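/- Let (SOCKP) be the problem: maximize $\sum_{j=1}^n p_jx_j$ subject to $\sum_j \hat a_jx_j+\Omega\sqrt{\sum_j\sigma_j^2x_j^2}\le b$, $x\in\{0,1\}^n$, where $n\ge 1$ and $p_j,\hat a_j,\sigma_j,\Omega,b$ are nonnegative integers. Put $m^*=\lceil \frac{\Omega}{2}\sqrt{n\sum_j\sigma_j^2}\,\rceil+1$. For $m\ge1$, $1\le j\le n$, $1\le k\le m$ let $d_j=\Omega\sigma_j/m$, $f_k=2k-1$. For a pair $l=(i,h)$ with $1\le i\le n$, $1\le h\le m$ and $r_l=d_i/f_h$, let $$B_l=\Big\{x\in\{0,1\}^n:\ \sum_{j}\hat a_jx_j+\sum_{(j,k):\,d_j/f_k>r_l}(d_j-r_lf_k)x_j\le b-r_lm^2\Big\},$$ and for one additional index $l=nm+1$ let $B_{nm+1}=\{x\in\{0,1\}^n:\sum_j(\hat a_j+m d_j)x_j\le b\}$. An ordinary binary knapsack problem (BKP) is: maximize $\sum_j p_jx_j$ subject to $\sum_j w_jx_j\le c$, $x\in\{0,1\}^n$, with $n\ge1$ and nonnegative integers $p_j,w_j,c$. Call an algorithm pseudo-polynomial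 if its running time, on a random access machine with logarithmic costs, is bounded by a polynomial in $n$ and the largest coefficient of the instance. There are an algorithm $A$ with one subroutine and a constant $C$ such that the following holds for every algorithm $R$ that finds an optimal solution of every BKP. With $R$ as its subroutine, $A$ finds an exact optimal solution of every (SOCKP) with integer coefficients as above. It calls $R$ at most $C\,m^*n$ times, on the problems of maximizing $\sum_j p_jx_j$ over $B_l$ with $m=m^*$ (the constraint being multiplied by the common denominator $m(2h-1)$, or $1$ for the additional index): every call is on such a problem, and every $B_l$ whose right-hand side is nonnegative is the subject of a call. If $R$ takes at most $T$ elementary operations on each of these problems, then $A$ takes at most $C\,m^*n\,(n+T)$ elementary operations, including those of $R$. If $R$ is pseudo-polynomial, then so is $A$ with $R$. Moreover, there is an algorithm $R$ that finds an optimal solution of every BKP, is pseudo-polynomial, and takes $O(nU)$ elementary operations on each BKP for which $U\ge1$ is an upper bound on the optimal value; with this $R$ as its subroutine, the pseudo-polynomial algorithm $A$ for (SOCKP) takes $O(m^*n^2U)$ elementary operations whenever $U\ge 1$ is an upper bound on the optimal values of all problems $B_l$ with $m=m^*$. -/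

import Mathlib

namespace Knap

/-! ## The two optimization problems -/

/-- `x` is a vector of zeros and ones. -/
def Binary {n : ℕ} (x : Fin n → ℤ) : Prop := ∀ j, x j = 0 ∨ x j = 1

/-- An instance of the ordinary binary knapsack problem:
maximize `∑ p j * x j` subject to `∑ w j * x j ≤ c`, `x` binary; all data are nonnegative integers. -/
structure BKP where
  n : ℕ
  w : Fin n → ℕ
  p : Fin n → ℕ
  c : ℕ

namespace BKP

def Feasible (B : BKP) (x : Fin B.n → ℤ) : Prop :=
  Binary x ∧ ∑ j, (B.w j : ℤ) * x j ≤ B.c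

def profit (B : BKP) (x : Fin B.n → ℤ) : ℤ := ∑ j, (B.p j : ℤ) * x j

def IsOptimal (B : BKP) (x : Fin B.n → ℤ) : Prop :=
  B.Feasible x ∧ ∀ y, B.Feasible y → B.profit y ≤ B.profit x

/-- The largest number occurring among the coefficients of the instance. -/
def maxCoeff (B : BKP) : ℕ :=
  max B.c (max (Finset.univ.sup B.w) (Finset.univ.sup B.p))

end BKP

/-- An instance, with integer coefficients, of the second-order cone-constrained binary knapsack
problem: maximize `∑ p j * x j` subject to
`∑ a j * x j + Ω * √(∑ (σ j)^2 * (x j)^2) ≤ b`, `x` binary. -/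
structure SOCKP where
  n : ℕ
  p : Fin n → ℕ
  a : Fin n → ℕ
  σ : Fin n → ℕ
  Ω : ℕ
  b : ℕ

namespace SOCKP

noncomputable section

def Feasible (I : SOCKP) (x : Fin I.n → ℤ) : Prop :=
  Binary x ∧
    ∑ j, (I.a j : ℝ) * (x j : ℝ)
      + (I.Ω : ℝ) * Real.sqrt (∑ j, (I.σ j : ℝ) ^ 2 * (x j : ℝ) ^ 2) ≤ (I.b : ℝ)

def profit (I : SOCKP) (x : Fin I.n → ℤ) : ℤ := ∑ j, (I.p j : ℤ) * x j

def IsOptimal (I : SOCKP) (x : Fin I.n → ℤ) : Prop :=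
  I.Feasible x ∧ ∀ y, I.Feasible y → I.profit y ≤ I.profit x

/-- The largest number occurring among the coefficients of the instance. -/
def maxCoeff (I : SOCKP) : ℕ :=
  max (max I.b I.Ω)
    (max (Finset.univ.sup I.p) (max (Finset.univ.sup I.a) (Finset.univ.sup I.σ)))

/-- `m* = ⌈Ω / 2 * √(n * ∑ (σ j)^2)⌉ + 1`. -/
def mstar (I : SOCKP) : ℕ :=
  ⌈(I.Ω : ℝ) / 2 * Real.sqrt ((I.n : ℝ) * ∑ j, (I.σ j : ℝ) ^ 2)⌉₊ + 1

/-! The knapsack problems `B_l`, for a number `m` of linear pieces and `Δ = m ^ 2`.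
The pair `(j, k) : Fin I.n × Fin m` stands for item `j` and piece number `k + 1`. An index `l` is
such a pair, or `none` for the additional index `n * m + 1`. The problem `B_l` depends on the pair
only, not on its rank in an ordering of the pairs. -/

/-- `d = Ω * σ j / m`. -/
def d (I : SOCKP) (m : ℕ) (j : Fin I.n) : ℚ := (I.Ω : ℚ) * (I.σ j : ℚ) / (m : ℚ)

/-- `f = 2 * (k + 1) - 1`. -/
def f {m : ℕ} (k : Fin m) : ℚ := 2 * ((k : ℕ) : ℚ) + 1

/-- The coefficient of `x j` in the constraint of `B_l`: for a pair `l` it is `a j` plus the sum of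
`d_{l'} - (d_l / f_l) * f_{l'}` over the pairs `l'` of item `j` with `d_{l'} / f_{l'} > d_l / f_l`;
for the additional index it is `a j` plus the sum of `d_{l'}` over all pairs `l'` of item `j`. -/
def subWeight (I : SOCKP) (m : ℕ) : Option (Fin I.n × Fin m) → Fin I.n → ℚ
  | some (i, h), j => (I.a j : ℚ)
      + ∑ k : Fin m with I.d m i / f h < I.d m j / f k, (I.d m j - I.d m i / f h * f k)
  | none, j => (I.a j : ℚ) + ∑ _k : Fin m, I.d m j

/-- The right-hand side of the constraint of `B_l`: `b - (d_l / f_l) * m ^ 2` for a pair, and `b`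
for the additional index. -/
def subCap (I : SOCKP) (m : ℕ) : Option (Fin I.n × Fin m) → ℚ
  | some (i, h) => (I.b : ℚ) - I.d m i / f h * (m : ℚ) ^ 2
  | none => (I.b : ℚ)

/-- `x` belongs to the feasible set `B_l`. -/
def InSub (I : SOCKP) (m : ℕ) (l : Option (Fin I.n × Fin m)) (x : Fin I.n → ℤ) : Prop :=
  Binary x ∧ ∑ j, I.subWeight m l j * (x j : ℚ) ≤ I.subCap m l

/-- The common denominator `m * (2 * (k + 1) - 1)` of the data of `B_l` (`1` for the additional
index). -/
def subScale (I : SOCKP) (m : ℕ) : Option (Fin I.n × Fin m) → ℚ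
  | some (_, h) => (m : ℚ) * f h
  | none => 1

/-- The instance `B` of the ordinary knapsack problem is the problem `B_l`, with its constraint
multiplied by the common denominator, so that all coefficients are integers. -/
def IsSub (I : SOCKP) (m : ℕ) (l : Option (Fin I.n × Fin m)) (B : BKP) : Prop :=
  ∃ h : B.n = I.n,
    (∀ j, B.p j = I.p (Fin.cast h j)) ∧
    (∀ j, (B.w j : ℚ) = I.subScale m l * I.subWeight m l (Fin.cast h j)) ∧
    (B.c : ℚ) = I.subScale m l * I.subCap m l

end

end SOCKP

/-! ## The machine model

Programs of a random access machine with integer registers (named scalar variables and named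
arrays of unbounded length), with structured control flow and one subroutine. Two costs are
recorded: the number of elementary operations (`steps`), and the logarithmic cost (`bits`), in which
every operation is charged with the binary lengths of the integers it deals with. -/

/-- Binary length of an integer, including the sign. -/
def len (z : ℤ) : ℕ := Nat.size z.natAbs + 1

structure State where
  var : ℕ → ℤ
  arr : ℕ → ℤ → ℤ

namespace State

def setVar (s : State) (v : ℕ) (z : ℤ) : State :=
  { s with var := Function.update s.var v z }

def setArr (s : State) (a : ℕ) (i z : ℤ) : State :=
  { s with arr := Function.update s.arr a (Function.update (s.arr a) i z) }

/-- Overwrite the entries `0, …, n - 1` of the array `a` by those of `g`. -/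
def copyArr (s : State) (a n : ℕ) (g : ℤ → ℤ) : State :=
  ⟨s.var, Function.update s.arr a (fun i => if 0 ≤ i ∧ i < (n : ℤ) then g i else s.arr a i)⟩

end State

inductive Expr where
  | const (z : ℤ)
  | var (v : ℕ)
  | get (a : ℕ) (i : Expr)
  | add (e₁ e₂ : Expr)
  | sub (e₁ e₂ : Expr)
  | mul (e₁ e₂ : Expr)
  | div (e₁ e₂ : Expr)

namespace Expr

/-- Value of an expression; `div` is integer division (and gives `0` for the divisor `0`). -/
def eval (s : State) : Expr → ℤ
  | const z => z
  | var v => s.var v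
  | get a i => s.arr a (i.eval s)
  | add e₁ e₂ => e₁.eval s + e₂.eval s
  | sub e₁ e₂ => e₁.eval s - e₂.eval s
  | mul e₁ e₂ => e₁.eval s * e₂.eval s
  | div e₁ e₂ => e₁.eval s / e₂.eval s

/-- Number of elementary operations in the evaluation. -/
def steps : Expr → ℕ
  | const _ => 1
  | var _ => 1
  | get _ i => i.steps + 1
  | add e₁ e₂ => e₁.steps + e₂.steps + 1
  | sub e₁ e₂ => e₁.steps + e₂.steps + 1
  | mul e₁ e₂ => e₁.steps + e₂.steps + 1
  | div e₁ e₂ => e₁.steps + e₂.steps + 1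

/-- Sum of the binary lengths of all values that occur in the evaluation. -/
def bits (s : State) : Expr → ℕ
  | const z => len z
  | var v => len (s.var v)
  | get a i => i.bits s + len ((get a i).eval s)
  | add e₁ e₂ => e₁.bits s + e₂.bits s + len ((add e₁ e₂).eval s)
  | sub e₁ e₂ => e₁.bits s + e₂.bits s + len ((sub e₁ e₂).eval s)
  | mul e₁ e₂ => e₁.bits s + e₂.bits s + len ((mul e₁ e₂).eval s)
  | div e₁ e₂ => e₁.bits s + e₂.bits s + len ((div e₁ e₂).eval s)

end Expr

inductive Cmd where
  | skip
  /-- `v := e` -/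
  | assign (v : ℕ) (e : Expr)
  /-- `a[i] := e` -/
  | store (a : ℕ) (i e : Expr)
  | seq (c₁ c₂ : Cmd)
  /-- if `e₁ ≤ e₂` then `c₁` else `c₂` -/
  | ite (e₁ e₂ : Expr) (c₁ c₂ : Cmd)
  /-- while `e₁ ≤ e₂` do `c` -/
  | loop (e₁ e₂ : Expr) (c : Cmd)
  /-- Call the subroutine on the knapsack instance with number of items in the variable `vn`,
  capacity in the variable `vc`, weights in the array `aw` and profits in the array `ap`; its output
  is written to the array `ax`. -/
  | call (vn vc aw ap ax : ℕ)

/-- Cost of an execution, with the list of the instances on which the subroutine was called. -/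
structure Cost where
  steps : ℕ
  bits : ℕ
  calls : List BKP

namespace Cost

/-- Cost of consecutive executions. -/
def add (k₁ k₂ : Cost) : Cost :=
  ⟨k₁.steps + k₂.steps, k₁.bits + k₂.bits, k₁.calls ++ k₂.calls⟩

/-- One operation that evaluates the expression `e`. -/
def one (s : State) (e : Expr) : Cost := ⟨e.steps + 1, e.bits s + 1, []⟩

/-- One operation that evaluates two expressions. -/
def two (s : State) (e₁ e₂ : Expr) : Cost :=
  ⟨e₁.steps + e₂.steps + 1, e₁.bits s + e₂.bits s + 1, []⟩

/-- A call on the instance `B` with output `g`: the input and the output are transferred, and the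
subroutine runs at cost `k`. -/
def ofCall (B : BKP) (g : ℤ → ℤ) (k : Cost) : Cost :=
  ⟨k.steps + (3 * B.n + 3),
   k.bits + (∑ j, (len (B.w j) + len (B.p j) + len (g ((j : ℕ) : ℤ))) + len B.n + len B.c + 1),
   [B]⟩

end Cost

/-- The knapsack instance found in the memory by a call. -/
def State.readBKP (s : State) (vn vc aw ap : ℕ) : BKP where
  n := (s.var vn).toNat
  w := fun j => (s.arr aw ((j : ℕ) : ℤ)).toNat
  p := fun j => (s.arr ap ((j : ℕ) : ℤ)).toNat
  c := (s.var vc).toNat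

/-- `Exec Sub c s t k`: started in the state `s`, the command `c` terminates in the state `t` at cost
`k`. Here `Sub B g k` says that the subroutine, called on `B`, terminates with output `g` at
cost `k`. -/
inductive Exec (Sub : BKP → (ℤ → ℤ) → Cost → Prop) : Cmd → State → State → Cost → Prop where
  | skip (s : State) : Exec Sub Cmd.skip s s ⟨1, 1, []⟩
  | assign (s : State) (v : ℕ) (e : Expr) :
      Exec Sub (Cmd.assign v e) s (s.setVar v (e.eval s)) (Cost.one s e)
  | store (s : State) (a : ℕ) (i e : Expr) :
      Exec Sub (Cmd.store a i e) s (s.setArr a (i.eval s) (e.eval s)) (Cost.two s i e)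
  | seq {c₁ c₂ : Cmd} {s t u : State} {k₁ k₂ : Cost} :
      Exec Sub c₁ s t k₁ → Exec Sub c₂ t u k₂ → Exec Sub (Cmd.seq c₁ c₂) s u (k₁.add k₂)
  | iteTrue {e₁ e₂ : Expr} {c₁ c₂ : Cmd} {s t : State} {k : Cost} :
      e₁.eval s ≤ e₂.eval s → Exec Sub c₁ s t k →
      Exec Sub (Cmd.ite e₁ e₂ c₁ c₂) s t ((Cost.two s e₁ e₂).add k)
  | iteFalse {e₁ e₂ : Expr} {c₁ c₂ : Cmd} {s t : State} {k : Cost} :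
      ¬ e₁.eval s ≤ e₂.eval s → Exec Sub c₂ s t k →
      Exec Sub (Cmd.ite e₁ e₂ c₁ c₂) s t ((Cost.two s e₁ e₂).add k)
  | loopTrue {e₁ e₂ : Expr} {c : Cmd} {s t u : State} {k₁ k₂ : Cost} :
      e₁.eval s ≤ e₂.eval s → Exec Sub c s t k₁ → Exec Sub (Cmd.loop e₁ e₂ c) t u k₂ →
      Exec Sub (Cmd.loop e₁ e₂ c) s u ((Cost.two s e₁ e₂).add (k₁.add k₂))
  | loopFalse {e₁ e₂ : Expr} {c : Cmd} {s : State} :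
      ¬ e₁.eval s ≤ e₂.eval s → Exec Sub (Cmd.loop e₁ e₂ c) s s (Cost.two s e₁ e₂)
  | call {s : State} {vn vc aw ap ax : ℕ} {g : ℤ → ℤ} {k : Cost} :
      Sub (s.readBKP vn vc aw ap) g k →
      Exec Sub (Cmd.call vn vc aw ap ax) s
        (s.copyArr ax (s.readBKP vn vc aw ap).n g)
        (Cost.ofCall (s.readBKP vn vc aw ap) g k)

/-- Execution is deterministic if the subroutine is. -/
theorem Exec.det {Sub : BKP → (ℤ → ℤ) → Cost → Prop}
    (hS : ∀ B g₁ k₁ g₂ k₂, Sub B g₁ k₁ → Sub B g₂ k₂ → g₁ = g₂ ∧ k₁ = k₂)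
    {c : Cmd} {s t₁ : State} {k₁ : Cost} (h₁ : Exec Sub c s t₁ k₁) :
    ∀ {t₂ : State} {k₂ : Cost}, Exec Sub c s t₂ k₂ → t₁ = t₂ ∧ k₁ = k₂ := by
  induction h₁ with
  | skip s => intro t₂ k₂ h; cases h; exact ⟨rfl, rfl⟩
  | assign s v e => intro t₂ k₂ h; cases h; exact ⟨rfl, rfl⟩
  | store s a i e => intro t₂ k₂ h; cases h; exact ⟨rfl, rfl⟩
  | seq _ _ ih₁ ih₂ =>
    intro t₂ k₂ h
    cases h with
    | seq g₁ g₂ =>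
      obtain ⟨rfl, rfl⟩ := ih₁ g₁
      obtain ⟨rfl, rfl⟩ := ih₂ g₂
      exact ⟨rfl, rfl⟩
  | iteTrue hc _ ih =>
    intro t₂ k₂ h
    cases h with
    | iteTrue _ g => obtain ⟨rfl, rfl⟩ := ih g; exact ⟨rfl, rfl⟩
    | iteFalse hn _ => exact absurd hc hn
  | iteFalse hc _ ih =>
    intro t₂ k₂ h
    cases h with
    | iteTrue hn _ => exact absurd hn hc
    | iteFalse _ g => obtain ⟨rfl, rfl⟩ := ih g; exact ⟨rfl, rfl⟩
  | loopTrue hc _ _ ih₁ ih₂ =>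
    intro t₂ k₂ h
    cases h with
    | loopTrue _ g₁ g₂ =>
      obtain ⟨rfl, rfl⟩ := ih₁ g₁
      obtain ⟨rfl, rfl⟩ := ih₂ g₂
      exact ⟨rfl, rfl⟩
    | loopFalse hn => exact absurd hc hn
  | loopFalse hc =>
    intro t₂ k₂ h
    cases h with
    | loopTrue hn _ _ => exact absurd hn hc
    | loopFalse _ => exact ⟨rfl, rfl⟩
  | call hg =>
    intro t₂ k₂ h
    cases h with
    | call hg' =>
      obtain ⟨rfl, rfl⟩ := hS _ _ _ _ _ hg hg'
      exact ⟨rfl, rfl⟩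

/-! ## Input, output, and running times -/

/-- A vector as the beginning of an array that is zero elsewhere. -/
def toArr {n : ℕ} (v : Fin n → ℕ) (i : ℤ) : ℤ :=
  if h : 0 ≤ i ∧ i.toNat < n then (v ⟨i.toNat, h.2⟩ : ℤ) else 0

/-- The vector formed by the first `n` entries of an array. -/
def ofArr (n : ℕ) (g : ℤ → ℤ) : Fin n → ℤ := fun j => g ((j : ℕ) : ℤ)

/-- Initial memory of a program for the ordinary knapsack problem: `n`, `c` in the variables `0`,
`1`, and `w`, `p` in the arrays `0`, `1`; everything else is zero. -/
def BKP.load (B : BKP) : State where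
  var := fun v => if v = 0 then B.n else if v = 1 then B.c else 0
  arr := fun a => if a = 0 then toArr B.w else if a = 1 then toArr B.p else fun _ => 0

/-- Initial memory of a program for (SOCKP): `n`, `b`, `Ω` in the variables `0`, `1`, `2`, and
`a`, `p`, `σ` in the arrays `0`, `1`, `2`; everything else is zero. -/
def SOCKP.load (I : SOCKP) : State where
  var := fun v => if v = 0 then I.n else if v = 1 then I.b else if v = 2 then I.Ω else 0
  arr := fun a =>
    if a = 0 then toArr I.a else if a = 1 then toArr I.p else if a = 2 then toArr I.σ
    else fun _ => 0

/-- The program `R`, without any subroutine, terminates on the knapsack instance `B` at cost `k`,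
with the array `g` as its output (array `2`). -/
def RunsBKP (R : Cmd) (B : BKP) (g : ℤ → ℤ) (k : Cost) : Prop :=
  ∃ t, Exec (fun _ _ _ => False) R B.load t k ∧ t.arr 2 = g

/-- The program `A`, with the program `R` as its subroutine, terminates on the instance `I` of
(SOCKP) at cost `k` (including the cost of the subroutine), with the array `g` as its output
(array `3`). -/
def RunsSOCKP (A R : Cmd) (I : SOCKP) (g : ℤ → ℤ) (k : Cost) : Prop :=
  ∃ t, Exec (RunsBKP R) A I.load t k ∧ t.arr 3 = g

/-- The program `R` finds an optimal solution of every ordinary knapsack problem. -/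
def SolvesBKP (R : Cmd) : Prop :=
  ∀ B : BKP, 0 < B.n → ∃ g k, RunsBKP R B g k ∧ B.IsOptimal (ofArr B.n g)

/-- The program `A` with subroutine `R` finds an optimal solution of every problem (SOCKP) with
integer coefficients. -/
def SolvesSOCKP (A R : Cmd) : Prop :=
  ∀ I : SOCKP, 0 < I.n → ∃ g k, RunsSOCKP A R I g k ∧ I.IsOptimal (ofArr I.n g)

/-- The running time (in the logarithmic cost measure) of the program `R` for the ordinary knapsack
problem is polynomial in the number of items and the largest coefficient. -/
def PseudoPolyBKP (R : Cmd) : Prop :=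
  ∃ D e : ℕ, ∀ B : BKP, 0 < B.n → ∀ g k, RunsBKP R B g k →
    k.bits ≤ D * (B.n + B.maxCoeff) ^ e

/-- The running time (in the logarithmic cost measure) of the program `A` with subroutine `R` for
(SOCKP) is polynomial in the number of items and the largest coefficient. -/
def PseudoPolySOCKP (A R : Cmd) : Prop :=
  ∃ D e : ℕ, ∀ I : SOCKP, 0 < I.n → ∀ g k, RunsSOCKP A R I g k →
    k.bits ≤ D * (I.n + I.maxCoeff) ^ e

/-- `R` needs at most `C * n * U` elementary operations on each knapsack problem with `n` items for
which `U ≥ 1` is an upper bound on the optimal value. -/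
def ProfitTimeBKP (R : Cmd) (C : ℕ) : Prop :=
  ∀ B : BKP, 0 < B.n → ∀ U : ℕ, 1 ≤ U → (∀ x, B.Feasible x → B.profit x ≤ U) →
    ∀ g k, RunsBKP R B g k → k.steps ≤ C * (B.n * U)

/-- `A` with subroutine `R` needs at most `C * m* * n ^ 2 * U` elementary operations on each problem
(SOCKP) with `n` items for which `U ≥ 1` is an upper bound on the optimal values of the knapsack
problems `B_l`. -/
def ProfitTimeSOCKP (A R : Cmd) (C : ℕ) : Prop :=
  ∀ I : SOCKP, 0 < I.n → ∀ U : ℕ, 1 ≤ U →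
    (∀ l x, I.InSub I.mstar l x → I.profit x ≤ U) →
    ∀ g k, RunsSOCKP A R I g k → k.steps ≤ C * (I.mstar * I.n ^ 2 * U)

/-- `A` with subroutine `R` works by solving the knapsack problems `B_l` for `m = m*` with `R`: it
calls `R` at most `C * m* * n` times, each time on one of the problems `B_l`, and on each of the
problems `B_l` with nonnegative capacity (the others have no feasible solution). -/
def CallsSubproblems (A R : Cmd) (C : ℕ) : Prop :=
  ∀ I : SOCKP, 0 < I.n → ∀ g k, RunsSOCKP A R I g k →
    k.calls.length ≤ C * (I.mstar * I.n) ∧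
    (∀ B ∈ k.calls, ∃ l, I.IsSub I.mstar l B) ∧
    (∀ l, 0 ≤ I.subCap I.mstar l → ∃ B ∈ k.calls, I.IsSub I.mstar l B)

/-- If `R` takes at most `T` elementary operations on each of the problems `B_l`, then `A` with
subroutine `R` takes at most `C * m* * n * (n + T)` elementary operations. -/
def ReductionTime (A R : Cmd) (C : ℕ) : Prop :=
  ∀ I : SOCKP, 0 < I.n → ∀ T : ℕ,
    (∀ l B, I.IsSub I.mstar l B → ∀ g k, RunsBKP R B g k → k.steps ≤ T) →
    ∀ g k, RunsSOCKP A R I g k → k.steps ≤ C * (I.mstar * I.n * (I.n + T))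

end Knap

/-! ### Operation costs in states with bounded registers -/

namespace Knap

/-! Write T(x) for the cone term of a binary vector x. By Cauchy-Schwarz, T(x) is the maximum of ∑
d_j x_j y_j over real y with ∑ x_j y_j² ≤ m². Restrict the y_j to the integers 0, …, m and dualize
the constraint with a multiplier z ≥ 0. For one item, the maximum of K d_j - z K² over K ≤ m is the
sum of the positive parts of d_j - z(2k+1), because the odd numbers sum to squares; this is
`pieceSum`. The dual function is `dualBound`, and `inSub_iff` identifies `B_l` with the condition
that the linear part plus `dualBound` at z = r_l is at most b.

The union of the `B_l` for m = m* is exactly the feasible set (`feasible_iff_exists_inSub`). A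
feasible x lies in some `B_l`: at z = T/(2m²) the dual function is at most T, and, being piecewise
linear in z, it is no larger at 0 or at some breakpoint d_i/f_h (`exists_dualBound_le`,
`exists_breakpoint_le`). Conversely, rounding y to integers loses at most z/4 per item, which gives
`dualBound`² ≥ T² - T²n/(4m²) for every z ≥ 0 (`le_dualBound_sq`). For m = m* the loss is less than
1. Since T² and b - ∑ a_j x_j are integers, an x in `B_l` satisfies the cone constraint exactly,
without any error.

The algorithm therefore solves all `B_l` of nonnegative capacity and keeps the best solution. The
number of positive pieces of an item is found by one division, so that `B_l` is set up in O(n)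
operations and the reduction costs O(m* n (n + T)) for subroutine time T. Registers stay polynomial
in n, m* and the largest coefficient, and m* is itself polynomial in these (`mstar_le`), which gives
pseudo-polynomiality.

The concrete subroutine is dynamic programming over profits. It scans only profits up to the largest
one reached so far; hence the bound O(nU), although U is unknown to the program.

Programs are verified with `Wp`, a weakest precondition with total correctness that also tracks the
number of operations, a common register bound and the list of calls. A single factor `unitCost`
converts operations into logarithmic cost. -/

theorem len_le (z : ℤ) : len z ≤ z.natAbs + 1 := by
  have : Nat.size z.natAbs ≤ z.natAbs := Nat.size_le.2 Nat.lt_two_pow_self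
  simp only [len]
  omega

theorem natAbs_le_of_abs_le {z : ℤ} {X : ℕ} (h : |z| ≤ (X : ℤ)) : z.natAbs ≤ X := by
  rw [Int.abs_eq_natAbs] at h
  exact_mod_cast h

theorem abs_toNat_le {z : ℤ} {X : ℕ} (h : |z| ≤ (X : ℤ)) : |(z.toNat : ℤ)| ≤ (X : ℤ) := by
  have := natAbs_le_of_abs_le h
  rw [abs_of_nonneg (by omega)]
  omega

@[simp] theorem State.setVar_var (s : State) (v w : ℕ) (z : ℤ) :
    (s.setVar v z).var w = if w = v then z else s.var w := by
  simp [State.setVar, Function.update_apply]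

@[simp] theorem State.setVar_arr (s : State) (v : ℕ) (z : ℤ) : (s.setVar v z).arr = s.arr := rfl

@[simp] theorem State.setArr_var (s : State) (a : ℕ) (i z : ℤ) : (s.setArr a i z).var = s.var := rfl

@[simp] theorem State.setArr_arr (s : State) (a b : ℕ) (i z : ℤ) :
    (s.setArr a i z).arr b = if b = a then Function.update (s.arr a) i z else s.arr b := by
  simp [State.setArr, Function.update_apply]

@[simp] theorem State.copyArr_arr (s : State) (a b n : ℕ) (g : ℤ → ℤ) :
    (s.copyArr a n g).arr b =
      if b = a then (fun i => if 0 ≤ i ∧ i < (n : ℤ) then g i else s.arr a i) else s.arr b := by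
  simp [State.copyArr, Function.update_apply]

/-- Every register of `s` holds a number of absolute value at most `X`. -/
def State.Bounded (X : ℕ) (s : State) : Prop :=
  (∀ v, |s.var v| ≤ (X : ℤ)) ∧ ∀ a i, |s.arr a i| ≤ (X : ℤ)

theorem State.Bounded.setVar {X : ℕ} {s : State} (h : s.Bounded X) (v : ℕ) {z : ℤ}
    (hz : |z| ≤ (X : ℤ)) : (s.setVar v z).Bounded X := by
  refine ⟨fun w => ?_, h.2⟩
  rw [State.setVar_var]
  split_ifs
  exacts [hz, h.1 w]

theorem State.Bounded.setArr {X : ℕ} {s : State} (h : s.Bounded X) (a : ℕ) (i : ℤ) {z : ℤ}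
    (hz : |z| ≤ (X : ℤ)) : (s.setArr a i z).Bounded X := by
  refine ⟨h.1, fun b j => ?_⟩
  rw [State.setArr_arr]
  split_ifs
  · rw [Function.update_apply]
    split_ifs
    exacts [hz, h.2 _ _]
  · exact h.2 _ _

theorem State.Bounded.copyArr {X : ℕ} {s : State} (h : s.Bounded X) (a n : ℕ) {g : ℤ → ℤ}
    (hg : ∀ i : ℤ, 0 ≤ i → i < n → |g i| ≤ (X : ℤ)) : (s.copyArr a n g).Bounded X := by
  refine ⟨h.1, fun b j => ?_⟩
  rw [State.copyArr_arr]
  split_ifs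
  · dsimp only
    split_ifs with hj
    exacts [hg j hj.1 hj.2, h.2 _ _]
  · exact h.2 _ _

namespace Expr

/-- All constants of the expression have absolute value at most `4`. -/
def smallConsts : Expr → Bool
  | const z => z.natAbs ≤ 4
  | var _ => true
  | get _ i => i.smallConsts
  | add e₁ e₂ => e₁.smallConsts && e₂.smallConsts
  | sub e₁ e₂ => e₁.smallConsts && e₂.smallConsts
  | mul e₁ e₂ => e₁.smallConsts && e₂.smallConsts
  | div e₁ e₂ => e₁.smallConsts && e₂.smallConsts

/-- The base X + 4 dominates registers and constants, and it is at least 2, so that one additional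
exponent absorbs a sum. Products add exponents, and integer division does not increase absolute
values. -/
theorem natAbs_eval_le {X : ℕ} {s : State} (hs : s.Bounded X) :
    ∀ e : Expr, e.smallConsts = true → (e.eval s).natAbs ≤ (X + 4) ^ e.steps := by
  have hvar : ∀ v, (s.var v).natAbs ≤ X := fun v => natAbs_le_of_abs_le (hs.1 v)
  have harr : ∀ a i, (s.arr a i).natAbs ≤ X := fun a i => natAbs_le_of_abs_le (hs.2 a i)
  have hpow : ∀ a b : ℕ, (X + 4) ^ a + (X + 4) ^ b ≤ (X + 4) ^ (a + b + 1) := by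
    intro a b
    have h1 : (X + 4) ^ a ≤ (X + 4) ^ (a + b) := Nat.pow_le_pow_right (by omega) (by omega)
    have h2 : (X + 4) ^ b ≤ (X + 4) ^ (a + b) := Nat.pow_le_pow_right (by omega) (by omega)
    have h3 : (X + 4) ^ (a + b) * 2 ≤ (X + 4) ^ (a + b) * (X + 4) :=
      Nat.mul_le_mul_left _ (by omega)
    rw [pow_succ]
    omega
  have hle : ∀ a b : ℕ, a ≤ b → (X + 4) ^ a ≤ (X + 4) ^ b := fun a b h =>
    Nat.pow_le_pow_right (by omega) h
  intro e
  induction e with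
  | const z =>
    intro h
    simp only [smallConsts, decide_eq_true_eq] at h
    simp only [eval, steps, pow_one]
    omega
  | var v =>
    intro _
    simp only [eval, steps, pow_one]
    have := hvar v
    omega
  | get a i ih =>
    intro _
    simp only [eval, steps]
    refine (harr a _).trans ?_
    calc X ≤ (X + 4) ^ 1 := by simp
      _ ≤ _ := hle _ _ (by omega)
  | add e₁ e₂ ih₁ ih₂ =>
    intro h
    simp only [smallConsts, Bool.and_eq_true] at h
    simp only [eval, steps]
    exact (Int.natAbs_add_le _ _).trans ((add_le_add (ih₁ h.1) (ih₂ h.2)).trans (hpow _ _))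
  | sub e₁ e₂ ih₁ ih₂ =>
    intro h
    simp only [smallConsts, Bool.and_eq_true] at h
    simp only [eval, steps]
    exact (Int.natAbs_sub_le _ _).trans ((add_le_add (ih₁ h.1) (ih₂ h.2)).trans (hpow _ _))
  | mul e₁ e₂ ih₁ ih₂ =>
    intro h
    simp only [smallConsts, Bool.and_eq_true] at h
    simp only [eval, steps]
    rw [Int.natAbs_mul]
    refine (Nat.mul_le_mul (ih₁ h.1) (ih₂ h.2)).trans ?_
    rw [← pow_add]
    exact hle _ _ (by omega)
  | div e₁ e₂ ih₁ ih₂ =>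
    intro h
    simp only [smallConsts, Bool.and_eq_true] at h
    simp only [eval, steps]
    exact (Int.natAbs_ediv_le_natAbs _ _).trans ((ih₁ h.1).trans (hle _ _ (by omega)))

/-- The largest number of operations allowed in a single expression. -/
def maxSteps : ℕ := 30

/-- A syntactic condition that bounds the values of an expression in terms of the registers. -/
def small (e : Expr) : Bool := e.smallConsts && decide (e.steps ≤ maxSteps)

end Expr

/-- A bound on the logarithmic cost of one operation in states bounded by `X`. -/
def unitCost (X : ℕ) : ℕ := (X + 4) ^ Expr.maxSteps + 1

theorem le_unitCost (X : ℕ) : X + 2 ≤ unitCost X := by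
  have : (X + 4) ^ 1 ≤ (X + 4) ^ Expr.maxSteps :=
    Nat.pow_le_pow_right (by omega) (by simp [Expr.maxSteps])
  rw [pow_one] at this
  simp only [unitCost]
  omega

theorem len_le_unitCost {X : ℕ} {z : ℤ} (h : |z| ≤ (X : ℤ)) : len z ≤ unitCost X := by
  have h1 := len_le z
  have h2 := le_unitCost X
  have h3 := natAbs_le_of_abs_le h
  omega

/-- The logarithmic cost is a sum over the nodes of the expression, and there are `steps` nodes.
Each subexpression is again `small`, so each node contributes at most `unitCost X`. -/
theorem Expr.bits_le {X : ℕ} {s : State} (hs : s.Bounded X) {e : Expr} (he : e.small = true) :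
    e.bits s ≤ e.steps * unitCost X := by
  have key : ∀ e' : Expr, e'.small = true → len (e'.eval s) ≤ unitCost X := by
    intro e' h
    simp only [small, Bool.and_eq_true, decide_eq_true_eq] at h
    have h1 := natAbs_eval_le hs e' h.1
    have h2 := len_le (e'.eval s)
    have h3 : (X + 4) ^ e'.steps ≤ (X + 4) ^ maxSteps := Nat.pow_le_pow_right (by omega) h.2
    simp only [unitCost]
    omega
  induction e with
  | const z => simpa [bits, steps, eval] using key _ he
  | var v => simpa [bits, steps, eval] using key _ he
  | get a i ih =>
    have h0 := key _ he
    have h1 : i.small = true := by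
      simp only [small, smallConsts, steps, Bool.and_eq_true, decide_eq_true_eq] at he ⊢
      have := of_decide_eq_true he.2
      exact ⟨he.1, by omega⟩
    have := ih h1
    simp only [bits, steps, add_mul, one_mul]
    omega
  | add e₁ e₂ ih₁ ih₂ | sub e₁ e₂ ih₁ ih₂ | mul e₁ e₂ ih₁ ih₂ | div e₁ e₂ ih₁ ih₂ =>
    have h0 := key _ he
    have h1 : e₁.small = true ∧ e₂.small = true := by
      simp only [small, smallConsts, steps, Bool.and_eq_true, decide_eq_true_eq] at he ⊢
      have := of_decide_eq_true he.2
      exact ⟨⟨he.1.1, by omega⟩, he.1.2, by omega⟩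
    have i1 := ih₁ h1.1
    have i2 := ih₂ h1.2
    simp only [bits, steps, add_mul, one_mul]
    omega

/-- A subroutine with its cost on every instance, and a bound for the registers. -/
structure Env where
  Sub : BKP → (ℤ → ℤ) → Cost → Prop
  cost : BKP → Cost
  X : ℕ

/-- `Wp E c s cs a Q`: started in the state `s`, after calls on the instances `cs`, the command `c`
terminates such that `Q` holds for the final state and the list of all calls. It needs at most `a`
operations besides those of the subroutine, and all registers stay bounded by `E.X`. -/
def Wp (E : Env) (c : Cmd) (s : State) (cs : List BKP) (a : ℕ) (Q : State → List BKP → Prop) :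
    Prop :=
  s.Bounded E.X → ∃ t k, Exec E.Sub c s t k ∧ t.Bounded E.X ∧
    k.steps ≤ a + (k.calls.map fun B => (E.cost B).steps).sum ∧
    k.bits ≤ a * unitCost E.X + (k.calls.map fun B => (E.cost B).bits).sum ∧
    Q t (cs ++ k.calls)

/-! ### A weakest-precondition calculus with costs -/

namespace Wp

variable {E : Env} {s : State} {cs : List BKP} {Q : State → List BKP → Prop}

theorem mono {c : Cmd} {a a' : ℕ} {Q' : State → List BKP → Prop} (h : Wp E c s cs a Q)
    (ha : a ≤ a') (hQ : ∀ t ds, Q t ds → Q' t ds) : Wp E c s cs a' Q' := by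
  intro hs
  obtain ⟨t, k, h1, h2, h3, h4, h5⟩ := h hs
  have := Nat.mul_le_mul_right (unitCost E.X) ha
  exact ⟨t, k, h1, h2, by omega, by omega, hQ _ _ h5⟩

theorem le {c : Cmd} {a a' : ℕ} (h : Wp E c s cs a Q) (ha : a ≤ a') : Wp E c s cs a' Q :=
  h.mono ha fun _ _ h => h

theorem skip (h : Q s cs) : Wp E Cmd.skip s cs 1 Q := by
  intro hs
  refine ⟨s, _, Exec.skip s, hs, by simp, ?_, by simpa using h⟩
  have := le_unitCost E.X
  simp
  omega

theorem assign {v : ℕ} {e : Expr} (he : e.small = true) (hv : |e.eval s| ≤ (E.X : ℤ))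
    (h : Q (s.setVar v (e.eval s)) cs) : Wp E (Cmd.assign v e) s cs (e.steps + 1) Q := by
  intro hs
  refine ⟨_, _, Exec.assign s v e, hs.setVar v hv, by simp [Cost.one], ?_,
    by simpa [Cost.one] using h⟩
  have h1 := le_unitCost E.X
  have h2 := Expr.bits_le hs he
  simp only [Cost.one, List.map_nil, List.sum_nil, add_mul, one_mul]
  omega

theorem store {a : ℕ} {i e : Expr} (hi : i.small = true) (he : e.small = true)
    (hv : |e.eval s| ≤ (E.X : ℤ)) (h : Q (s.setArr a (i.eval s) (e.eval s)) cs) :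
    Wp E (Cmd.store a i e) s cs (i.steps + e.steps + 1) Q := by
  intro hs
  refine ⟨_, _, Exec.store s a i e, hs.setArr a _ hv, by simp [Cost.two], ?_,
    by simpa [Cost.two] using h⟩
  have h1 := le_unitCost E.X
  have h2 := Expr.bits_le hs he
  have h3 := Expr.bits_le hs hi
  simp only [Cost.two, List.map_nil, List.sum_nil, add_mul, one_mul]
  omega

theorem seq {c₁ c₂ : Cmd} {a₁ a₂ : ℕ}
    (h : Wp E c₁ s cs a₁ fun t ds => Wp E c₂ t ds a₂ Q) :
    Wp E (Cmd.seq c₁ c₂) s cs (a₁ + a₂) Q := by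
  intro hs
  obtain ⟨t, k, h1, h2, h3, h4, h5⟩ := h hs
  obtain ⟨u, k', g1, g2, g3, g4, g5⟩ := h5 h2
  refine ⟨u, _, Exec.seq h1 g1, g2, ?_, ?_, ?_⟩
  · simp only [Cost.add, List.map_append, List.sum_append]
    omega
  · simp only [Cost.add, List.map_append, List.sum_append, add_mul]
    omega
  · simpa [Cost.add] using g5

theorem ite {e₁ e₂ : Expr} {c₁ c₂ : Cmd} {a : ℕ} (h₁ : e₁.small = true) (h₂ : e₂.small = true)
    (ht : e₁.eval s ≤ e₂.eval s → Wp E c₁ s cs a Q)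
    (hf : ¬ e₁.eval s ≤ e₂.eval s → Wp E c₂ s cs a Q) :
    Wp E (Cmd.ite e₁ e₂ c₁ c₂) s cs (e₁.steps + e₂.steps + 1 + a) Q := by
  intro hs
  have b1 := Expr.bits_le hs h₁
  have b2 := Expr.bits_le hs h₂
  have b3 := le_unitCost E.X
  by_cases hc : e₁.eval s ≤ e₂.eval s
  · obtain ⟨t, k, g1, g2, g3, g4, g5⟩ := ht hc hs
    refine ⟨t, _, Exec.iteTrue hc g1, g2, ?_, ?_, ?_⟩
    · simp only [Cost.add, Cost.two, List.nil_append]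
      omega
    · simp only [Cost.add, Cost.two, List.nil_append, add_mul, one_mul]
      omega
    · simpa [Cost.add, Cost.two] using g5
  · obtain ⟨t, k, g1, g2, g3, g4, g5⟩ := hf hc hs
    refine ⟨t, _, Exec.iteFalse hc g1, g2, ?_, ?_, ?_⟩
    · simp only [Cost.add, Cost.two, List.nil_append]
      omega
    · simp only [Cost.add, Cost.two, List.nil_append, add_mul, one_mul]
      omega
    · simpa [Cost.add, Cost.two] using g5

/-- A loop that is executed `N` times, with an invariant that counts the iterations. -/
theorem loop {e₁ e₂ : Expr} {c : Cmd} {a : ℕ} (N : ℕ) (Inv : ℕ → State → List BKP → Prop)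
    (h₁ : e₁.small = true) (h₂ : e₂.small = true) (h0 : Inv 0 s cs)
    (hstep : ∀ i < N, ∀ t ds, Inv i t ds →
      e₁.eval t ≤ e₂.eval t ∧ Wp E c t ds a (Inv (i + 1)))
    (hend : ∀ t ds, Inv N t ds → ¬ e₁.eval t ≤ e₂.eval t ∧ Q t ds) :
    Wp E (Cmd.loop e₁ e₂ c) s cs ((N + 1) * (e₁.steps + e₂.steps + 1 + a)) Q := by
  -- Induction on the number r of remaining iterations. There is one more test than there are
  -- bodies; the final test is charged a full round.
  have main : ∀ r i, i + r = N → ∀ s cs, Inv i s cs →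
      Wp E (Cmd.loop e₁ e₂ c) s cs ((r + 1) * (e₁.steps + e₂.steps + 1 + a)) Q := by
    intro r
    induction r with
    | zero =>
      intro i hi s cs hI hs
      obtain rfl : i = N := by omega
      have b1 := Expr.bits_le hs h₁
      have b2 := Expr.bits_le hs h₂
      have b3 := le_unitCost E.X
      obtain ⟨hc, hq⟩ := hend s cs hI
      refine ⟨s, _, Exec.loopFalse hc, hs, ?_, ?_, ?_⟩
      · simp only [Cost.two]
        omega
      · simp only [Cost.two, zero_add, one_mul, add_mul]
        omega
      · simpa [Cost.two] using hq
    | succ r ih =>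
      intro i hi s cs hI hs
      have b1 := Expr.bits_le hs h₁
      have b2 := Expr.bits_le hs h₂
      have b3 := le_unitCost E.X
      obtain ⟨hc, hw⟩ := hstep i (by omega) s cs hI
      obtain ⟨t, k, g1, g2, g3, g4, g5⟩ := hw hs
      obtain ⟨u, k', f1, f2, f3, f4, f5⟩ := ih (i + 1) (by omega) t _ g5 g2
      refine ⟨u, _, Exec.loopTrue hc g1 f1, f2, ?_, ?_, ?_⟩
      · simp only [Cost.add, Cost.two, List.nil_append, List.map_append, List.sum_append]
        rw [add_mul (r + 1) 1]
        omega
      · simp only [Cost.add, Cost.two, List.nil_append, List.map_append, List.sum_append]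
        rw [add_mul (r + 1) 1, add_mul (_ * _) (1 * _), one_mul]
        simp only [add_mul (_ + _) _ (unitCost E.X), add_mul _ _ (unitCost E.X), one_mul] at *
        omega
      · simpa [Cost.add, Cost.two] using f5
  exact main N 0 (by omega) s cs h0

/-- The instance consists of registers truncated at 0, so all transferred numbers inherit the
register bound; the output is bounded by `hg`. Three numbers per item and a constant overhead match
the charge 3n + 3. -/
theorem call {vn vc aw ap ax : ℕ} {g : ℤ → ℤ}
    (hsub : E.Sub (s.readBKP vn vc aw ap) g (E.cost (s.readBKP vn vc aw ap)))
    (hg : ∀ i : ℤ, 0 ≤ i → i < (s.readBKP vn vc aw ap).n → |g i| ≤ (E.X : ℤ))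
    (h : Q (s.copyArr ax (s.readBKP vn vc aw ap).n g) (cs ++ [s.readBKP vn vc aw ap])) :
    Wp E (Cmd.call vn vc aw ap ax) s cs (3 * (s.readBKP vn vc aw ap).n + 3) Q := by
  intro hs
  refine ⟨_, _, Exec.call hsub, hs.copyArr ax _ hg, ?_, ?_, ?_⟩
  · simp [Cost.ofCall]
    omega
  · have hn : len ((s.readBKP vn vc aw ap).n : ℤ) ≤ unitCost E.X := by
      exact len_le_unitCost (abs_toNat_le (hs.1 vn))
    have hc : len ((s.readBKP vn vc aw ap).c : ℤ) ≤ unitCost E.X := by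
      exact len_le_unitCost (abs_toNat_le (hs.1 vc))
    have hj : ∀ j : Fin (s.readBKP vn vc aw ap).n,
        len ((s.readBKP vn vc aw ap).w j) + len ((s.readBKP vn vc aw ap).p j)
          + len (g ((j : ℕ) : ℤ)) ≤ 3 * unitCost E.X := by
      intro j
      have j1 : len ((s.readBKP vn vc aw ap).w j) ≤ unitCost E.X := by
        exact len_le_unitCost (abs_toNat_le (hs.2 aw ((j : ℕ) : ℤ)))
      have j2 : len ((s.readBKP vn vc aw ap).p j) ≤ unitCost E.X := by
        exact len_le_unitCost (abs_toNat_le (hs.2 ap ((j : ℕ) : ℤ)))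
      have j3 : len (g ((j : ℕ) : ℤ)) ≤ unitCost E.X :=
        len_le_unitCost (hg _ (by omega) (by exact_mod_cast j.2))
      omega
    have hsum := Finset.sum_le_card_nsmul Finset.univ _ _ fun j _ => hj j
    simp only [Finset.card_univ, Fintype.card_fin, smul_eq_mul] at hsum
    have b3 := le_unitCost E.X
    simp only [Cost.ofCall, List.map_cons, List.map_nil, List.sum_cons, List.sum_nil]
    have e : (3 * (s.readBKP vn vc aw ap).n + 3) * unitCost E.X
        = (s.readBKP vn vc aw ap).n * (3 * unitCost E.X) + 3 * unitCost E.X := by ring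
    rw [e]
    omega
  · simpa [Cost.ofCall] using h

end Wp

attribute [simp] Expr.eval

/-- The largest number of operations of a program without loops and calls. -/
def Cmd.flat : Cmd → ℕ
  | skip => 1
  | assign _ e => e.steps + 1
  | store _ i e => i.steps + e.steps + 1
  | seq c₁ c₂ => c₁.flat + c₂.flat
  | ite e₁ e₂ c₁ c₂ => e₁.steps + e₂.steps + 1 + max c₁.flat c₂.flat
  | loop _ _ _ => 0
  | call _ _ _ _ _ => 0

namespace Wp

variable {E : Env} {s : State} {cs : List BKP} {Q : State → List BKP → Prop}

/-- The `flat` variants fix the cost by the syntax of the command, so that for a whole loop body the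
numerical bound is left to a single `decide`. -/
theorem flat_skip (h : Q s cs) : Wp E Cmd.skip s cs Cmd.skip.flat Q := skip h

theorem flat_assign {v : ℕ} {e : Expr} (he : e.small = true) (hv : |e.eval s| ≤ (E.X : ℤ))
    (h : Q (s.setVar v (e.eval s)) cs) : Wp E (Cmd.assign v e) s cs (Cmd.assign v e).flat Q :=
  assign he hv h

theorem flat_store {a : ℕ} {i e : Expr} (hi : i.small = true) (he : e.small = true)
    (hv : |e.eval s| ≤ (E.X : ℤ)) (h : Q (s.setArr a (i.eval s) (e.eval s)) cs) :
    Wp E (Cmd.store a i e) s cs (Cmd.store a i e).flat Q :=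
  store hi he hv h

theorem flat_seq {c₁ c₂ : Cmd}
    (h : Wp E c₁ s cs c₁.flat fun t ds => Wp E c₂ t ds c₂.flat Q) :
    Wp E (Cmd.seq c₁ c₂) s cs (Cmd.seq c₁ c₂).flat Q :=
  seq h

theorem flat_ite {e₁ e₂ : Expr} {c₁ c₂ : Cmd} (h₁ : e₁.small = true) (h₂ : e₂.small = true)
    (ht : e₁.eval s ≤ e₂.eval s → Wp E c₁ s cs c₁.flat Q)
    (hf : ¬ e₁.eval s ≤ e₂.eval s → Wp E c₂ s cs c₂.flat Q) :
    Wp E (Cmd.ite e₁ e₂ c₁ c₂) s cs (Cmd.ite e₁ e₂ c₁ c₂).flat Q :=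
  ite h₁ h₂ (fun h => (ht h).le (le_max_left _ _)) (fun h => (hf h).le (le_max_right _ _))

end Wp

/-! ### Vectors in arrays, and determinism of runs -/

@[simp] theorem toArr_natCast {n : ℕ} (v : Fin n → ℕ) (j : Fin n) :
    toArr v ((j : ℕ) : ℤ) = v j := by
  simp [toArr]

theorem toArr_of_lt {n : ℕ} (v : Fin n → ℕ) {j : ℕ} (h : j < n) :
    toArr v (j : ℤ) = v ⟨j, h⟩ := toArr_natCast v ⟨j, h⟩

theorem toArr_nonneg {n : ℕ} (v : Fin n → ℕ) (i : ℤ) : 0 ≤ toArr v i := by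
  unfold toArr
  split_ifs <;> simp

theorem toArr_le {n : ℕ} (v : Fin n → ℕ) {b : ℕ} (h : ∀ j, v j ≤ b) (i : ℤ) :
    toArr v i ≤ b := by
  unfold toArr
  split_ifs with hi
  · exact_mod_cast h _
  · simp

theorem abs_toArr_le {n : ℕ} (v : Fin n → ℕ) {b : ℕ} (h : ∀ j, v j ≤ b) (i : ℤ) :
    |toArr v i| ≤ b := by
  rw [abs_of_nonneg (toArr_nonneg v i)]
  exact toArr_le v h i

/-- Sums over the first `n` entries of arrays. -/
theorem sum_ofArr {n : ℕ} (v : Fin n → ℕ) (g : ℤ → ℤ) :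
    ∑ j, (v j : ℤ) * ofArr n g j = ∑ j ∈ Finset.range n, toArr v (j : ℤ) * g j := by
  rw [← Fin.sum_univ_eq_sum_range (fun j : ℕ => toArr v (j : ℤ) * g j) n]
  simp [ofArr]

/-- Time bounds speak of all runs, while the calculus produces one run; determinism transfers the
bounds. -/
theorem RunsBKP.det {R : Cmd} {B : BKP} {g₁ g₂ : ℤ → ℤ} {k₁ k₂ : Cost}
    (h₁ : RunsBKP R B g₁ k₁) (h₂ : RunsBKP R B g₂ k₂) : g₁ = g₂ ∧ k₁ = k₂ := by
  obtain ⟨t₁, e₁, rfl⟩ := h₁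
  obtain ⟨t₂, e₂, rfl⟩ := h₂
  obtain ⟨rfl, rfl⟩ := Exec.det (fun _ _ _ _ _ h _ => h.elim) e₁ e₂
  exact ⟨rfl, rfl⟩

theorem RunsSOCKP.det {A R : Cmd} {I : SOCKP} {g₁ g₂ : ℤ → ℤ} {k₁ k₂ : Cost}
    (h₁ : RunsSOCKP A R I g₁ k₁) (h₂ : RunsSOCKP A R I g₂ k₂) : g₁ = g₂ ∧ k₁ = k₂ := by
  obtain ⟨t₁, e₁, rfl⟩ := h₁
  obtain ⟨t₂, e₂, rfl⟩ := h₂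
  obtain ⟨rfl, rfl⟩ := Exec.det (fun _ _ _ _ _ h h' => h.det h') e₁ e₂
  exact ⟨rfl, rfl⟩

end Knap

namespace Knap

/-! ## Piecewise linear approximation of the square -/

section pieceSum

variable {R : Type*} [CommRing R] [LinearOrder R] [IsStrictOrderedRing R]

/-- The sum of the positive parts of `y - s * (2 * k + 1)` for `k < m`. -/
def pieceSum (m : ℕ) (y s : R) : R := ∑ k ∈ Finset.range m, max (y - s * (2 * k + 1)) 0

theorem sum_odd_pieces (K : ℕ) (y s : R) :
    ∑ k ∈ Finset.range K, (y - s * (2 * k + 1)) = K * y - s * (K : R) ^ 2 := by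
  induction K with
  | zero => simp
  | succ K ih => rw [Finset.sum_range_succ, ih]; push_cast; ring

/-- When exactly the first K pieces count, the positive parts can be dropped and the odd numbers sum
to K². -/
theorem pieceSum_eq {m K : ℕ} {y s : R} (hK : K ≤ m) (h₁ : ∀ k < K, s * (2 * k + 1) ≤ y)
    (h₂ : ∀ k, K ≤ k → k < m → y ≤ s * (2 * k + 1)) :
    pieceSum m y s = K * y - s * (K : R) ^ 2 := by
  rw [← sum_odd_pieces, pieceSum]
  obtain ⟨r, rfl⟩ := Nat.exists_eq_add_of_le hK
  rw [Finset.sum_range_add, Finset.sum_eq_zero (s := Finset.range r), add_zero]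
  · refine Finset.sum_congr rfl fun k hk => max_eq_left ?_
    have := h₁ k (Finset.mem_range.1 hk)
    linarith
  · intro k hk
    rw [Finset.mem_range] at hk
    have := h₂ (K + k) (by omega) (by omega)
    exact max_eq_right (by linarith)

theorem pieceSum_zero {m : ℕ} {y : R} (hy : 0 ≤ y) : pieceSum m y 0 = m * y := by
  rw [pieceSum_eq (le_refl m) (fun k _ => by simpa using hy)
    (fun k h1 h2 => absurd h1 (not_le.2 h2))]
  ring

/-- Together with `exists_pieceSum_eq`, this says that for s ≥ 0 `pieceSum` is the maximum of K y -
s K² over the integers 0 ≤ K ≤ m. -/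
theorem le_pieceSum {m K : ℕ} (hK : K ≤ m) (y s : R) :
    K * y - s * (K : R) ^ 2 ≤ pieceSum m y s := by
  rw [← sum_odd_pieces]
  calc ∑ k ∈ Finset.range K, (y - s * (2 * k + 1))
      ≤ ∑ k ∈ Finset.range K, max (y - s * (2 * k + 1)) 0 :=
        Finset.sum_le_sum fun _ _ => le_max_left _ _
    _ ≤ pieceSum m y s :=
        Finset.sum_le_sum_of_subset_of_nonneg (Finset.range_subset_range.2 hK)
          fun _ _ _ => le_max_right _ _

theorem pieceSum_nonneg (m : ℕ) (y s : R) : 0 ≤ pieceSum m y s :=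
  Finset.sum_nonneg fun _ _ => le_max_right _ _

/-- For s ≥ 0 the pieces decrease in k: if the last one is nonnegative, all of them are, and
otherwise it contributes nothing. -/
theorem exists_pieceSum_eq (m : ℕ) (y : R) {s : R} (hs : 0 ≤ s) :
    ∃ K ≤ m, pieceSum m y s = K * y - s * (K : R) ^ 2 := by
  induction m with
  | zero => exact ⟨0, le_rfl, by simp [pieceSum]⟩
  | succ m ih =>
    by_cases h : s * (2 * m + 1) ≤ y
    · refine ⟨m + 1, le_rfl, pieceSum_eq le_rfl (fun k hk => le_trans ?_ h)
        (fun k h1 h2 => absurd h1 (not_le.2 h2))⟩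
      have : (k : R) ≤ m := by exact_mod_cast Nat.lt_succ_iff.1 hk
      gcongr
    · obtain ⟨K, hK, e⟩ := ih
      refine ⟨K, by omega, ?_⟩
      rw [← e, pieceSum, Finset.sum_range_succ, max_eq_right (by linarith), add_zero, pieceSum]

/-- Completing the square: K y - s K² never exceeds its real maximum y²/(4s). -/
theorem four_mul_pieceSum_le (m : ℕ) (y : R) {s : R} (hs : 0 ≤ s) :
    4 * s * pieceSum m y s ≤ y ^ 2 := by
  obtain ⟨K, -, e⟩ := exists_pieceSum_eq m y hs
  rw [e]
  nlinarith [sq_nonneg (y - 2 * s * K)]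

end pieceSum

/-- Interpolate the bounds of `le_pieceSum` between the integers K = ⌊y⌋ and K + 1. The chord of the
square exceeds y² by (y - K)(K + 1 - y), which is at most 1/4. -/
theorem le_pieceSum_real {m : ℕ} {y d s : ℝ} (hs : 0 ≤ s) (hy : 0 ≤ y) (hym : y ≤ m) :
    y * d - s * (y ^ 2 + 1 / 4) ≤ pieceSum m d s := by
  have h1 : (⌊y⌋₊ : ℝ) ≤ y := Nat.floor_le hy
  have h2 : y < ⌊y⌋₊ + 1 := Nat.lt_floor_add_one y
  have hK : ⌊y⌋₊ ≤ m := by exact_mod_cast h1.trans hym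
  generalize ⌊y⌋₊ = K at *
  have g1 := le_pieceSum hK d s
  rcases hK.lt_or_eq with h | h
  · have g2 := le_pieceSum (K := K + 1) h d s
    push_cast at g2
    have k1 := mul_le_mul_of_nonneg_left g1 (by linarith : (0 : ℝ) ≤ K + 1 - y)
    have k2 := mul_le_mul_of_nonneg_left g2 (by linarith : (0 : ℝ) ≤ y - K)
    have k3 : 0 ≤ s * (y - K - 1 / 2) ^ 2 := by positivity
    nlinarith
  -- For K = m there is no next piece to interpolate with, but then y = m is an integer.
  · have e : y = K := le_antisymm (by rw [h]; exact hym) h1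
    subst e
    nlinarith

/-- A piecewise linear function attains its minimum over the nonnegative numbers in a breakpoint. -/
theorem exists_breakpoint_le {ι : Type*} [Fintype ι] (q d f : ι → ℝ) (hf : ∀ a, 0 < f a)
    {c : ℝ} (hc : 0 ≤ c) {z : ℝ} (hz : 0 ≤ z) :
    ∃ l : Option ι,
      c * l.elim 0 (fun a => d a / f a)
        + ∑ a, q a * max (d a - l.elim 0 (fun a => d a / f a) * f a) 0
      ≤ c * z + ∑ a, q a * max (d a - z * f a) 0 := by
  classical
  set r : Option ι → ℝ := fun l => l.elim 0 (fun a => d a / f a) with hr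
  set G : ℝ → ℝ := fun y => c * y + ∑ a, q a * max (d a - y * f a) 0 with hG
  show ∃ l, G (r l) ≤ G z
  obtain ⟨lo, hlo, hlo'⟩ := Finset.exists_max_image (Finset.univ.filter fun l => r l ≤ z) r
    ⟨none, by simpa [hr] using hz⟩
  simp only [Finset.mem_filter, Finset.mem_univ, true_and] at hlo hlo'
  have hrd : ∀ a, d a = r (some a) * f a := fun a => by
    simp only [hr, Option.elim]
    rw [div_mul_cancel₀ _ (hf a).ne']
  by_cases hex : ∃ l, z < r l
  · obtain ⟨hi, hhi, hhi'⟩ := Finset.exists_min_image (Finset.univ.filter fun l => z < r l) r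
      (by obtain ⟨l, hl⟩ := hex; exact ⟨l, by simpa using hl⟩)
    simp only [Finset.mem_filter, Finset.mem_univ, true_and] at hhi hhi'
    -- No breakpoint lies strictly between the neighbours `lo` and `hi` of z, so each term is affine
    -- there, and its value at z is the corresponding convex combination.
    have hterm : ∀ a, (r hi - r lo) * max (d a - z * f a) 0
        = (r hi - z) * max (d a - r lo * f a) 0 + (z - r lo) * max (d a - r hi * f a) 0 := by
      intro a
      have fa := hf a
      rcases le_or_gt (r (some a)) z with h | h
      · have := hlo' _ h
        have k1 : d a - z * f a ≤ 0 := by rw [hrd a]; nlinarith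
        have k2 : d a - r lo * f a ≤ 0 := by rw [hrd a]; nlinarith
        have k3 : d a - r hi * f a ≤ 0 := by rw [hrd a]; nlinarith
        rw [max_eq_right k1, max_eq_right k2, max_eq_right k3]
        ring
      · have := hhi' _ h
        have k1 : 0 ≤ d a - z * f a := by rw [hrd a]; nlinarith
        have k2 : 0 ≤ d a - r lo * f a := by rw [hrd a]; nlinarith
        have k3 : 0 ≤ d a - r hi * f a := by rw [hrd a]; nlinarith
        rw [max_eq_left k1, max_eq_left k2, max_eq_left k3]
        ring
    have hconv : (r hi - r lo) * G z = (r hi - z) * G (r lo) + (z - r lo) * G (r hi) := by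
      have : ∑ a, q a * ((r hi - r lo) * max (d a - z * f a) 0)
          = ∑ a, q a * ((r hi - z) * max (d a - r lo * f a) 0
            + (z - r lo) * max (d a - r hi * f a) 0) :=
        Finset.sum_congr rfl fun a _ => by rw [hterm a]
      simp only [mul_add, Finset.sum_add_distrib, mul_left_comm (q _), ← Finset.mul_sum] at this
      simp only [hG]
      linear_combination this
    by_contra! hcon
    have c1 := hcon lo
    have c2 := hcon hi
    nlinarith
  -- Beyond the last breakpoint all positive parts vanish, and only the nondecreasing term in c
  -- remains.
  · push Not at hex
    refine ⟨lo, ?_⟩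
    have hterm : ∀ a, max (d a - r lo * f a) 0 = 0 ∧ max (d a - z * f a) 0 = 0 := by
      intro a
      have fa := hf a
      have k := hex (some a)
      have := hlo' _ k
      exact ⟨max_eq_right (by rw [hrd a]; nlinarith), max_eq_right (by rw [hrd a]; nlinarith)⟩
    simp only [hG, (hterm _).1, (hterm _).2]
    have := mul_le_mul_of_nonneg_left hlo hc
    linarith

/-! ### The Lagrangian bound and the union of the problems `B_l` -/

theorem Binary.nonneg {n : ℕ} {x : Fin n → ℤ} (hx : Binary x) (j : Fin n) : 0 ≤ x j := by
  rcases hx j with h | h <;> simp [h]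

theorem Binary.cast_sq {n : ℕ} {x : Fin n → ℤ} (hx : Binary x) (j : Fin n) :
    (x j : ℝ) ^ 2 = x j := by
  rcases hx j with h | h <;> simp [h]

namespace SOCKP

variable (I : SOCKP)

/-- The multiplier `d_l / f_l` that belongs to the problem `B_l`, and `0` for the additional
index. -/
noncomputable def multiplier (m : ℕ) (l : Option (Fin I.n × Fin m)) : ℝ :=
  l.elim 0 fun a => (I.d m a.1 : ℝ) / (f a.2 : ℝ)

/-- The Lagrangian upper bound for the second-order cone term. -/
noncomputable def dualBound (m : ℕ) (x : Fin I.n → ℤ) (z : ℝ) : ℝ :=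
  (m : ℝ) ^ 2 * z + ∑ j, (x j : ℝ) * pieceSum m (I.d m j : ℝ) z

variable {I}

theorem f_pos {m : ℕ} (k : Fin m) : 0 < f k := by
  unfold f
  positivity

theorem d_nonneg (m : ℕ) (j : Fin I.n) : 0 ≤ I.d m j := by
  unfold d
  positivity

theorem multiplier_nonneg (m : ℕ) (l : Option (Fin I.n × Fin m)) : 0 ≤ I.multiplier m l := by
  rcases l with _ | ⟨i, h⟩
  · exact le_rfl
  · have h1 : (0 : ℝ) ≤ I.d m i := by exact_mod_cast d_nonneg m i
    have h2 : (0 : ℝ) < f h := by exact_mod_cast f_pos h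
    exact div_nonneg h1 h2.le

/-- The filter selects exactly the pairs with a positive summand, so the filtered sum is a sum of
positive parts. -/
theorem subWeight_some (m : ℕ) (i : Fin I.n) (h : Fin m) (j : Fin I.n) :
    I.subWeight m (some (i, h)) j = I.a j + pieceSum m (I.d m j) (I.d m i / f h) := by
  simp only [subWeight]
  rw [Finset.sum_filter, pieceSum,
    ← Fin.sum_univ_eq_sum_range (fun k : ℕ => max (I.d m j - I.d m i / f h * (2 * k + 1)) 0) m]
  congr 1
  refine Finset.sum_congr rfl fun k _ => ?_
  have hk := f_pos k
  have e : (2 * ((k : ℕ) : ℚ) + 1) = f k := rfl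
  rw [e]
  split_ifs with hlt
  · rw [lt_div_iff₀ hk] at hlt
    rw [max_eq_left (by linarith)]
  · rw [lt_div_iff₀ hk] at hlt
    rw [max_eq_right (by linarith)]

theorem subWeight_none (m : ℕ) (j : Fin I.n) :
    I.subWeight m none j = I.a j + m * I.d m j := by
  simp [subWeight]

theorem subWeight_nonneg (m : ℕ) (l : Option (Fin I.n × Fin m)) (j : Fin I.n) :
    0 ≤ I.subWeight m l j := by
  rcases l with _ | ⟨i, h⟩
  · rw [subWeight_none]
    have := d_nonneg m j
    positivity
  · rw [subWeight_some]
    have := pieceSum_nonneg m (I.d m j) (I.d m i / f h)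
    positivity

theorem inSub_iff {m : ℕ} {l : Option (Fin I.n × Fin m)} {x : Fin I.n → ℤ} :
    I.InSub m l x ↔
      Binary x ∧ ∑ j, (I.a j : ℝ) * x j + I.dualBound m x (I.multiplier m l) ≤ I.b := by
  refine and_congr_right fun _ => ?_
  rcases l with _ | ⟨i, h⟩
  · have e : ∀ j, (I.d m j : ℝ) = ((I.d m j : ℚ) : ℝ) := fun _ => rfl
    have hd : ∀ j, (0 : ℝ) ≤ I.d m j := fun j => by exact_mod_cast d_nonneg m j
    rw [← (Rat.cast_le (K := ℝ))]
    simp only [subWeight_none, subCap, multiplier, dualBound, Option.elim, mul_zero, zero_add,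
      pieceSum_zero (hd _), ← Finset.sum_add_distrib]
    push_cast
    refine iff_of_eq (congrArg (· ≤ (I.b : ℝ)) (Finset.sum_congr rfl fun j _ => ?_))
    ring
  · rw [← (Rat.cast_le (K := ℝ))]
    simp only [subWeight_some, subCap, multiplier, dualBound, Option.elim, pieceSum]
    push_cast
    simp only [add_mul, Finset.sum_add_distrib]
    have : ∀ u v w y : ℝ, (u + v ≤ w - y * (m : ℝ) ^ 2) ↔ (u + ((m : ℝ) ^ 2 * y + v) ≤ w) := by
      intro u v w y
      constructor <;> intro h <;> linarith
    rw [this]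
    refine iff_of_eq (congrArg (fun t => _ + (_ + t) ≤ (I.b : ℝ))
      (Finset.sum_congr rfl fun j _ => ?_))
    ring

theorem subCap_nonneg_of_inSub {m : ℕ} {l : Option (Fin I.n × Fin m)} {x : Fin I.n → ℤ}
    (h : I.InSub m l x) : 0 ≤ I.subCap m l := by
  refine le_trans (Finset.sum_nonneg fun j _ => ?_) h.2
  have : (0 : ℚ) ≤ x j := by exact_mod_cast Binary.nonneg h.1 j
  exact mul_nonneg (subWeight_nonneg m l j) this

theorem sum_d_sq {m : ℕ} (hm : 0 < m) {x : Fin I.n → ℤ} (hx : Binary x) :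
    ∑ j, (x j : ℝ) * (I.d m j : ℝ) ^ 2
      = ((I.Ω : ℝ) * √(∑ j, (I.σ j : ℝ) ^ 2 * (x j : ℝ) ^ 2)) ^ 2 / (m : ℝ) ^ 2 := by
  rw [mul_pow, Real.sq_sqrt (Finset.sum_nonneg fun j _ => by positivity), Finset.mul_sum,
    Finset.sum_div]
  refine Finset.sum_congr rfl fun j _ => ?_
  have : (m : ℝ) ≠ 0 := by positivity
  rw [hx.cast_sq, d]
  push_cast
  field_simp

/-- Some `B_l` approximates the second-order cone term from below. -/
theorem exists_dualBound_le {m : ℕ} (hm : 0 < m) {x : Fin I.n → ℤ} (hx : Binary x) :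
    ∃ l, I.dualBound m x (I.multiplier m l)
      ≤ (I.Ω : ℝ) * √(∑ j, (I.σ j : ℝ) ^ 2 * (x j : ℝ) ^ 2) := by
  have hs := sum_d_sq hm hx
  have hT : 0 ≤ (I.Ω : ℝ) * √(∑ j, (I.σ j : ℝ) ^ 2 * (x j : ℝ) ^ 2) := by positivity
  generalize (I.Ω : ℝ) * √(∑ j, (I.σ j : ℝ) ^ 2 * (x j : ℝ) ^ 2) = T at *
  have hx0 : ∀ j, (0 : ℝ) ≤ x j := fun j => by exact_mod_cast Binary.nonneg hx j
  have hd : ∀ j, (0 : ℝ) ≤ I.d m j := fun j => by exact_mod_cast d_nonneg m j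
  have hm' : (0 : ℝ) < m := by exact_mod_cast hm
  -- If the cone term vanishes, so does every x_j d_j, and the additional index with multiplier 0
  -- already works.
  rcases hT.eq_or_lt with h0 | hpos
  · refine ⟨none, ?_⟩
    rw [← h0] at hs ⊢
    have hz : ∀ j ∈ Finset.univ, (x j : ℝ) * (I.d m j : ℝ) ^ 2 = 0 :=
      (Finset.sum_eq_zero_iff_of_nonneg fun j _ => mul_nonneg (hx0 j) (sq_nonneg _)).1
        (by simpa using hs)
    simp only [dualBound, multiplier, Option.elim, mul_zero, zero_add, pieceSum_zero (hd _)]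
    refine (Finset.sum_eq_zero fun j hj => ?_).le
    rcases mul_eq_zero.1 (hz j hj) with h | h
    · rw [h, zero_mul]
    · rw [pow_eq_zero_iff two_ne_zero] at h
      rw [h, mul_zero, mul_zero]
  -- This is the optimal multiplier of the continuous relaxation: m² z is T/2, and by completing the
  -- square the sum over the items is at most T/2 as well.
  · set z : ℝ := T / (2 * (m : ℝ) ^ 2) with hz
    have hzpos : 0 < z := by positivity
    obtain ⟨l, hl⟩ := exists_breakpoint_le (ι := Fin I.n × Fin m) (fun a => (x a.1 : ℝ))
      (fun a => (I.d m a.1 : ℝ)) (fun a => (f a.2 : ℝ)) (fun a => by exact_mod_cast f_pos a.2)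
      (sq_nonneg (m : ℝ)) hzpos.le
    have key : ∀ y : ℝ, (m : ℝ) ^ 2 * y + ∑ a : Fin I.n × Fin m,
        (x a.1 : ℝ) * max ((I.d m a.1 : ℝ) - y * (f a.2 : ℝ)) 0 = I.dualBound m x y := by
      intro y
      rw [dualBound, Fintype.sum_prod_type]
      congr 1
      refine Finset.sum_congr rfl fun j _ => ?_
      rw [pieceSum, ← Fin.sum_univ_eq_sum_range
        (fun k : ℕ => max ((I.d m j : ℝ) - y * (2 * k + 1)) 0) m, Finset.mul_sum]
      refine Finset.sum_congr rfl fun k _ => ?_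
      simp [f]
    refine ⟨l, ?_⟩
    rw [key, key] at hl
    refine hl.trans ?_
    have h4 : 4 * z * ∑ j, (x j : ℝ) * pieceSum m (I.d m j : ℝ) z ≤ T ^ 2 / (m : ℝ) ^ 2 := by
      rw [← hs, Finset.mul_sum]
      refine Finset.sum_le_sum fun j _ => ?_
      have := mul_le_mul_of_nonneg_left (four_mul_pieceSum_le m (I.d m j : ℝ) hzpos.le) (hx0 j)
      linarith
    have e1 : (m : ℝ) ^ 2 * z = T / 2 := by rw [hz]; field_simp
    have e2 : T ^ 2 / (m : ℝ) ^ 2 = 4 * z * (T / 2) := by rw [hz]; field_simp; norm_num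
    rw [e2] at h4
    have h5 := le_of_mul_le_mul_left h4 (by positivity)
    rw [dualBound, e1]
    linarith

/-- Every `B_l` approximates the second-order cone term well. -/
theorem le_dualBound_sq {m : ℕ} (hm : 0 < m) (hn : (I.n : ℝ) ≤ 4 * (m : ℝ) ^ 2)
    {x : Fin I.n → ℤ} (hx : Binary x) {z : ℝ} (hz : 0 ≤ z) {T : ℝ} (hT : 0 < T)
    (hTe : T = (I.Ω : ℝ) * √(∑ j, (I.σ j : ℝ) ^ 2 * (x j : ℝ) ^ 2)) :
    T ^ 2 - T ^ 2 * I.n / (4 * (m : ℝ) ^ 2) ≤ I.dualBound m x z ^ 2 := by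
  have hs := sum_d_sq hm hx
  rw [← hTe] at hs
  have hx0 : ∀ j, (0 : ℝ) ≤ x j := fun j => by exact_mod_cast Binary.nonneg hx j
  have hx1 : ∀ j, (x j : ℝ) ≤ 1 := fun j => by rcases hx j with h | h <;> simp [h]
  have hd : ∀ j, (0 : ℝ) ≤ I.d m j := fun j => by exact_mod_cast d_nonneg m j
  have hm' : (0 : ℝ) < m := by exact_mod_cast hm
  set D := T / m with hD
  have hDpos : 0 < D := by positivity
  have hs' : ∑ j, (x j : ℝ) * (I.d m j : ℝ) ^ 2 = D ^ 2 := by rw [hs, hD, div_pow]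
  -- The test point is y_j = (ρ/D) d_j, a multiple of the Cauchy-Schwarz maximizer. Its norm is
  -- reduced from m to ρ to pay for the rounding: ρ² + n/4 = m².
  set ρ := √((m : ℝ) ^ 2 - I.n / 4) with hρ
  have hρ2 : ρ ^ 2 = (m : ℝ) ^ 2 - I.n / 4 := Real.sq_sqrt (by linarith)
  have hρ0 : 0 ≤ ρ := Real.sqrt_nonneg _
  have hρm : ρ ≤ m := by
    have : (0 : ℝ) ≤ I.n := by positivity
    exact abs_le_of_sq_le_sq' (by linarith) hm'.le |>.2
  -- The loss z/4 is charged to items with x_j = 0 too, which is harmless for z ≥ 0 and makes the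
  -- total loss nz/4 independent of x.
  have hterm : ∀ j, (x j : ℝ) * ((ρ / D) * (I.d m j : ℝ) ^ 2)
      - z * ((ρ / D) ^ 2 * ((x j : ℝ) * (I.d m j : ℝ) ^ 2) + 1 / 4)
      ≤ (x j : ℝ) * pieceSum m (I.d m j : ℝ) z := by
    intro j
    rcases hx j with h | h
    · simp [h, hz]
    · have hdD : (I.d m j : ℝ) ≤ D := by
        have h1 := Finset.single_le_sum (f := fun j => (x j : ℝ) * (I.d m j : ℝ) ^ 2)
          (fun j _ => mul_nonneg (hx0 j) (sq_nonneg _)) (Finset.mem_univ j)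
        rw [hs'] at h1
        simp only [h, Int.cast_one, one_mul] at h1
        exact abs_le_of_sq_le_sq' h1 hDpos.le |>.2
      have h2 : (ρ / D) * (I.d m j : ℝ) ≤ m := by
        rw [div_mul_eq_mul_div, div_le_iff₀ hDpos]
        exact mul_le_mul hρm hdD (hd j) hm'.le
      have h3 := le_pieceSum_real (d := (I.d m j : ℝ)) hz
        (mul_nonneg (div_nonneg hρ0 hDpos.le) (hd j)) h2
      simp only [h, Int.cast_one, one_mul]
      refine le_trans (le_of_eq ?_) h3
      ring
  have hsum := Finset.sum_le_sum fun j (_ : j ∈ Finset.univ) => hterm j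
  simp only [Finset.sum_sub_distrib, ← Finset.mul_sum, Finset.sum_add_distrib,
    mul_left_comm (x _ : ℝ), hs', Finset.sum_const, Finset.card_univ, Fintype.card_fin,
    nsmul_eq_mul] at hsum
  have e1 : ρ / D * D ^ 2 = ρ * D := by field_simp
  have e2 : (ρ / D) ^ 2 * D ^ 2 = ρ ^ 2 := by field_simp
  rw [e1, e2, hρ2] at hsum
  have hge : ρ * D ≤ I.dualBound m x z := by
    rw [dualBound]
    linarith
  have h5 := pow_le_pow_left₀ (mul_nonneg hρ0 hDpos.le) hge 2
  refine le_trans (le_of_eq ?_) h5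
  rw [mul_pow, hρ2, hD]
  field_simp

/-- Squaring removes the root and the ceiling. This integer test is what the program evaluates, and
it yields the bounds on m*. -/
theorem mstar_pred_le_iff (q : ℕ) :
    I.mstar ≤ q + 1 ↔ I.Ω ^ 2 * (I.n * ∑ j, I.σ j ^ 2) ≤ 4 * q ^ 2 := by
  rw [mstar, Nat.add_le_add_iff_right, Nat.ceil_le]
  have e : (I.Ω : ℝ) / 2 * √((I.n : ℝ) * ∑ j, (I.σ j : ℝ) ^ 2)
      = √(((I.Ω ^ 2 * (I.n * ∑ j, I.σ j ^ 2) : ℕ) : ℝ) / 4) := by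
    have h : (((I.Ω ^ 2 * (I.n * ∑ j, I.σ j ^ 2) : ℕ) : ℝ) / 4)
        = ((I.Ω : ℝ) / 2) ^ 2 * ((I.n : ℝ) * ∑ j, (I.σ j : ℝ) ^ 2) := by
      push_cast
      ring
    rw [h, Real.sqrt_mul (sq_nonneg _), Real.sqrt_sq (by positivity)]
  rw [e, Real.sqrt_le_left (by positivity), div_le_iff₀ (by norm_num)]
  constructor
  · intro h
    have : ((I.Ω ^ 2 * (I.n * ∑ j, I.σ j ^ 2) : ℕ) : ℝ) ≤ ((4 * q ^ 2 : ℕ) : ℝ) := by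
      rw [Nat.cast_mul 4]
      push_cast at h ⊢
      linarith
    exact_mod_cast this
  · intro h
    have : ((I.Ω ^ 2 * (I.n * ∑ j, I.σ j ^ 2) : ℕ) : ℝ) ≤ ((4 * q ^ 2 : ℕ) : ℝ) := by
      exact_mod_cast h
    rw [Nat.cast_mul 4] at this
    push_cast at this ⊢
    linarith

theorem mstar_pos : 0 < I.mstar := Nat.succ_pos _

/-- The summand 1 in the definition of m* makes the inequality strict; the rounding argument needs a
loss strictly below 1. -/
theorem lt_four_mul_mstar_sq : I.Ω ^ 2 * (I.n * ∑ j, I.σ j ^ 2) < 4 * I.mstar ^ 2 := by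
  have h := (mstar_pred_le_iff (I := I) (I.mstar - 1)).1 (by omega)
  refine h.trans_lt ?_
  have := mstar_pos (I := I)
  have : (I.mstar - 1) ^ 2 < I.mstar ^ 2 := Nat.pow_lt_pow_left (by omega) two_ne_zero
  omega

/-- For `m = m*`, the problems `B_l` together describe the feasible set of (SOCKP). -/
theorem feasible_iff_exists_inSub {x : Fin I.n → ℤ} :
    I.Feasible x ↔ ∃ l, I.InSub I.mstar l x := by
  constructor
  · rintro ⟨hx, h⟩
    obtain ⟨l, hl⟩ := exists_dualBound_le mstar_pos hx
    exact ⟨l, inSub_iff.2 ⟨hx, by linarith⟩⟩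
  · rintro ⟨l, hl⟩
    obtain ⟨hx, h⟩ := inSub_iff.1 hl
    refine ⟨hx, ?_⟩
    have hz := multiplier_nonneg I.mstar l
    generalize I.multiplier I.mstar l = z at *
    -- The slack t and, below, the squared cone term N are integers; exactness rests on this.
    obtain ⟨t, ht⟩ : ∃ t : ℤ, t = I.b - ∑ j, (I.a j : ℤ) * x j := ⟨_, rfl⟩
    have ht' : (t : ℝ) = I.b - ∑ j, (I.a j : ℝ) * x j := by rw [ht]; push_cast; ring
    have hG0 : 0 ≤ I.dualBound I.mstar x z := by
      have hx0 : ∀ j, (0 : ℝ) ≤ x j := fun j => by exact_mod_cast Binary.nonneg hx j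
      exact add_nonneg (by positivity) (Finset.sum_nonneg fun j _ =>
        mul_nonneg (hx0 j) (pieceSum_nonneg _ _ _))
    have hGt : I.dualBound I.mstar x z ≤ t := by linarith
    suffices hs : (I.Ω : ℝ) * √(∑ j, (I.σ j : ℝ) ^ 2 * (x j : ℝ) ^ 2) ≤ t by linarith
    obtain ⟨N, hN⟩ : ∃ N : ℕ, N = I.Ω ^ 2 * ∑ j, I.σ j ^ 2 * (x j).natAbs ^ 2 := ⟨_, rfl⟩
    have hTN : ((I.Ω : ℝ) * √(∑ j, (I.σ j : ℝ) ^ 2 * (x j : ℝ) ^ 2)) ^ 2 = N := by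
      rw [mul_pow, Real.sq_sqrt (Finset.sum_nonneg fun j _ => by positivity), hN]
      push_cast
      congr 1
      refine Finset.sum_congr rfl fun j _ => ?_
      congr 1
      rcases hx j with h | h <;> simp [h]
    obtain ⟨T, hT⟩ : ∃ T, T = (I.Ω : ℝ) * √(∑ j, (I.σ j : ℝ) ^ 2 * (x j : ℝ) ^ 2) := ⟨_, rfl⟩
    rw [← hT] at hTN ⊢
    have hT0 : 0 ≤ T := by rw [hT]; positivity
    rcases hT0.eq_or_lt with h0 | hpos
    · rw [← h0]
      exact hG0.trans hGt
    have hNpos : 1 ≤ N := by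
      have : (0 : ℝ) < N := by rw [← hTN]; positivity
      exact_mod_cast this
    have hNle : N * I.n < 4 * I.mstar ^ 2 := by
      refine lt_of_le_of_lt ?_ lt_four_mul_mstar_sq
      have : ∑ j, I.σ j ^ 2 * (x j).natAbs ^ 2 ≤ ∑ j, I.σ j ^ 2 := by
        refine Finset.sum_le_sum fun j _ => ?_
        rcases hx j with h | h <;> simp [h]
      rw [hN]
      calc I.Ω ^ 2 * (∑ j, I.σ j ^ 2 * (x j).natAbs ^ 2) * I.n
          ≤ I.Ω ^ 2 * (∑ j, I.σ j ^ 2) * I.n := by gcongr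
        _ = _ := by ring
    have hmpos : (0 : ℝ) < I.mstar := by exact_mod_cast mstar_pos
    have hn : (I.n : ℝ) ≤ 4 * (I.mstar : ℝ) ^ 2 := by
      have : I.n ≤ 4 * I.mstar ^ 2 := by nlinarith
      exact_mod_cast this
    have key := le_dualBound_sq mstar_pos hn hx hz hpos hT
    rw [hTN] at key
    have h1 : (N : ℝ) * I.n / (4 * (I.mstar : ℝ) ^ 2) < 1 := by
      rw [div_lt_one (by positivity)]
      exact_mod_cast hNle
    have h2 : I.dualBound I.mstar x z ^ 2 ≤ (t : ℝ) ^ 2 := pow_le_pow_left₀ hG0 hGt 2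
    -- The approximation gives N < t² + 1, which for integers means N ≤ t².
    have h3 : (N : ℤ) ≤ t ^ 2 := by
      have : (N : ℝ) < (t : ℝ) ^ 2 + 1 := by linarith
      have : (N : ℤ) < t ^ 2 + 1 := by exact_mod_cast this
      omega
    have h4 : T ^ 2 ≤ (t : ℝ) ^ 2 := by rw [hTN]; exact_mod_cast h3
    exact abs_le_of_sq_le_sq' h4 (hG0.trans hGt) |>.2

/-! ### Clearing denominators in `B_l` -/

theorem subScale_pos {m : ℕ} (hm : 0 < m) (l : Option (Fin I.n × Fin m)) :
    0 < I.subScale m l := by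
  rcases l with _ | ⟨i, h⟩
  · exact one_pos
  · have := f_pos h
    simp only [subScale]
    positivity

theorem IsSub.profit_eq {m : ℕ} {l : Option (Fin I.n × Fin m)} {B : BKP} (h : I.IsSub m l B)
    (g : ℤ → ℤ) : B.profit (ofArr B.n g) = I.profit (ofArr I.n g) := by
  obtain ⟨n, w, p, c⟩ := B
  obtain ⟨h, hp, -, -⟩ := h
  dsimp only at h
  subst h
  exact Finset.sum_congr rfl fun j _ => by rw [hp]; rfl

theorem IsSub.feasible_iff {m : ℕ} (hm : 0 < m) {l : Option (Fin I.n × Fin m)} {B : BKP}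
    (h : I.IsSub m l B) (g : ℤ → ℤ) :
    B.Feasible (ofArr B.n g) ↔ I.InSub m l (ofArr I.n g) := by
  obtain ⟨n, w, p, c⟩ := B
  obtain ⟨h, -, hw, hc⟩ := h
  dsimp only at h hw hc
  subst h
  refine and_congr_right fun _ => ?_
  rw [← mul_le_mul_iff_right₀ (subScale_pos hm l), ← hc, Finset.mul_sum,
    ← (Int.cast_le (R := ℚ))]
  push_cast
  refine iff_of_eq (congrArg (· ≤ (c : ℚ)) (Finset.sum_congr rfl fun j _ => ?_))
  have := hw j
  simp only [Fin.cast_eq_self] at this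
  rw [this, mul_assoc]

/-- The integer weight of item `j` in `B_l` for a pair `l`. -/
def pairWeight (I : SOCKP) (m : ℕ) (i j : Fin I.n) (h : ℕ) : ℤ :=
  m * (2 * h + 1) * I.a j + I.Ω * pieceSum m ((I.σ j : ℤ) * (2 * h + 1)) (I.σ i)

/-- The factor m(2h+1) turns d_j - (d_i/f_h) f_k into Ω(σ_j(2h+1) - σ_i(2k+1)); being positive, it
commutes with positive parts. -/
theorem subScale_mul_subWeight {m : ℕ} (hm : 0 < m) (i j : Fin I.n) (h : Fin m) :
    I.subScale m (some (i, h)) * I.subWeight m (some (i, h)) j = I.pairWeight m i j h := by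
  have hm' : (m : ℚ) ≠ 0 := by positivity
  have hf := f_pos h
  have hs := subScale_pos hm (some (i, h))
  rw [subWeight_some, pairWeight, pieceSum, pieceSum]
  push_cast
  rw [mul_add, Finset.mul_sum, Finset.mul_sum]
  congr 1
  refine Finset.sum_congr rfl fun k _ => ?_
  rw [mul_max_of_nonneg _ _ hs.le, mul_max_of_nonneg _ _ (by positivity), mul_zero, mul_zero]
  congr 1
  have e : (2 * ((h : ℕ) : ℚ) + 1) = f h := rfl
  rw [e]
  simp only [subScale, d]
  field_simp

theorem subScale_mul_subCap {m : ℕ} (hm : 0 < m) (i : Fin I.n) (h : Fin m) :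
    I.subScale m (some (i, h)) * I.subCap m (some (i, h))
      = ((m * (2 * h + 1) * I.b - I.Ω * I.σ i * (m * m) : ℤ) : ℚ) := by
  have hm' : (m : ℚ) ≠ 0 := by positivity
  have hf := f_pos h
  push_cast
  have e : (2 * ((h : ℕ) : ℚ) + 1) = f h := rfl
  rw [e]
  simp only [subScale, subCap, d]
  field_simp

end SOCKP

end Knap

namespace Knap

/-! ## Dynamic programming over profits -/

/-- The largest value of `c + 1` minus the weight among the sets of the first `j` items that have
profit `u` and weight at most `c`, and `0` if there is no such set. -/
def dpValue (w p : ℤ → ℤ) (c : ℤ) : ℕ → ℤ → ℤ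
  | 0, u => if u = 0 then c + 1 else 0
  | j + 1, u => max (dpValue w p c j u) (dpValue w p c j (u - p j) - w j)

section dpValue

variable {w p : ℤ → ℤ} {c : ℤ}

theorem dpValue_nonneg (hc : 0 ≤ c) (j : ℕ) (u : ℤ) : 0 ≤ dpValue w p c j u := by
  induction j generalizing u with
  | zero => simp only [dpValue]; split_ifs <;> omega
  | succ j ih => exact le_max_of_le_left (ih u)

theorem dpValue_le (hw : ∀ i, 0 ≤ w i) (hc : 0 ≤ c) (j : ℕ) (u : ℤ) :
    dpValue w p c j u ≤ c + 1 := by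
  induction j generalizing u with
  | zero => simp only [dpValue]; split_ifs <;> omega
  | succ j ih =>
    have := ih (u - p j)
    have := hw j
    exact max_le (ih u) (by omega)

/-- Hence the program may stop its scan at profit 0, and a traceback never reaches a negative
profit. -/
theorem dpValue_of_neg (hw : ∀ i, 0 ≤ w i) (hp : ∀ i, 0 ≤ p i) (j : ℕ) {u : ℤ} (hu : u < 0) :
    dpValue w p c j u = 0 := by
  induction j generalizing u with
  | zero => simp only [dpValue]; rw [if_neg (by omega)]
  | succ j ih =>
    have h1 := hp j
    have h2 := hw j
    simp only [dpValue]
    rw [ih hu, ih (by omega)]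
    omega

theorem dpValue_mono {j k : ℕ} (h : j ≤ k) (u : ℤ) : dpValue w p c j u ≤ dpValue w p c k u := by
  induction k, h using Nat.le_induction with
  | base => exact le_rfl
  | succ k _ ih => exact ih.trans (le_max_left _ _)

/-- With `le_dpValue`, this shows that the positive entries mark exactly the profits of sets of
weight at most c. Storing c + 1 minus the weight lets the initial zero memory mean "unreachable". -/
theorem exists_of_one_le_dpValue {j : ℕ} {u : ℤ} (h : 1 ≤ dpValue w p c j u) (hw : ∀ i, 0 ≤ w i) :
    ∃ x : ℕ → ℤ, (∀ i, x i = 0 ∨ x i = 1) ∧ ∑ i ∈ Finset.range j, p i * x i = u ∧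
      ∑ i ∈ Finset.range j, w i * x i = c + 1 - dpValue w p c j u := by
  induction j generalizing u with
  | zero =>
    simp only [dpValue] at h ⊢
    split_ifs at h with hu
    · exact ⟨fun _ => 0, fun _ => Or.inl rfl, by simp [hu], by simp [hu]⟩
    · omega
  | succ j ih =>
    have key : ∀ (x : ℕ → ℤ) (b : ℤ) (q : ℤ → ℤ),
        ∑ i ∈ Finset.range (j + 1), q i * (Function.update x j b) i
          = ∑ i ∈ Finset.range j, q i * x i + q j * b := by
      intro x b q
      rw [Finset.sum_range_succ, Function.update_self]
      congr 1
      refine Finset.sum_congr rfl fun i hi => ?_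
      rw [Function.update_of_ne (Finset.mem_range.1 hi).ne]
    rcases le_total (dpValue w p c j (u - p j) - w j) (dpValue w p c j u) with hle | hle
    · have e : dpValue w p c (j + 1) u = dpValue w p c j u := max_eq_left hle
      rw [e] at h ⊢
      obtain ⟨x, h1, h2, h3⟩ := ih h
      refine ⟨Function.update x j 0, fun i => ?_, ?_, ?_⟩
      · rw [Function.update_apply]
        split_ifs
        exacts [Or.inl rfl, h1 i]
      · rw [key, h2]; ring
      · rw [key, h3]; ring
    · have e : dpValue w p c (j + 1) u = dpValue w p c j (u - p j) - w j := max_eq_right hle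
      rw [e] at h ⊢
      have := hw j
      obtain ⟨x, h1, h2, h3⟩ := ih (u := u - p j) (by omega)
      refine ⟨Function.update x j 1, fun i => ?_, ?_, ?_⟩
      · rw [Function.update_apply]
        split_ifs
        exacts [Or.inr rfl, h1 i]
      · rw [key, h2]; ring
      · rw [key, h3]; ring

theorem le_dpValue {x : ℕ → ℤ} (hx : ∀ i, x i = 0 ∨ x i = 1) (j : ℕ) :
    c + 1 - ∑ i ∈ Finset.range j, w i * x i
      ≤ dpValue w p c j (∑ i ∈ Finset.range j, p i * x i) := by
  induction j with
  | zero => simp [dpValue]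
  | succ j ih =>
    simp only [dpValue, Finset.sum_range_succ]
    rcases hx j with h | h
    · refine le_max_of_le_left ?_
      simpa [h] using ih
    · refine le_max_of_le_right ?_
      simp only [h, mul_one, add_sub_cancel_right]
      omega

end dpValue

theorem sum_mul_update {q x : ℤ → ℤ} {n k : ℕ} (hk : k < n) (hx : x k = 0) :
    ∑ i ∈ Finset.range n, q i * (Function.update x (k : ℤ) 1) i
      = ∑ i ∈ Finset.range n, q i * x i + q k := by
  have : ∀ i ∈ Finset.range n, q i * (Function.update x (k : ℤ) 1) i
      = q i * x i + if i = k then q k else 0 := by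
    intro i _
    rw [Function.update_apply]
    by_cases h : i = k
    · subst h; simp [hx]
    · simp [h]
  rw [Finset.sum_congr rfl this, Finset.sum_add_distrib, Finset.sum_ite_eq' (Finset.range n) k,
    if_pos (Finset.mem_range.2 hk)]

/-- Division with remainder by n: the improvement marks of different pairs of profit and item occupy
different cells of one array. -/
theorem pair_index_inj {n i j : ℕ} {u v : ℤ} (hi : i < n) (hj : j < n)
    (h : u * n + i = v * n + j) : u = v ∧ i = j := by
  have hn : (0 : ℤ) < n := by omega
  have e1 : u = (u * n + i) / n := by
    rw [add_comm, Int.add_mul_ediv_right _ _ hn.ne', Int.ediv_eq_zero_of_lt (by omega) (by omega)]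
    omega
  have e2 : v = (v * n + j) / n := by
    rw [add_comm, Int.add_mul_ediv_right _ _ hn.ne', Int.ediv_eq_zero_of_lt (by omega) (by omega)]
    omega
  have e3 : u = v := by rw [e1, h, ← e2]
  subst e3
  exact ⟨rfl, by omega⟩

/-! The program: the variables are `j` (number `2`), the largest profit reached so far (`3`) and the
current profit (`4`); array `3` holds the values `dpValue`, and array `4` holds, at the index
`u * n + j`, whether item `j` improved the entry for profit `u`. -/

def dpTarget : Expr := .add (.var 4) (.get 1 (.var 2))

def dpCandidate : Expr := .sub (.get 3 (.var 4)) (.get 0 (.var 2))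

/-- The entry for profit v is pushed to v + p_j, in place. Descending v ensures that the entry read
still belongs to the preceding items. The test asks for a strict improvement. -/
def dpBody : Cmd :=
  .seq
    (.ite (.add (.get 3 dpTarget) (.const 1)) dpCandidate
      (.seq (.store 3 dpTarget dpCandidate)
        (.seq (.store 4 (.add (.mul dpTarget (.var 0)) (.var 2)) (.const 1))
          (.ite (.add (.var 3) (.const 1)) dpTarget (.assign 3 dpTarget) .skip)))
      .skip)
    (.assign 4 (.sub (.var 4) (.const 1)))

/-- The scan starts at the largest profit reached so far, which is the source of the factor U in the
running time. -/
def dpItem : Cmd :=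
  .seq (.assign 4 (.var 3))
    (.seq (.loop (.const 0) (.var 4) dpBody) (.assign 2 (.add (.var 2) (.const 1))))

def dpBackStep : Cmd :=
  .seq
    (.ite (.const 1) (.get 4 (.add (.mul (.var 4) (.var 0)) (.var 2)))
      (.seq (.store 2 (.var 2) (.const 1)) (.assign 4 (.sub (.var 4) (.get 1 (.var 2)))))
      .skip)
    (.assign 2 (.sub (.var 2) (.const 1)))

/-- Dynamic programming for the ordinary knapsack problem. -/
def dpProgram : Cmd :=
  .seq (.store 3 (.const 0) (.add (.var 1) (.const 1)))
    (.seq (.loop (.add (.var 2) (.const 1)) (.var 0) dpItem)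
      (.seq (.assign 4 (.var 3))
        (.seq (.assign 2 (.sub (.var 0) (.const 1)))
          (.loop (.const 0) (.var 2) dpBackStep))))

section dpProgram

variable (n : ℕ) (w p : ℤ → ℤ) (c : ℤ)

/-- The state of the dynamic program while item `j` is treated, when all profits greater than `v`
have been treated. -/
structure DpInner (j : ℕ) (v : ℤ) (s : State) : Prop where
  var0 : s.var 0 = n
  var1 : s.var 1 = c
  var2 : s.var 2 = j
  var4 : s.var 4 = v
  arr0 : s.arr 0 = w
  arr1 : s.arr 1 = p
  arr2 : s.arr 2 = fun _ => 0
  arr3 : ∀ u, s.arr 3 u = if v + p j < u then dpValue w p c (j + 1) u else dpValue w p c j u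
  arr4 : ∀ u : ℤ, ∀ i < n, s.arr 4 (u * n + i) =
    if (i < j ∨ i = j ∧ v + p j < u) ∧ dpValue w p c i u < dpValue w p c (i + 1) u then 1 else 0
  best : 1 ≤ dpValue w p c (j + 1) (s.var 3)
  nonneg : 0 ≤ s.var 3
  zero : ∀ u, s.var 3 < u → s.arr 3 u = 0

/-- The state of the dynamic program when `j` items have been treated. -/
structure DpOuter (j : ℕ) (s : State) : Prop where
  var0 : s.var 0 = n
  var1 : s.var 1 = c
  var2 : s.var 2 = j
  arr0 : s.arr 0 = w
  arr1 : s.arr 1 = p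
  arr2 : s.arr 2 = fun _ => 0
  arr3 : s.arr 3 = dpValue w p c j
  arr4 : ∀ u : ℤ, ∀ i < n, s.arr 4 (u * n + i) =
    if i < j ∧ dpValue w p c i u < dpValue w p c (i + 1) u then 1 else 0
  best : 1 ≤ dpValue w p c j (s.var 3)
  nonneg : 0 ≤ s.var 3
  zero : ∀ u, s.var 3 < u → dpValue w p c j u = 0

/-- The state of the dynamic program while the solution of profit `V` is traced back, when the items
from `j` on have been treated. -/
structure DpBack (V : ℤ) (j : ℕ) (s : State) : Prop where
  var0 : s.var 0 = n
  var2 : s.var 2 = (j : ℤ) - 1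
  arr1 : s.arr 1 = p
  arr4 : ∀ u : ℤ, ∀ i < n, s.arr 4 (u * n + i) =
    if dpValue w p c i u < dpValue w p c (i + 1) u then 1 else 0
  le : 0 ≤ s.var 4 ∧ s.var 4 ≤ V
  reach : 1 ≤ dpValue w p c j (s.var 4)
  binary : ∀ i, s.arr 2 i = 0 ∨ s.arr 2 i = 1
  small : ∀ i : ℕ, i < j → s.arr 2 i = 0
  profit : ∑ i ∈ Finset.range n, p i * s.arr 2 i + s.var 4 = V
  weight : ∑ i ∈ Finset.range n, w i * s.arr 2 i + (c + 1 - dpValue w p c j (s.var 4))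
    = c + 1 - dpValue w p c n V

variable {n w p c}
variable {E : Env} {s : State} {cs : List BKP}

theorem dpBody_wp {U : ℕ} (hw : ∀ i, 0 ≤ w i) (hp : ∀ i, 0 ≤ p i) (hc : 0 ≤ c)
    (hU : ∀ u, 1 ≤ dpValue w p c n u → u ≤ U) (hX : (U : ℤ) ≤ E.X ∧ c + 1 ≤ E.X ∧ n ≤ E.X)
    {j : ℕ} (hj : j < n) {v : ℤ} (hv : 0 ≤ v) (h : DpInner n w p c j v s) (hvU : v ≤ U) :
    Wp E dpBody s cs 50 fun t ds => DpInner n w p c j (v - 1) t ∧ ds = cs := by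
  obtain ⟨hXU, hXc, hXn⟩ := hX
  have hpj := hp j
  have hwj := hw j
  have a3 := h.arr3
  -- Since p_j ≥ 0, neither the source nor the target has been updated for item j yet.
  have e1 : s.arr 3 v = dpValue w p c j v := by rw [a3, if_neg (by omega)]
  have e2 : s.arr 3 (v + p j) = dpValue w p c j (v + p j) := by rw [a3, if_neg (by omega)]
  have e3 : dpValue w p c (j + 1) (v + p j)
      = max (dpValue w p c j (v + p j)) (dpValue w p c j v - w j) := by
    simp [dpValue]
  have d1 := dpValue_nonneg (w := w) (p := p) hc j (v + p j)
  have d2 := dpValue_le (p := p) hw hc j v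
  refine Wp.le (a := dpBody.flat) (Wp.flat_seq ?_) (by decide)
  refine Wp.flat_ite rfl rfl (fun ht => ?_) (fun hf => ?_)
  · simp only [dpTarget, dpCandidate, Expr.eval, h.var4, h.var2, h.arr0, h.arr1, e1, e2] at ht
    have e4 : dpValue w p c (j + 1) (v + p j) = dpValue w p c j v - w j := by
      rw [e3]; exact max_eq_right (by omega)
    -- The target is now reachable, and entries only grow with further items, so the bound on the
    -- final profits applies.
    have e5 : v + p j ≤ U := hU _ ((show 1 ≤ dpValue w p c (j + 1) (v + p j) by omega).trans
      (dpValue_mono hj _))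
    refine Wp.flat_seq (Wp.flat_store rfl rfl ?_ ?_)
    · simp only [dpCandidate, Expr.eval, h.var4, h.var2, h.arr0, e1]
      rw [abs_le]; constructor <;> omega
    refine Wp.flat_seq (Wp.flat_store rfl rfl ?_ ?_)
    · simp only [Expr.eval, abs_one]; omega
    -- Serves both branches of the next test; V is the largest reached profit afterwards.
    have fin : ∀ V : ℤ, (V = s.var 3 ∧ v + p j ≤ s.var 3 ∨ V = v + p j ∧ s.var 3 < v + p j) →
        ∀ t : State, t.var = Function.update (Function.update s.var 3 V) 4 (v - 1) →
        t.arr = Function.update (Function.update s.arr 3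
            (Function.update (s.arr 3) (v + p j) (dpValue w p c j v - w j)))
          4 (Function.update (s.arr 4) ((v + p j) * n + j) 1) →
        DpInner n w p c j (v - 1) t := by
      intro V hV t ht1 ht2
      have b := h.best
      have nn := h.nonneg
      have zz := h.zero
      constructor
      · simp [ht1, h.var0]
      · simp [ht1, h.var1]
      · simp [ht1, h.var2]
      · simp [ht1]
      · simp [ht2, h.arr0]
      · simp [ht2, h.arr1]
      · simp [ht2, h.arr2]
      · intro u
        have g : t.arr 3 = Function.update (s.arr 3) (v + p j) (dpValue w p c j v - w j) := by
          simp [ht2]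
        rw [g, Function.update_apply]
        by_cases hu : u = v + p j
        · rw [if_pos hu, hu, if_pos (by omega), e4]
        · rw [if_neg hu, a3]
          by_cases hu' : v + p j < u
          · rw [if_pos hu', if_pos (by omega)]
          · rw [if_neg hu', if_neg (by omega)]
      · intro u i hi
        have g : t.arr 4 = Function.update (s.arr 4) ((v + p j) * n + j) 1 := by simp [ht2]
        rw [g, Function.update_apply]
        by_cases hu : u * n + i = (v + p j) * n + j
        · obtain ⟨rfl, rfl⟩ := pair_index_inj hi hj hu
          rw [if_pos rfl, if_pos ⟨Or.inr ⟨rfl, by omega⟩, by omega⟩]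
        · rw [if_neg hu, h.arr4 u i hi]
          refine if_congr (and_congr_left fun _ => or_congr_right
            (and_congr_right fun hij => ?_)) rfl rfl
          subst hij
          have : u ≠ v + p i := fun h => hu (by rw [h])
          omega
      · simp only [ht1, Function.update_apply]
        rcases hV with ⟨rfl, _⟩ | ⟨rfl, _⟩
        · simpa using b
        · simp only [Nat.reduceEqDiff, if_false, if_true]
          omega
      · simp only [ht1, Function.update_apply, Nat.reduceEqDiff, if_false, if_true]
        omega
      · intro u hu
        simp only [ht1, Function.update_apply, Nat.reduceEqDiff, if_false, if_true] at hu
        have g : t.arr 3 = Function.update (s.arr 3) (v + p j) (dpValue w p c j v - w j) := by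
          simp [ht2]
        rw [g, Function.update_of_ne (by omega)]
        exact zz u (by omega)
    refine Wp.flat_ite rfl rfl (fun ht' => ?_) (fun hf' => ?_)
    · simp [dpTarget, h.var4, h.var2, h.arr1] at ht'
      refine Wp.flat_assign rfl ?_ (Wp.flat_assign rfl ?_ ⟨fin (v + p j) ?_ _ ?_ ?_, rfl⟩)
      · simp [dpTarget, h.var4, h.var2, h.arr1]
        rw [abs_le]; constructor <;> omega
      · simp [h.var4]
        rw [abs_le]; constructor <;> omega
      · omega
      · simp [State.setVar, State.setArr, dpTarget, h.var4, h.var2, h.arr1]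
      · simp [State.setVar, State.setArr, dpTarget, dpCandidate, h.var4, h.var2, h.arr0, h.arr1, e1,
          h.var0]
    · simp [dpTarget, h.var4, h.var2, h.arr1] at hf'
      refine Wp.flat_skip (Wp.flat_assign rfl ?_ ⟨fin (s.var 3) ?_ _ ?_ ?_, rfl⟩)
      · simp [h.var4]
        rw [abs_le]; constructor <;> omega
      · omega
      · simp [State.setVar, State.setArr, h.var4]
      · simp [State.setVar, State.setArr, dpTarget, dpCandidate, h.var4, h.var2, h.arr0, h.arr1, e1,
          h.var0]
  · refine Wp.flat_skip (Wp.flat_assign rfl ?_ ⟨?_, rfl⟩)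
    · simp [h.var4]
      rw [abs_le]; constructor <;> omega
    simp only [dpTarget, dpCandidate, Expr.eval, h.var4, h.var2, h.arr0, h.arr1, e1, e2] at hf
    have e4 : dpValue w p c (j + 1) (v + p j) = dpValue w p c j (v + p j) := by
      rw [e3]; exact max_eq_left (by omega)
    constructor
    · simp [h.var0]
    · simp [h.var1]
    · simp [h.var2]
    · simp [h.var4]
    · simp [h.arr0]
    · simp [h.arr1]
    · simp [h.arr2]
    · intro u
      rw [State.setVar_arr, a3]
      by_cases hu : u = v + p j
      · rw [hu, if_neg (by omega), if_pos (by omega), e4]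
      · by_cases hu' : v + p j < u
        · rw [if_pos hu', if_pos (by omega)]
        · rw [if_neg hu', if_neg (by omega)]
    · intro u i hi
      rw [State.setVar_arr, h.arr4 u i hi]
      refine if_congr ?_ rfl rfl
      constructor
      · rintro ⟨h1 | h1, h2⟩
        · exact ⟨Or.inl h1, h2⟩
        · exact ⟨Or.inr ⟨h1.1, by omega⟩, h2⟩
      · rintro ⟨h1 | ⟨rfl, h1⟩, h2⟩
        · exact ⟨Or.inl h1, h2⟩
        · have : u ≠ v + p i := by rintro rfl; omega
          exact ⟨Or.inr ⟨rfl, by omega⟩, h2⟩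
    · simpa using h.best
    · simpa using h.nonneg
    · simpa using h.zero

theorem dpItem_wp {U : ℕ} (hw : ∀ i, 0 ≤ w i) (hp : ∀ i, 0 ≤ p i) (hc : 0 ≤ c)
    (hU : ∀ u, 1 ≤ dpValue w p c n u → u ≤ U) (hX : (U : ℤ) ≤ E.X ∧ c + 1 ≤ E.X ∧ n ≤ E.X)
    {j : ℕ} (hj : j < n) (h : DpOuter n w p c j s) :
    Wp E dpItem s cs (54 * (U + 3)) fun t ds => DpOuter n w p c (j + 1) t ∧ ds = cs := by
  have hVU : s.var 3 ≤ U := hU _ (h.best.trans (dpValue_mono hj.le _))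
  have hV0 := h.nonneg
  have hpj := hp j
  have hwj := hw j
  obtain ⟨hXU, hXc, hXn⟩ := hX
  refine Wp.le (Wp.seq (Wp.assign rfl ?_ (Wp.seq (a₂ := 4) (Wp.loop (a := 50) ((s.var 3).toNat + 1)
    (fun i t ds => DpInner n w p c j (s.var 3 - i) t ∧ ds = cs) rfl rfl ⟨?_, rfl⟩ ?_ ?_)))) ?_
  · simp only [Expr.eval]
    rw [abs_le]; constructor <;> omega
  · have hout : ∀ u, s.var 3 < u → dpValue w p c j u = 0 := h.zero
    -- Profits this large can be reached neither without item j nor with it, so the scan may begin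
    -- at the present maximum.
    have hstep : ∀ u, s.var 3 + p j < u → dpValue w p c (j + 1) u = dpValue w p c j u := by
      intro u hu
      simp only [dpValue]
      rw [hout u (by omega), hout (u - p j) (by omega)]
      omega
    constructor
    · simp [h.var0]
    · simp [h.var1]
    · simp [h.var2]
    · simp
    · simp [h.arr0]
    · simp [h.arr1]
    · simp [h.arr2]
    · intro u
      simp only [State.setVar_arr, h.arr3, Nat.cast_zero, sub_zero]
      split_ifs with hu
      · rw [hstep u hu]
      · rfl
    · intro u i hi
      rw [State.setVar_arr, h.arr4 u i hi]
      refine if_congr ?_ rfl rfl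
      constructor
      · exact fun h => ⟨Or.inl h.1, h.2⟩
      · rintro ⟨h1 | ⟨rfl, h1⟩, h2⟩
        · exact ⟨h1, h2⟩
        · rw [hstep u (by simpa using h1)] at h2
          exact absurd h2 (lt_irrefl _)
    · simpa using h.best.trans (dpValue_mono (Nat.le_succ j) _)
    · simpa using h.nonneg
    · simpa [h.arr3] using h.zero
  · rintro i hi t ds ⟨ht, rfl⟩
    refine ⟨?_, ?_⟩
    · simp only [Expr.eval, ht.var4]
      omega
    · refine (dpBody_wp hw hp hc hU ⟨hXU, hXc, hXn⟩ hj (by omega) ht (by omega)).mono le_rfl ?_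
      rintro t' ds' ⟨h1, rfl⟩
      refine ⟨?_, rfl⟩
      have : s.var 3 - ((i + 1 : ℕ) : ℤ) = s.var 3 - i - 1 := by push_cast; ring
      rwa [this]
  · rintro t ds ⟨ht, rfl⟩
    refine ⟨?_, Wp.assign rfl ?_ ⟨?_, rfl⟩⟩
    · simp only [Expr.eval, ht.var4]
      omega
    · simp only [Expr.eval, ht.var2]
      rw [abs_le]; constructor <;> omega
    -- After v = 0 the invariant holds with v = -1; the targets not yet covered have u < p_j, and
    -- their sources would be negative profits.
    have hv : s.var 3 - (((s.var 3).toNat + 1 : ℕ) : ℤ) = -1 := by push_cast; omega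
    have g3 : t.arr 3 = dpValue w p c (j + 1) := by
      funext u
      rw [ht.arr3, hv]
      split_ifs with hu
      · rfl
      · simp only [dpValue]
        rw [dpValue_of_neg hw hp j (u := u - p j) (by omega)]
        have := dpValue_nonneg (w := w) (p := p) hc j u
        omega
    constructor
    · simp [ht.var0]
    · simp [ht.var1]
    · simp [ht.var2]
    · simp [ht.arr0]
    · simp [ht.arr1]
    · simp [ht.arr2]
    · simp [g3]
    · intro u i hi
      rw [State.setVar_arr, ht.arr4 u i hi]
      refine if_congr ?_ rfl rfl
      constructor
      · rintro ⟨h1, h2⟩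
        exact ⟨by omega, h2⟩
      · rintro ⟨h1, h2⟩
        refine ⟨?_, h2⟩
        rcases Nat.lt_succ_iff_lt_or_eq.1 h1 with h3 | rfl
        · exact Or.inl h3
        · refine Or.inr ⟨rfl, ?_⟩
          by_contra hu
          simp only [dpValue] at h2
          rw [dpValue_of_neg hw hp i (u := u - p i) (by omega)] at h2
          have := dpValue_nonneg (w := w) (p := p) hc i u
          omega
    · simpa using ht.best
    · simpa using ht.nonneg
    · have := ht.zero
      rw [g3] at this
      simpa using this
  · simp only [Expr.steps]
    have : (s.var 3).toNat ≤ U := by omega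
    omega

/-- A mark means that the maximum in the recursion is attained only with item j, so j is taken and
the profit drops by p_j; without a mark the value is the same without item j. -/
theorem dpBackStep_wp {U : ℕ} (hw : ∀ i, 0 ≤ w i) (hp : ∀ i, 0 ≤ p i) (hc : 0 ≤ c)
    (hX : (U : ℤ) ≤ E.X ∧ 1 ≤ E.X ∧ n ≤ E.X) {V : ℤ} (hV : V ≤ U)
    {j : ℕ} (hj : j < n) (h : DpBack n w p c V (j + 1) s) :
    Wp E dpBackStep s cs 30 fun t ds => DpBack n w p c V j t ∧ ds = cs := by
  obtain ⟨hXU, hXc, hXn⟩ := hX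
  have hpj := hp j
  have hwj := hw j
  obtain ⟨hv0, hv1⟩ := h.le
  have hv2 : s.var 2 = j := by rw [h.var2]; push_cast; ring
  have hx0 : s.arr 2 j = 0 := h.small j (Nat.lt_succ_self j)
  have hr := h.reach
  have hr0 := dpValue_nonneg (w := w) (p := p) hc j (s.var 4)
  have e4 := h.arr4 (s.var 4) j hj
  have hd : dpValue w p c (j + 1) (s.var 4)
    = max (dpValue w p c j (s.var 4)) (dpValue w p c j (s.var 4 - p j) - w j) := rfl
  refine Wp.le (a := dpBackStep.flat) (Wp.flat_seq ?_) (by decide)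
  refine Wp.flat_ite rfl rfl (fun ht => ?_) (fun hf => ?_)
  · simp only [Expr.eval, h.var0, hv2, e4] at ht
    split_ifs at ht with hlt
    swap
    · omega
    have hd' : dpValue w p c (j + 1) (s.var 4) = dpValue w p c j (s.var 4 - p j) - w j := by omega
    have hv3 : 0 ≤ s.var 4 - p j := by
      by_contra hneg
      rw [dpValue_of_neg hw hp j (u := s.var 4 - p j) (by omega)] at hd'
      omega
    refine Wp.flat_seq (Wp.flat_store rfl rfl ?_ (Wp.flat_assign rfl ?_ (Wp.flat_assign rfl ?_
      ⟨?_, rfl⟩)))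
    · simp only [Expr.eval, abs_one]; omega
    · simp [hv2, h.arr1]
      rw [abs_le]; constructor <;> omega
    · simp [hv2]
      rw [abs_le]; constructor <;> omega
    have upd : ∀ q : ℤ → ℤ, ∑ i ∈ Finset.range n, q i * (Function.update (s.arr 2) (j : ℤ) 1) i
      = ∑ i ∈ Finset.range n, q i * s.arr 2 i + q j := fun q => sum_mul_update hj hx0
    have hP := h.profit
    have hW := h.weight
    constructor
    · simp [h.var0]
    · simp [hv2]
    · simp [h.arr1]
    · simpa using h.arr4
    · simp [hv2, h.arr1]
      omega
    · simp [hv2, h.arr1]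
      omega
    · intro i
      simp only [State.setVar_arr, State.setArr_arr, Expr.eval, hv2, if_true, Function.update_apply]
      split_ifs
      exacts [Or.inr rfl, h.binary i]
    · intro i hi
      simp only [State.setVar_arr, State.setArr_arr, Expr.eval, hv2, if_true]
      rw [Function.update_of_ne (by exact_mod_cast hi.ne)]
      exact h.small i (by omega)
    · simp [hv2, h.arr1, upd]
      omega
    · simp [hv2, h.arr1, upd]
      omega
  · simp only [Expr.eval, h.var0, hv2, e4] at hf
    split_ifs at hf with hlt
    · omega
    have hd' : dpValue w p c (j + 1) (s.var 4) = dpValue w p c j (s.var 4) := by omega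
    refine Wp.flat_skip (Wp.flat_assign rfl ?_ ⟨?_, rfl⟩)
    · simp [hv2]
      rw [abs_le]; constructor <;> omega
    have hW := h.weight
    constructor
    · simp [h.var0]
    · simp [hv2]
    · simp [h.arr1]
    · simpa using h.arr4
    · simpa using h.le
    · simpa [← hd'] using h.reach
    · simpa using h.binary
    · intro i hi
      simpa using h.small i (by omega)
    · simpa using h.profit
    · simpa [← hd'] using h.weight

theorem dpProgram_wp {U : ℕ} (hw : ∀ i, 0 ≤ w i) (hp : ∀ i, 0 ≤ p i) (hc : 0 ≤ c)
    (hU : ∀ u, 1 ≤ dpValue w p c n u → u ≤ U) (hX : (U : ℤ) ≤ E.X ∧ c + 1 ≤ E.X ∧ n ≤ E.X)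
    (h0 : s.var 0 = n) (h1 : s.var 1 = c) (h2 : s.var 2 = 0) (h3 : s.var 3 = 0)
    (a0 : s.arr 0 = w) (a1 : s.arr 1 = p) (a2 : s.arr 2 = fun _ => 0) (a3 : s.arr 3 = fun _ => 0)
    (a4 : s.arr 4 = fun _ => 0) :
    Wp E dpProgram s cs (100 * ((n + 1) * (U + 3))) fun t ds => ds = cs ∧
      (∀ i, t.arr 2 i = 0 ∨ t.arr 2 i = 1) ∧ ∑ i ∈ Finset.range n, w i * t.arr 2 i ≤ c ∧
      ∀ u, 1 ≤ dpValue w p c n u → u ≤ ∑ i ∈ Finset.range n, p i * t.arr 2 i := by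
  obtain ⟨hXU, hXc, hXn⟩ := id hX
  refine Wp.le (Wp.seq (Wp.store rfl rfl ?_ (Wp.seq (Wp.loop (a := 54 * (U + 3)) n
    (fun i t ds => DpOuter n w p c i t ∧ ds = cs) rfl rfl ⟨?_, rfl⟩ ?_ ?_)))) ?_
    (a := 5 + ((n + 1) * (5 + 54 * (U + 3)) + (2 + (4 + (n + 1) * 33))))
  · simp only [Expr.eval, h1]
    rw [abs_le]; constructor <;> omega
  · constructor
    · simp [h0]
    · simp [h1]
    · simp [h2]
    · simp [a0]
    · simp [a1]
    · simp [a2]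
    · funext u
      simp [a3, h1, dpValue, Function.update_apply]
    · simp [a4]
    · simp [h3, dpValue, hc]
    · simp [h3]
    · intro u hu
      simp only [State.setArr_var, h3] at hu
      simp [dpValue, hu.ne']
  · rintro i hi t ds ⟨ht, rfl⟩
    refine ⟨?_, dpItem_wp hw hp hc hU hX hi ht⟩
    simp only [Expr.eval, ht.var2, ht.var0]
    omega
  · rintro t ds ⟨ht, rfl⟩
    have hVU := hU _ ht.best
    have hV0 := ht.nonneg
    refine ⟨?_, Wp.seq (Wp.assign rfl ?_ (Wp.seq (Wp.assign rfl ?_ (Wp.loop (a := 30) n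
      (fun i t' ds' => DpBack n w p c (t.var 3) (n - i) t' ∧ ds' = ds) rfl rfl ⟨?_, rfl⟩
      ?_ ?_))))⟩
    · simp only [Expr.eval, ht.var2, ht.var0]
      omega
    · simp only [Expr.eval]
      rw [abs_le]; constructor <;> omega
    · simp [ht.var0]
      rw [abs_le]; constructor <;> omega
    · constructor
      · simp [ht.var0]
      · simp [ht.var0]
      · simp [ht.arr1]
      · intro u i hi
        rw [State.setVar_arr, State.setVar_arr, ht.arr4 u i hi]
        simp [hi]
      · simpa using hV0
      · simpa using ht.best
      · simp [ht.arr2]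
      · simp [ht.arr2]
      · simp [ht.arr2]
      · simp [ht.arr2]
    · rintro i hi t' ds' ⟨ht', rfl⟩
      obtain ⟨r, hr⟩ : ∃ r, n - i = r + 1 := ⟨n - i - 1, by omega⟩
      have hr' : n - (i + 1) = r := by omega
      rw [hr] at ht'
      rw [hr']
      refine ⟨?_, dpBackStep_wp hw hp hc ⟨hXU, by omega, hXn⟩ hVU (by omega) ht'⟩
      simp only [Expr.eval, ht'.var2]
      omega
    · rintro t' ds' ⟨ht', rfl⟩
      rw [Nat.sub_self] at ht'
      have hr := ht'.reach
      have hW := ht'.weight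
      have hP := ht'.profit
      refine ⟨?_, rfl, ht'.binary, ?_, ?_⟩
      · simp only [Expr.eval, ht'.var2]
        omega
      · have hb := ht.best
        have := dpValue_le (p := p) hw hc 0 (t'.var 4)
        omega
      · intro u hu
        -- With no items left, only profit 0 has a positive entry, so the traced solution accounts
        -- for the whole profit V.
        have hz : t'.var 4 = 0 := by
          by_contra hne
          simp only [dpValue, if_neg hne] at hr
          omega
        rw [hz, add_zero] at hP
        rw [hP]
        by_contra hlt
        have := ht.zero u (by omega)
        omega
  · have e1 : (n + 1) * (5 + 54 * (U + 3)) = (n + 1) * (54 * U + 167) := by ring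
    have e2 : (n + 1) * (54 * U + 167) + (n + 1) * 33 + (n + 1) * 20
      ≤ 100 * ((n + 1) * (U + 3)) := by
      have : 100 * ((n + 1) * (U + 3)) = (n + 1) * (54 * U + 167) + (n + 1) * 33 + (n + 1) * 20
        + (n + 1) * (46 * U + 80) := by ring
      omega
    omega

end dpProgram

/-- The environment of a program without subroutine. -/
def noSub (X : ℕ) : Env := ⟨fun _ _ _ => False, fun _ => ⟨0, 0, []⟩, X⟩

theorem dpProgram_runs (B : BKP) {U : ℕ} (hU : ∀ x, B.Feasible x → B.profit x ≤ U) :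
    ∃ g k, RunsBKP dpProgram B g k ∧ B.IsOptimal (ofArr B.n g) ∧
      k.steps ≤ 100 * ((B.n + 1) * (U + 3)) ∧
      k.bits ≤ 100 * ((B.n + 1) * (U + 3)) * unitCost (B.n + B.maxCoeff + U + 1) := by
  have hw : ∀ i, 0 ≤ toArr B.w i := toArr_nonneg _
  have hp : ∀ i, 0 ≤ toArr B.p i := toArr_nonneg _
  have hwm : ∀ j, B.w j ≤ B.maxCoeff := fun j =>
    le_max_of_le_right (le_max_of_le_left (Finset.le_sup (f := B.w) (Finset.mem_univ j)))
  have hpm : ∀ j, B.p j ≤ B.maxCoeff := fun j =>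
    le_max_of_le_right (le_max_of_le_right (Finset.le_sup (f := B.p) (Finset.mem_univ j)))
  have hcm : B.c ≤ B.maxCoeff := le_max_left _ _
  -- U enters the analysis only: every reachable profit belongs to a feasible solution.
  have hreach : ∀ u, 1 ≤ dpValue (toArr B.w) (toArr B.p) B.c B.n u → u ≤ U := by
    intro u hu
    obtain ⟨x, h1, h2, h3⟩ := exists_of_one_le_dpValue hu hw
    have e : ∀ v : Fin B.n → ℕ, ∑ j, (v j : ℤ) * x j
        = ∑ j ∈ Finset.range B.n, toArr v (j : ℤ) * x j := by
      intro v
      rw [← Fin.sum_univ_eq_sum_range (fun j : ℕ => toArr v (j : ℤ) * x j) B.n]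
      simp
    have := hU (fun j => x j) ⟨fun j => h1 j, by rw [e, h3]; omega⟩
    rw [BKP.profit, e, h2] at this
    exact this
  obtain ⟨t, k, ht1, -, ht3, ht4, ht5, ht6, ht7, ht8⟩ :=
    dpProgram_wp (E := noSub (B.n + B.maxCoeff + U + 1)) (s := B.load) (cs := []) (U := U) hw hp
      (by omega) hreach ⟨by simp [noSub]; omega, by simp [noSub]; omega, by simp [noSub]; omega⟩
      rfl rfl rfl rfl rfl rfl rfl rfl rfl (by
        refine ⟨fun v => ?_, fun a i => ?_⟩
        · simp only [BKP.load, noSub]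
          rw [abs_le]
          split_ifs <;> constructor <;> push_cast <;> omega
        · have b1 := abs_toArr_le B.w hwm i
          have b2 := abs_toArr_le B.p hpm i
          simp only [BKP.load, noSub]
          split_ifs
          · push_cast; omega
          · push_cast; omega
          · simp only [abs_zero]; omega)
  have hcalls : k.calls = [] := by simpa using ht5
  rw [hcalls] at ht3 ht4
  refine ⟨t.arr 2, k, ⟨t, ht1, rfl⟩, ⟨⟨fun j => ht6 _, ?_⟩, ?_⟩, by simpa using ht3,
    by simpa [noSub] using ht4⟩
  · rw [sum_ofArr]; exact ht7
  · intro y hy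
    rw [BKP.profit, BKP.profit, sum_ofArr]
    let x : ℕ → ℤ := fun i => if h : i < B.n then y ⟨i, h⟩ else 0
    have hx : ∀ i, x i = 0 ∨ x i = 1 := by
      intro i
      simp only [x]
      split_ifs with h
      exacts [hy.1 _, Or.inl rfl]
    have e : ∀ v : Fin B.n → ℕ, ∑ j ∈ Finset.range B.n, toArr v (j : ℤ) * x j
        = ∑ j, (v j : ℤ) * y j := by
      intro v
      rw [← Fin.sum_univ_eq_sum_range (fun j : ℕ => toArr v (j : ℤ) * x j) B.n]
      simp [x]
    have := le_dpValue (w := toArr B.w) (p := toArr B.p) (c := B.c) hx B.n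
    rw [e, e] at this
    have hyw := hy.2
    exact ht8 _ (by omega)

end Knap

namespace Knap

/-! ## The program for (SOCKP)

The variables are `j` (number `4`), `∑ σ ^ 2` (`5`), `m` (`6`), `i` (`7`), `h` (`8`), `2 * h + 1`
(`9`), `σ i` (`10`), the number of pieces with positive contribution (`11`), the capacity (`12`), the
profit of the current solution (`13`) and the best profit (`14`). Array `4` holds the weights, array
`5` the solution that the subroutine returns. -/

def incr (v : ℕ) : Cmd := .assign v (.add (.var v) (.const 1))

/-- For `v` from its present value to the value of the variable `u`, exclusively. -/
def forLoop (v u : ℕ) (c : Cmd) : Cmd := .loop (.add (.var v) (.const 1)) (.var u) c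

def sumSqBody : Cmd :=
  .seq (.assign 5 (.add (.var 5) (.mul (.get 2 (.var 4)) (.get 2 (.var 4))))) (incr 4)

/-- Computation of `m*`. -/
def piecesProgram : Cmd :=
  .seq (.loop
      (.add (.mul (.const 4) (.mul (.var 6) (.var 6))) (.const 1))
      (.mul (.mul (.var 2) (.var 2)) (.mul (.var 0) (.var 5))) (incr 6))
    (incr 6)

def profitBody : Cmd :=
  .seq (.assign 13 (.add (.var 13) (.mul (.get 1 (.var 4)) (.get 5 (.var 4))))) (incr 4)

def copyBody : Cmd := .seq (.store 3 (.var 4) (.get 5 (.var 4))) (incr 4)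

/-- Solve the knapsack problem in the memory, and update the best solution. -/
def solveProgram : Cmd :=
  .seq (.call 0 12 4 1 5)
    (.seq (.assign 13 (.const 0))
      (.seq (.assign 4 (.const 0))
        (.seq (forLoop 4 0 profitBody)
          (.ite (.add (.var 14) (.const 1)) (.var 13)
            (.seq (.assign 14 (.var 13)) (.seq (.assign 4 (.const 0)) (forLoop 4 0 copyBody)))
            .skip))))

def noneWeightBody : Cmd :=
  .seq (.store 4 (.var 4) (.add (.get 0 (.var 4)) (.mul (.var 2) (.get 2 (.var 4))))) (incr 4)

/-- The number K of positive pieces is computed first; the weight then has the closed form in K y -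
s K², so an item costs O(1) operations instead of O(m*). -/
def pairWeightBody : Cmd :=
  .seq
    (.ite (.mul (.const 2) (.mul (.var 10) (.var 6)))
      (.add (.mul (.get 2 (.var 4)) (.var 9)) (.var 10))
      (.assign 11 (.var 6))
      (.assign 11 (.div (.add (.mul (.get 2 (.var 4)) (.var 9)) (.var 10))
        (.mul (.const 2) (.var 10)))))
    (.seq
      (.store 4 (.var 4)
        (.add (.mul (.mul (.var 6) (.var 9)) (.get 0 (.var 4)))
          (.mul (.var 2) (.sub (.mul (.var 11) (.mul (.get 2 (.var 4)) (.var 9)))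
            (.mul (.var 10) (.mul (.var 11) (.var 11)))))))
      (incr 4))

/-- Negative capacities must be skipped: a call would truncate the capacity to 0 and pose a
different problem. -/
def pairBody : Cmd :=
  .seq (.assign 9 (.add (.mul (.const 2) (.var 8)) (.const 1)))
    (.seq (.assign 12 (.sub (.mul (.mul (.var 6) (.var 9)) (.var 1))
        (.mul (.mul (.var 2) (.var 10)) (.mul (.var 6) (.var 6)))))
      (.seq
        (.ite (.const 0) (.var 12)
          (.seq (.assign 4 (.const 0)) (.seq (forLoop 4 0 pairWeightBody) solveProgram))
          .skip)
        (incr 8)))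

def itemBody : Cmd :=
  .seq (.assign 10 (.get 2 (.var 7)))
    (.seq (.assign 8 (.const 0)) (.seq (forLoop 8 6 pairBody) (incr 7)))

/-- The program for (SOCKP). -/
def socProgram : Cmd :=
  .seq (forLoop 4 0 sumSqBody)
    (.seq piecesProgram
      (.seq (.assign 4 (.const 0))
        (.seq (forLoop 4 0 noneWeightBody)
          (.seq (.assign 12 (.var 1))
            (.seq solveProgram (forLoop 7 0 itemBody))))))

/-! ### Invariants and register bounds of the (SOCKP) program -/

namespace SOCKP

variable (I : SOCKP)

/-- A bound for all registers during the execution of the program for (SOCKP). -/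
noncomputable def regBound : ℕ :=
  4 * I.mstar ^ 2 * (I.maxCoeff + 1) ^ 2 + I.n * (I.maxCoeff + 1) ^ 2 + I.mstar + 1

/-- The part of the memory that describes the instance and the number of pieces. -/
structure Ctx (s : State) : Prop where
  var0 : s.var 0 = I.n
  var1 : s.var 1 = I.b
  var2 : s.var 2 = I.Ω
  var6 : s.var 6 = I.mstar
  arr0 : s.arr 0 = toArr I.a
  arr1 : s.arr 1 = toArr I.p
  arr2 : s.arr 2 = toArr I.σ

/-- The best solution found by the calls `cs` is stored in the memory. -/
structure Best (cs : List BKP) (s : State) : Prop where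
  feasible : I.Feasible (ofArr I.n (s.arr 3))
  profit : s.var 14 = I.profit (ofArr I.n (s.arr 3))
  calls : ∀ B ∈ cs, ∃ l, I.IsSub I.mstar l B
  upper : ∀ B ∈ cs, ∀ g, B.Feasible (ofArr B.n g) → B.profit (ofArr B.n g) ≤ s.var 14

variable {I}

theorem a_le (j : Fin I.n) : I.a j ≤ I.maxCoeff :=
  le_max_of_le_right (le_max_of_le_right (le_max_of_le_left
    (Finset.le_sup (f := I.a) (Finset.mem_univ j))))

theorem p_le (j : Fin I.n) : I.p j ≤ I.maxCoeff :=
  le_max_of_le_right (le_max_of_le_left (Finset.le_sup (f := I.p) (Finset.mem_univ j)))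

theorem σ_le (j : Fin I.n) : I.σ j ≤ I.maxCoeff :=
  le_max_of_le_right (le_max_of_le_right (le_max_of_le_right
    (Finset.le_sup (f := I.σ) (Finset.mem_univ j))))

theorem b_le : I.b ≤ I.maxCoeff := le_max_of_le_left (le_max_left _ _)

theorem Ω_le : I.Ω ≤ I.maxCoeff := le_max_of_le_left (le_max_right _ _)

theorem Ctx.congr {s t : State} (h : I.Ctx s)
    (hv : ∀ v, v = 0 ∨ v = 1 ∨ v = 2 ∨ v = 6 → t.var v = s.var v)
    (ha : ∀ a, a < 3 → t.arr a = s.arr a) : I.Ctx t where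
  var0 := by rw [hv 0 (by simp), h.var0]
  var1 := by rw [hv 1 (by simp), h.var1]
  var2 := by rw [hv 2 (by simp), h.var2]
  var6 := by rw [hv 6 (by simp), h.var6]
  arr0 := by rw [ha 0 (by simp), h.arr0]
  arr1 := by rw [ha 1 (by simp), h.arr1]
  arr2 := by rw [ha 2 (by simp), h.arr2]

theorem Best.congr {cs : List BKP} {s t : State} (h : I.Best cs s) (hv : t.var 14 = s.var 14)
    (ha : t.arr 3 = s.arr 3) : I.Best cs t where
  feasible := by rw [ha]; exact h.feasible
  profit := by rw [ha, hv]; exact h.profit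
  calls := h.calls
  upper := by rw [hv]; exact h.upper

theorem profit_partial_bounds {g : ℤ → ℤ} (hg : ∀ j : ℕ, j < I.n → g j = 0 ∨ g j = 1)
    {i : ℕ} (hi : i ≤ I.n) :
    |∑ j ∈ Finset.range i, toArr I.p (j : ℤ) * g j| ≤ I.n * I.maxCoeff := by
  have h1 : ∀ j ∈ Finset.range i, |toArr I.p (j : ℤ) * g j| ≤ (I.maxCoeff : ℤ) := by
    intro j hj
    rcases hg j (by have := Finset.mem_range.1 hj; omega) with h | h
    · simp [h]
    · rw [h, mul_one]
      exact abs_toArr_le I.p p_le j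
  refine (Finset.abs_sum_le_sum_abs _ _).trans ((Finset.sum_le_card_nsmul _ _ _ h1).trans ?_)
  rw [Finset.card_range, nsmul_eq_mul]
  gcongr

/-- The components cover profits, counters, the sum of the σ_j², and, in the last one, the scaled
weights and capacities. -/
theorem le_regBound : I.n * I.maxCoeff ≤ I.regBound ∧ I.n ≤ I.regBound ∧ 1 ≤ I.regBound ∧
    I.mstar ≤ I.regBound ∧ I.maxCoeff ≤ I.regBound ∧ I.n * I.maxCoeff ^ 2 ≤ I.regBound ∧
    2 * I.mstar + 1 ≤ I.regBound ∧ I.maxCoeff * 2 ≤ I.regBound ∧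
    2 * I.mstar ^ 2 * I.maxCoeff + 2 * I.mstar ^ 2 * I.maxCoeff ^ 2 ≤ I.regBound := by
  have hm := mstar_pos (I := I)
  unfold regBound
  generalize I.mstar = m at *
  generalize I.maxCoeff = P at *
  generalize I.n = n at *
  obtain ⟨m, rfl⟩ : ∃ r, m = r + 1 := ⟨m - 1, by omega⟩
  refine ⟨?_, ?_, ?_, ?_, ?_, ?_, ?_, ?_, ?_⟩ <;> ring_nf <;>
    nlinarith [Nat.zero_le (m * P), Nat.zero_le (m * P ^ 2), Nat.zero_le (m ^ 2 * P),
      Nat.zero_le (m ^ 2 * P ^ 2), Nat.zero_le (n * P), Nat.zero_le (n * P ^ 2),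
      Nat.zero_le (P ^ 2), Nat.zero_le (m ^ 2), Nat.zero_le n, Nat.zero_le m, Nat.zero_le P]

end SOCKP

open SOCKP

variable {I : SOCKP} {E : Env} {s : State} {cs : List BKP}

/-- The subroutine of the environment solves every ordinary knapsack problem. -/
def Env.Solves (E : Env) : Prop :=
  ∀ B : BKP, 0 < B.n → ∃ g, E.Sub B g (E.cost B) ∧ B.IsOptimal (ofArr B.n g)

/-- The optimum of any `B_l` is feasible for (SOCKP) by `feasible_iff_exists_inSub`, so replacing
the stored solution by a more profitable one keeps it feasible. -/
theorem solveProgram_wp (hn : 0 < I.n) (hE : E.Solves) (hX : I.regBound ≤ E.X) (hs : I.Ctx s)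
    (hb : I.Best cs s) (hB : ∃ l, I.IsSub I.mstar l (s.readBKP 0 12 4 1)) :
    Wp E solveProgram s cs (60 * (I.n + 1)) fun t ds =>
      ds = cs ++ [s.readBKP 0 12 4 1] ∧ I.Best ds t ∧
      (∀ v, v ≠ 4 → v ≠ 13 → v ≠ 14 → t.var v = s.var v) ∧
      ∀ a, a ≠ 3 → a ≠ 5 → t.arr a = s.arr a := by
  obtain ⟨hX1, hX2, hX3, -⟩ := le_regBound (I := I)
  set B := s.readBKP 0 12 4 1 with hBdef
  have hBn : B.n = I.n := by simp [hBdef, State.readBKP, hs.var0]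
  obtain ⟨l, hl⟩ := hB
  obtain ⟨g, hsub, hopt⟩ := hE B (by omega)
  have hg01 : ∀ j : ℕ, j < I.n → g j = 0 ∨ g j = 1 := fun j hj => hopt.1.1 ⟨j, by omega⟩
  have hgabs : ∀ j : ℕ, j < I.n → |g j| ≤ 1 := fun j hj => by
    rcases hg01 j hj with h | h <;> simp [h]
  have hgfeas : I.Feasible (ofArr I.n g) :=
    feasible_iff_exists_inSub.2 ⟨l, (hl.feasible_iff mstar_pos g).1 hopt.1⟩
  have hgprofit : I.profit (ofArr I.n g) = ∑ j ∈ Finset.range I.n, toArr I.p (j : ℤ) * g j :=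
    sum_ofArr I.p g
  have hgB : ∀ g', B.Feasible (ofArr B.n g') → B.profit (ofArr B.n g') ≤ I.profit (ofArr I.n g) := by
    intro g' h
    rw [← hl.profit_eq g]
    exact hopt.2 _ h
  refine Wp.le (a := (3 * B.n + 3) + (2 + (2 + ((I.n + 1) * (5 + 15) + (5 +
    (2 + (2 + (I.n + 1) * (5 + 10)))))))) (Wp.seq (Wp.call (g := g) hsub ?_ ?_)) (by omega)
  · intro i h0 h1
    obtain ⟨j, rfl⟩ := Int.eq_ofNat_of_zero_le h0
    have := hgabs j (by rw [← hBdef, hBn] at h1; exact_mod_cast h1)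
    omega
  rw [← hBdef, hBn]
  set s₁ := s.copyArr 5 I.n g with hs₁
  have h1v : s₁.var = s.var := rfl
  have h15 : ∀ j : ℕ, j < I.n → s₁.arr 5 j = g j := by
    intro j hj
    simp [hs₁, hj]
  have h1a : ∀ a, a ≠ 5 → s₁.arr a = s.arr a := by
    intro a ha
    simp [hs₁, ha]
  clear_value s₁
  refine Wp.seq (Wp.assign rfl (by simp) (Wp.seq (Wp.assign rfl (by simp) (Wp.seq
    (Wp.loop (a := 15) I.n (fun i t ds => ds = cs ++ [B] ∧ t.var 4 = i ∧
      t.var 13 = ∑ j ∈ Finset.range i, toArr I.p (j : ℤ) * g j ∧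
      (∀ v, v ≠ 4 → v ≠ 13 → t.var v = s.var v) ∧ t.arr = s₁.arr) rfl rfl ?_ ?_ ?_)))))
  · refine ⟨rfl, by simp, by simp, fun v h4 h13 => ?_, rfl⟩
    simp [h4, h13, h1v]
  · rintro i hi t ds ⟨rfl, ht4, ht13, htv, hta⟩
    have ht0 := htv 0 (by simp) (by simp)
    rw [hs.var0] at ht0
    refine ⟨?_, Wp.le (a := profitBody.flat) (Wp.flat_seq (Wp.flat_assign rfl ?_
      (Wp.flat_assign rfl ?_ ⟨rfl, ?_, ?_, ?_, ?_⟩))) (by decide)⟩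
    · simp only [Expr.eval, ht4, ht0]
      omega
    · have := profit_partial_bounds hg01 (i := i + 1) hi
      rw [Finset.sum_range_succ] at this
      simp only [Expr.eval, ht4, ht13, hta, h15 i hi, h1a 1 (by simp), hs.arr1]
      refine this.trans ?_
      exact_mod_cast hX1.trans hX
    · simp [ht4]
      rw [abs_le]; constructor <;> omega
    · simp [ht4]
    · rw [Finset.sum_range_succ]
      simp [ht4, ht13, hta, h15 i hi, h1a 1, hs.arr1]
    · intro v h4 h13
      simp [h4, h13, htv v h4 h13]
    · simpa using hta
  · rintro t ds ⟨rfl, ht4, ht13, htv, hta⟩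
    have ht0 := htv 0 (by simp) (by simp)
    rw [hs.var0] at ht0
    have ht14 := htv 14 (by simp) (by simp)
    rw [← hgprofit] at ht13
    have hpb := profit_partial_bounds hg01 (i := I.n) le_rfl
    rw [← hgprofit] at hpb
    have hpX : |I.profit (ofArr I.n g)| ≤ (E.X : ℤ) := by
      refine hpb.trans ?_
      exact_mod_cast hX1.trans hX
    have hcalls : ∀ B' ∈ cs ++ [B], ∃ l, I.IsSub I.mstar l B' := by
      intro B' h
      rcases List.mem_append.1 h with h | h
      · exact hb.calls _ h
      · rw [List.mem_singleton.1 h]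
        exact ⟨l, hl⟩
    refine ⟨?_, Wp.ite rfl rfl (fun hlt => ?_) (fun hge => ?_)⟩
    · simp only [Expr.eval, ht4, ht0]
      omega
    · simp only [Expr.eval, ht14, ht13] at hlt
      refine Wp.seq (Wp.assign rfl ?_ (Wp.seq (Wp.assign rfl ?_
        (Wp.loop (a := 10) I.n (fun i u ds => ds = cs ++ [B] ∧ u.var 4 = i ∧
          u.var 14 = I.profit (ofArr I.n g) ∧ (∀ v, v ≠ 4 → v ≠ 13 → v ≠ 14 → u.var v = s.var v) ∧
          (∀ a, a ≠ 3 → u.arr a = s₁.arr a) ∧ ∀ k : ℕ, k < i → u.arr 3 k = g k)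
          rfl rfl ?_ ?_ ?_))))
      · simpa [ht13] using hpX
      · simp
      · refine ⟨rfl, by simp, by simp [ht13], fun v h4 h13 h14 => ?_, fun a h3 => ?_, by simp⟩
        · simp [h4, h14, htv v h4 h13]
        · simp [hta]
      · rintro i hi u ds ⟨rfl, hu4, hu14, huv, hua, hu3⟩
        have hu0 := huv 0 (by simp) (by simp) (by simp)
        rw [hs.var0] at hu0
        refine ⟨?_, Wp.le (a := copyBody.flat) (Wp.flat_seq (Wp.flat_store rfl rfl ?_
          (Wp.flat_assign rfl ?_ ⟨rfl, ?_, ?_, ?_, ?_, ?_⟩))) (by decide)⟩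
        · simp only [Expr.eval, hu4, hu0]
          omega
        · simp only [Expr.eval, hu4, hua 5 (by simp), h15 i hi]
          have := hgabs i hi
          omega
        · simp [hu4]
          rw [abs_le]; constructor <;> omega
        · simp [hu4]
        · simp [hu14]
        · intro v h4 h13 h14
          simp [h4, huv v h4 h13 h14]
        · intro a h3
          simp [h3, hua a h3]
        · intro k hk
          simp only [State.setVar_arr, State.setArr_arr, if_true, Expr.eval, hu4,
            hua 5 (by simp), h15 i hi, Function.update_apply]
          split_ifs with h
          · rw [h]
          · exact hu3 k (by omega)
      · rintro u ds ⟨rfl, hu4, hu14, huv, hua, hu3⟩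
        have hu0 := huv 0 (by simp) (by simp) (by simp)
        rw [hs.var0] at hu0
        have hof : ofArr I.n (u.arr 3) = ofArr I.n g := funext fun j => hu3 j j.2
        refine ⟨?_, rfl, ⟨?_, ?_, hcalls, ?_⟩, huv, fun a h3 h5 => ?_⟩
        · simp only [Expr.eval, hu4, hu0]
          omega
        · rw [hof]; exact hgfeas
        · rw [hof]; exact hu14
        · intro B' h g' hg'
          rw [hu14]
          rcases List.mem_append.1 h with h | h
          · have := hb.upper _ h g' hg'
            omega
          · rw [List.mem_singleton.1 h] at hg' ⊢
            exact hgB g' hg'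
        · rw [hua a h3, h1a a h5]
    · simp only [Expr.eval, ht14, ht13] at hge
      refine Wp.le (Wp.skip ?_) (by omega)
      refine ⟨rfl, ⟨?_, ?_, hcalls, ?_⟩, fun v h4 h13 _ => htv v h4 h13, fun a _ h5 => ?_⟩
      · rw [hta, h1a 3 (by simp)]; exact hb.feasible
      · rw [ht14, hta, h1a 3 (by simp)]; exact hb.profit
      · intro B' h g' hg'
        rw [ht14]
        rcases List.mem_append.1 h with h | h
        · exact hb.upper _ h g' hg'
        · rw [List.mem_singleton.1 h] at hg' ⊢
          have := hgB g' hg'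
          omega
      · rw [hta, h1a a h5]


/-- The number of pieces with positive contribution, computed by one division. -/
theorem pieceCount_spec {m : ℕ} {y s : ℤ} (hy : 0 ≤ y) (hs : 0 ≤ s) {K : ℤ}
    (hK : K = if 2 * (s * m) ≤ y + s then (m : ℤ) else (y + s) / (2 * s)) :
    0 ≤ K ∧ K ≤ m ∧ K * y - s * (K * K) = pieceSum m y s := by
  split_ifs at hK with h
  · subst hK
    refine ⟨by omega, le_rfl, ?_⟩
    rw [pieceSum_eq (le_refl m) (fun k hk => ?_) (fun k h1 h2 => absurd h1 (not_le.2 h2))]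
    · ring
    · have : (k : ℤ) + 1 ≤ m := by exact_mod_cast hk
      nlinarith
  -- For s = 0 the test succeeds and all m pieces count, so the division is executed with a positive
  -- divisor only.
  · have hspos : 0 < s := by
      rcases hs.eq_or_lt with h0 | h0
      · rw [← h0] at h
        simp [hy] at h
      · exact h0
    have hK0 : 0 ≤ K := by rw [hK]; exact Int.ediv_nonneg (by omega) (by omega)
    have hKm : K ≤ m := by
      rw [hK]
      refine Int.le_of_lt (Int.ediv_lt_of_lt_mul (by omega) ?_)
      linarith
    have h1 : K * (2 * s) ≤ y + s := by rw [hK]; exact Int.ediv_mul_le _ (by omega)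
    have h2 : y + s < (K + 1) * (2 * s) := by
      rw [hK]; exact Int.lt_ediv_add_one_mul_self _ (by omega)
    refine ⟨hK0, hKm, ?_⟩
    clear hK
    obtain ⟨K, rfl⟩ := Int.eq_ofNat_of_zero_le hK0
    rw [pieceSum_eq (K := K) (by omega) (fun k hk => ?_) (fun k hk _ => ?_)]
    · ring
    · have : (k : ℤ) + 1 ≤ K := by exact_mod_cast hk
      nlinarith
    · have : (K : ℤ) ≤ k := by exact_mod_cast hk
      nlinarith

theorem pieceSum_le_mul {m : ℕ} {y s : ℤ} (hy : 0 ≤ y) (hs : 0 ≤ s) : pieceSum m y s ≤ m * y := by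
  obtain ⟨K, hK, e⟩ := exists_pieceSum_eq m y hs
  rw [e]
  have : (K : ℤ) ≤ m := by exact_mod_cast hK
  nlinarith [sq_nonneg (K : ℤ)]

/-! ### The integer data of `B_l` in memory -/

namespace SOCKP

theorem pairWeight_nonneg (m : ℕ) (i j : Fin I.n) (h : ℕ) : 0 ≤ I.pairWeight m i j h := by
  have := pieceSum_nonneg m ((I.σ j : ℤ) * (2 * h + 1)) (I.σ i)
  unfold pairWeight
  positivity

theorem pairWeight_le (i j : Fin I.n) {h : ℕ} (hh : h < I.mstar) :
    I.pairWeight I.mstar i j h ≤ I.regBound := by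
  obtain ⟨-, -, -, -, -, -, -, -, hle⟩ := le_regBound (I := I)
  have h1 : pieceSum I.mstar ((I.σ j : ℤ) * (2 * h + 1)) (I.σ i)
      ≤ I.mstar * (I.maxCoeff * (2 * I.mstar)) := by
    refine (pieceSum_le_mul (by positivity) (by positivity)).trans ?_
    have := σ_le j
    gcongr
    omega
  have h2 : (I.mstar : ℤ) * (2 * h + 1) * I.a j ≤ I.mstar * (2 * I.mstar) * I.maxCoeff := by
    have := a_le j
    gcongr
    omega
  have h3 : (I.Ω : ℤ) * pieceSum I.mstar ((I.σ j : ℤ) * (2 * h + 1)) (I.σ i)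
      ≤ I.maxCoeff * (I.mstar * (I.maxCoeff * (2 * I.mstar))) := by
    have := Ω_le (I := I)
    have := pieceSum_nonneg I.mstar ((I.σ j : ℤ) * (2 * h + 1)) (I.σ i : ℤ)
    gcongr
  have h4 : ((2 * I.mstar ^ 2 * I.maxCoeff + 2 * I.mstar ^ 2 * I.maxCoeff ^ 2 : ℕ) : ℤ)
      ≤ I.regBound := by exact_mod_cast hle
  push_cast at h4
  unfold pairWeight
  linarith

theorem abs_pairCap_le (i : Fin I.n) {h : ℕ} (hh : h < I.mstar) :
    |(I.mstar * (2 * h + 1) * I.b - I.Ω * I.σ i * (I.mstar * I.mstar) : ℤ)| ≤ I.regBound := by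
  obtain ⟨-, -, -, -, -, -, -, -, hle⟩ := le_regBound (I := I)
  have h1 : (I.mstar : ℤ) * (2 * h + 1) * I.b ≤ I.mstar * (2 * I.mstar) * I.maxCoeff := by
    have := b_le (I := I)
    gcongr
    omega
  have h2 : (I.Ω : ℤ) * I.σ i * (I.mstar * I.mstar)
      ≤ I.maxCoeff * I.maxCoeff * (I.mstar * I.mstar) := by
    have := Ω_le (I := I)
    have := σ_le i
    gcongr
  have h3 : (0 : ℤ) ≤ (I.mstar : ℤ) * (2 * h + 1) * I.b := by positivity
  have h4 : (0 : ℤ) ≤ (I.Ω : ℤ) * I.σ i * (I.mstar * I.mstar) := by positivity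
  have h5 : ((2 * I.mstar ^ 2 * I.maxCoeff + 2 * I.mstar ^ 2 * I.maxCoeff ^ 2 : ℕ) : ℤ)
      ≤ I.regBound := by exact_mod_cast hle
  have h6 : (0 : ℤ) ≤ (I.mstar : ℤ) ^ 2 * I.maxCoeff ^ 2 := by positivity
  have h7 : (0 : ℤ) ≤ (I.mstar : ℤ) ^ 2 * I.maxCoeff := by positivity
  push_cast at h5
  rw [abs_le]
  constructor <;> linarith

/-- The memory contains the problem `B_l` for a pair `l`. -/
theorem isSub_pair {s : State} (hs : I.Ctx s) (i : Fin I.n) (h : Fin I.mstar)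
    (hc : s.var 12 = I.mstar * (2 * h + 1) * I.b - I.Ω * I.σ i * (I.mstar * I.mstar))
    (hc0 : 0 ≤ s.var 12)
    (hw : ∀ (k : ℕ) (hk : k < I.n), s.arr 4 k = I.pairWeight I.mstar i ⟨k, hk⟩ h) :
    I.IsSub I.mstar (some (i, h)) (s.readBKP 0 12 4 1) := by
  have hn : (s.readBKP 0 12 4 1).n = I.n := by simp [State.readBKP, hs.var0]
  refine ⟨hn, fun j => ?_, fun j => ?_, ?_⟩
  · simp only [State.readBKP, hs.arr1]
    rw [toArr_of_lt I.p (hn ▸ j.2), Int.toNat_natCast]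
    rfl
  · have e := hw j (hn ▸ j.2)
    have e' : (((s.readBKP 0 12 4 1).w j : ℕ) : ℤ) = I.pairWeight I.mstar i (Fin.cast hn j) h := by
      simp only [State.readBKP, e]
      exact Int.toNat_of_nonneg (pairWeight_nonneg _ _ _ _)
    rw [subScale_mul_subWeight mstar_pos, ← e']
    simp
  · have e' : (((s.readBKP 0 12 4 1).c : ℕ) : ℤ) = s.var 12 := Int.toNat_of_nonneg hc0
    rw [subScale_mul_subCap mstar_pos, ← hc, ← e']
    simp

/-- The memory contains the problem for the additional index. -/
theorem isSub_none {s : State} (hs : I.Ctx s) (hc : s.var 12 = I.b)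
    (hw : ∀ (k : ℕ) (hk : k < I.n), s.arr 4 k = I.a ⟨k, hk⟩ + I.Ω * I.σ ⟨k, hk⟩) :
    I.IsSub I.mstar none (s.readBKP 0 12 4 1) := by
  have hn : (s.readBKP 0 12 4 1).n = I.n := by simp [State.readBKP, hs.var0]
  have hm : (I.mstar : ℚ) ≠ 0 := by exact_mod_cast mstar_pos.ne'
  refine ⟨hn, fun j => ?_, fun j => ?_, ?_⟩
  · simp only [State.readBKP, hs.arr1]
    rw [toArr_of_lt I.p (hn ▸ j.2), Int.toNat_natCast]
    rfl
  · have e := hw j (hn ▸ j.2)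
    have e' : ((s.readBKP 0 12 4 1).w j : ℕ)
        = I.a (Fin.cast hn j) + I.Ω * I.σ (Fin.cast hn j) := by
      simp only [State.readBKP, e]
      rw [← Nat.cast_mul, ← Nat.cast_add, Int.toNat_natCast]
      rfl
    rw [subWeight_none, e', subScale, d]
    push_cast
    field_simp
  · simp [State.readBKP, hc, subScale, subCap]

end SOCKP

theorem pairWeights_wp (hX : I.regBound ≤ E.X) (hs : I.Ctx s) (i : Fin I.n) {h : ℕ}
    (hh : h < I.mstar) (h4 : s.var 4 = 0) (h9 : s.var 9 = 2 * h + 1) (h10 : s.var 10 = I.σ i) :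
    Wp E (forLoop 4 0 pairWeightBody) s cs ((I.n + 1) * 65) fun t ds => ds = cs ∧
      (∀ v, v ≠ 4 → v ≠ 11 → t.var v = s.var v) ∧ (∀ a, a ≠ 4 → t.arr a = s.arr a) ∧
      ∀ (k : ℕ) (hk : k < I.n), t.arr 4 k = I.pairWeight I.mstar i ⟨k, hk⟩ h := by
  obtain ⟨-, hX2, hX3, hX4, -⟩ := le_regBound (I := I)
  refine Wp.loop (a := 60) I.n (fun r t ds => ds = cs ∧ t.var 4 = r ∧
      (∀ v, v ≠ 4 → v ≠ 11 → t.var v = s.var v) ∧ (∀ a, a ≠ 4 → t.arr a = s.arr a) ∧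
      ∀ (k : ℕ) (hk : k < I.n), k < r → t.arr 4 k = I.pairWeight I.mstar i ⟨k, hk⟩ h)
      rfl rfl ⟨rfl, by simp [h4], by simp, by simp, by simp⟩ ?_ ?_
  · rintro r hr t ds ⟨rfl, ht4, htv, hta, htw⟩
    have t0 : t.var 0 = I.n := by rw [htv 0 (by simp) (by simp), hs.var0]
    have t2 : t.var 2 = I.Ω := by rw [htv 2 (by simp) (by simp), hs.var2]
    have t6 : t.var 6 = I.mstar := by rw [htv 6 (by simp) (by simp), hs.var6]
    have t9 : t.var 9 = 2 * h + 1 := by rw [htv 9 (by simp) (by simp), h9]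
    have t10 : t.var 10 = I.σ i := by rw [htv 10 (by simp) (by simp), h10]
    have a0 : t.arr 0 r = I.a ⟨r, hr⟩ := by rw [hta 0 (by simp), hs.arr0, toArr_of_lt]
    have a2 : t.arr 2 r = I.σ ⟨r, hr⟩ := by rw [hta 2 (by simp), hs.arr2, toArr_of_lt]
    -- Common continuation of the two ways in which the number K of pieces is found.
    have rest : ∀ K : ℤ, (0 ≤ K ∧ K ≤ I.mstar ∧
        K * ((I.σ ⟨r, hr⟩ : ℤ) * (2 * h + 1)) - I.σ i * (K * K)
          = pieceSum I.mstar ((I.σ ⟨r, hr⟩ : ℤ) * (2 * h + 1)) (I.σ i)) →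
        Wp E (.seq
          (.store 4 (.var 4)
            (.add (.mul (.mul (.var 6) (.var 9)) (.get 0 (.var 4)))
              (.mul (.var 2) (.sub (.mul (.var 11) (.mul (.get 2 (.var 4)) (.var 9)))
                (.mul (.var 10) (.mul (.var 11) (.var 11)))))))
          (incr 4)) (t.setVar 11 K) ds 27 fun u ds' => ds' = ds ∧ u.var 4 = (r + 1 : ℕ) ∧
            (∀ v, v ≠ 4 → v ≠ 11 → u.var v = s.var v) ∧ (∀ a, a ≠ 4 → u.arr a = s.arr a) ∧
            ∀ (k : ℕ) (hk : k < I.n), k < r + 1 →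
              u.arr 4 k = I.pairWeight I.mstar i ⟨k, hk⟩ h := by
      rintro K ⟨-, -, hK⟩
      have hval : (I.mstar : ℤ) * (2 * h + 1) * I.a ⟨r, hr⟩
          + I.Ω * (K * ((I.σ ⟨r, hr⟩ : ℤ) * (2 * h + 1)) - I.σ i * (K * K))
          = I.pairWeight I.mstar i ⟨r, hr⟩ h := by rw [hK, pairWeight]
      refine Wp.seq (Wp.store rfl rfl ?_ (Wp.assign rfl ?_ ⟨rfl, ?_, ?_, ?_, ?_⟩))
      · simp only [Expr.eval, State.setVar_var, State.setVar_arr, if_true, Nat.reduceEqDiff,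
          if_false, ht4, t2, t6, t9, t10, a0, a2]
        rw [hval]
        have p0 := pairWeight_nonneg I.mstar i ⟨r, hr⟩ h
        have p1 := pairWeight_le i ⟨r, hr⟩ hh
        rw [abs_of_nonneg p0]
        exact p1.trans (by exact_mod_cast hX)
      · simp [ht4]
        rw [abs_le]; constructor <;> omega
      · simp [ht4]
      · intro v h4 h11
        simp [h4, h11, htv v h4 h11]
      · intro a h4
        simp [h4, hta a h4]
      · intro k hk hkr
        simp only [State.setVar_arr, State.setArr_arr, if_true, Expr.eval, State.setVar_var,
          Function.update_apply]
        simp only [Nat.reduceEqDiff, if_false, ht4, t2, t6, t9, t10, a0, a2, hval]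
        by_cases hkr' : k = r
        · subst hkr'
          simp
        · rw [if_neg (by exact_mod_cast hkr')]
          exact htw k hk (by omega)
    have hy : (0 : ℤ) ≤ (I.σ ⟨r, hr⟩ : ℤ) * (2 * h + 1) := by positivity
    have hσ : (0 : ℤ) ≤ I.σ i := by positivity
    refine ⟨?_, Wp.le (a := 23 + 27) (Wp.seq (Wp.ite (a := 11) rfl rfl (fun hc => ?_)
      (fun hc => ?_))) (by decide)⟩
    · simp only [Expr.eval, ht4, t0]
      omega
    all_goals simp only [Expr.eval, ht4, t6, t9, t10, a2] at hc
    · have hK := pieceCount_spec (m := I.mstar) hy hσ (K := I.mstar) (by rw [if_pos hc])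
      refine Wp.le (Wp.assign rfl ?_ ?_) (by decide)
      · simp only [Expr.eval, t6]
        rw [abs_le]; constructor <;> omega
      · simp only [Expr.eval, t6]
        exact rest _ hK
    · have hK := pieceCount_spec (m := I.mstar) hy hσ
        (K := ((I.σ ⟨r, hr⟩ : ℤ) * (2 * h + 1) + I.σ i) / (2 * I.σ i)) (by rw [if_neg hc])
      refine Wp.le (Wp.assign rfl ?_ ?_) (by decide)
      · simp only [Expr.eval, ht4, t9, t10, a2]
        rw [abs_le]; constructor <;> omega
      · simp only [Expr.eval, ht4, t9, t10, a2]
        exact rest _ hK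
  · rintro t ds ⟨rfl, ht4, htv, hta, htw⟩
    have t0 : t.var 0 = I.n := by rw [htv 0 (by simp) (by simp), hs.var0]
    refine ⟨?_, rfl, htv, hta, fun k hk => htw k hk hk⟩
    simp only [Expr.eval, ht4, t0]
    omega

end Knap

/-! ### Correctness and cost of the (SOCKP) program -/

namespace Knap

open SOCKP

variable {I : SOCKP} {E : Env} {s : State} {cs : List BKP}

/-- The index `l` comes before the pair `(i, h)` in the order of treatment. -/
def SOCKP.Before (i h : ℕ) : Option (Fin I.n × Fin I.mstar) → Prop
  | none => True
  | some (i', h') => (i' : ℕ) < i ∨ (i' : ℕ) = i ∧ (h' : ℕ) < h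

/-- All problems `B_l` with `l` before the pair `(i, h)` have been solved. -/
structure SOCKP.Progress (I : SOCKP) (i h : ℕ) (cs : List BKP) (s : State) : Prop where
  ctx : I.Ctx s
  best : I.Best cs s
  var7 : s.var 7 = i
  length : cs.length ≤ 1 + i * I.mstar + h
  covered : ∀ l, Before i h l → 0 ≤ I.subCap I.mstar l → ∃ B ∈ cs, I.IsSub I.mstar l B

theorem pairBody_wp (hn : 0 < I.n) (hE : E.Solves) (hX : I.regBound ≤ E.X) (i : Fin I.n) {h : ℕ}
    (hh : h < I.mstar) (hs : I.Progress i h cs s) (h8 : s.var 8 = h) (h10 : s.var 10 = I.σ i) :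
    Wp E pairBody s cs (160 * (I.n + 1)) fun t ds =>
      I.Progress i (h + 1) ds t ∧ t.var 8 = (h + 1 : ℕ) ∧ t.var 10 = I.σ i := by
  obtain ⟨-, hX2, hX3, hX4, -, -, hX7, -⟩ := le_regBound (I := I)
  have hc := hs.ctx
  have hcap := subScale_mul_subCap (I := I) mstar_pos i ⟨h, hh⟩
  have hsc := subScale_pos (I := I) mstar_pos (some (i, ⟨h, hh⟩))
  obtain ⟨c, hcdef⟩ : ∃ c : ℤ,
      c = I.mstar * (2 * h + 1) * I.b - I.Ω * I.σ i * (I.mstar * I.mstar) := ⟨_, rfl⟩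
  have hcX : |c| ≤ (E.X : ℤ) := by
    rw [hcdef]
    exact (abs_pairCap_le i hh).trans (by exact_mod_cast hX)
  dsimp only at hcap
  rw [← hcdef] at hcap
  -- Shared by the branches with and without a call. Since `subScale` is positive, the scaled
  -- capacity c is nonnegative whenever `subCap` is, so a call is owed only for c ≥ 0.
  have finish : ∀ (t : State) (ds : List BKP), I.Ctx t → I.Best ds t → t.var 7 = s.var 7 →
      t.var 8 = s.var 8 → t.var 10 = s.var 10 → ds.length ≤ cs.length + 1 → cs ⊆ ds →
      (0 ≤ c → ∃ B ∈ ds, I.IsSub I.mstar (some (i, ⟨h, hh⟩)) B) →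
      Wp E (incr 8) t ds 4 fun t ds =>
        I.Progress i (h + 1) ds t ∧ t.var 8 = (h + 1 : ℕ) ∧ t.var 10 = I.σ i := by
    intro t ds t1 t2 t7 t8 t10 tl tsub tc
    refine Wp.assign rfl ?_ ⟨⟨?_, ?_, ?_, ?_, ?_⟩, ?_, ?_⟩
    · simp [t8, h8]
      rw [abs_le]; constructor <;> omega
    · exact t1.congr (fun v hv => by rcases hv with rfl | rfl | rfl | rfl <;> simp) (by simp)
    · exact t2.congr (by simp) (by simp)
    · simp [t7, hs.var7]
    · have := hs.length
      omega
    · intro l hl hl0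
      by_cases hlast : l = some (i, ⟨h, hh⟩)
      · subst hlast
        refine tc ?_
        have := mul_nonneg hsc.le hl0
        rw [hcap] at this
        exact_mod_cast this
      · obtain ⟨B, hB, hB'⟩ := hs.covered l (by
          rcases l with _ | ⟨i', h'⟩
          · trivial
          · rcases hl with hl | ⟨hl1, hl2⟩
            · exact Or.inl hl
            · refine Or.inr ⟨hl1, ?_⟩
              rcases Nat.lt_succ_iff_lt_or_eq.1 hl2 with h3 | h3
              · exact h3
              · exact absurd (congrArg some (Prod.ext (Fin.ext hl1) (Fin.ext h3))) hlast) hl0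
        exact ⟨B, tsub hB, hB'⟩
    · simp [t8, h8]
    · simp [t10, h10]
  refine Wp.le (a := 6 + (14 + ((3 + (2 + ((I.n + 1) * 65 + 60 * (I.n + 1)))) + 4)))
    (Wp.seq (Wp.assign rfl ?_ (Wp.seq (Wp.assign rfl ?_ ?_)))) (by omega)
  · simp [h8]
    rw [abs_le]; constructor <;> omega
  · simp [h8, h10, hc.var6, hc.var1, hc.var2]
    rw [← hcdef]
    exact hcX
  set s₁ := (s.setVar 9 (Expr.eval s (.add (.mul (.const 2) (.var 8)) (.const 1)))) with hs₁
  have e9 : s₁.var 9 = 2 * h + 1 := by simp [hs₁, h8]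
  have ev : ∀ v, v ≠ 9 → s₁.var v = s.var v := fun v hv => by simp [hs₁, hv]
  have ea : s₁.arr = s.arr := rfl
  clear_value s₁
  have e12 : Expr.eval s₁ (.sub (.mul (.mul (.var 6) (.var 9)) (.var 1))
        (.mul (.mul (.var 2) (.var 10)) (.mul (.var 6) (.var 6)))) = c := by
    simp only [Expr.eval, e9, ev 6 (by simp), ev 1 (by simp), ev 2 (by simp), ev 10 (by simp),
      hc.var1, hc.var2, hc.var6, h10]
    rw [hcdef]
  rw [e12]
  refine Wp.seq (Wp.ite rfl rfl (fun hpos => ?_) (fun hneg => ?_))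
  · simp at hpos
    refine Wp.seq (Wp.assign rfl (by simp) (Wp.seq ?_))
    have ctx₂ : I.Ctx ((s₁.setVar 12 c).setVar 4 (Expr.eval (s₁.setVar 12 c) (.const 0))) :=
      hc.congr (fun v hv => by
        rcases hv with rfl | rfl | rfl | rfl <;>
          simp [ev 0 (by simp), ev 1 (by simp), ev 2 (by simp), ev 6 (by simp)]) (by simp [ea])
    refine (pairWeights_wp hX ctx₂ i hh (by simp) (by simp [e9])
      (by simp [ev 10 (by simp), h10])).mono le_rfl ?_
    rintro t ds ⟨rfl, htv, hta, htw⟩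
    have ctx₃ : I.Ctx t := ctx₂.congr
      (fun v hv => htv v (by omega) (by omega)) (fun a ha => hta a (by omega))
    have t12 : t.var 12 = c := by rw [htv 12 (by simp) (by simp)]; simp
    have best₃ : I.Best ds t := hs.best.congr
      (by rw [htv 14 (by simp) (by simp)]; simp [ev 14 (by simp)])
      (by rw [hta 3 (by simp)]; simp [ea])
    have sub₃ := isSub_pair ctx₃ i ⟨h, hh⟩ (by rw [t12, hcdef]) (by rw [t12]; exact hpos) htw
    refine (solveProgram_wp hn hE hX ctx₃ best₃ ⟨_, sub₃⟩).mono le_rfl ?_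
    rintro u ds' ⟨rfl, hub, huv, hua⟩
    refine finish _ _ (ctx₃.congr (fun v hv => huv v (by omega) (by omega) (by omega))
      (fun a ha => hua a (by omega) (by omega))) hub ?_ ?_ ?_ (by simp) (by simp)
      (fun _ => ⟨_, by simp, sub₃⟩)
    · rw [huv 7 (by simp) (by simp) (by simp), htv 7 (by simp) (by simp)]
      simp [ev 7 (by simp)]
    · rw [huv 8 (by simp) (by simp) (by simp), htv 8 (by simp) (by simp)]
      simp [ev 8 (by simp)]
    · rw [huv 10 (by simp) (by simp) (by simp), htv 10 (by simp) (by simp)]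
      simp [ev 10 (by simp)]
  · simp at hneg
    refine Wp.le (Wp.skip ?_) (by omega)
    refine finish _ _ (hc.congr (fun v hv => ?_) (by simp [ea])) (hs.best.congr ?_ (by simp [ea]))
      ?_ ?_ ?_ (by omega) (by simp) (fun h0 => absurd h0 (by omega))
    · rcases hv with rfl | rfl | rfl | rfl <;>
        simp [ev 0 (by simp), ev 1 (by simp), ev 2 (by simp), ev 6 (by simp)]
    · simp [ev 14 (by simp)]
    · simp [ev 7 (by simp)]
    · simp [ev 8 (by simp)]
    · simp [ev 10 (by simp)]

theorem itemBody_wp (hn : 0 < I.n) (hE : E.Solves) (hX : I.regBound ≤ E.X) {i : ℕ} (hi : i < I.n)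
    (hs : I.Progress i 0 cs s) :
    Wp E itemBody s cs (180 * ((I.mstar + 1) * (I.n + 1))) fun t ds =>
      I.Progress (i + 1) 0 ds t := by
  obtain ⟨-, hX2, hX3, hX4, hX5, -, hX7, -⟩ := le_regBound (I := I)
  have hc := hs.ctx
  have e10 : s.arr 2 (s.var 7) = I.σ ⟨i, hi⟩ := by rw [hc.arr2, hs.var7, toArr_of_lt]
  refine Wp.le (a := 3 + (2 + ((I.mstar + 1) * (5 + 160 * (I.n + 1)) + 4)))
    (Wp.seq (Wp.assign rfl ?_ (Wp.seq (Wp.assign rfl (by simp) (Wp.seq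
      (Wp.loop (a := 160 * (I.n + 1)) I.mstar (fun h t ds => I.Progress i h ds t ∧ t.var 8 = h ∧
        t.var 10 = I.σ ⟨i, hi⟩) rfl rfl ⟨⟨?_, ?_, ?_, ?_, ?_⟩, ?_, ?_⟩ ?_ ?_)))))) ?_
  · simp only [Expr.eval, e10]
    have := σ_le (⟨i, hi⟩ : Fin I.n)
    rw [abs_le]; constructor <;> omega
  · exact hc.congr (fun v hv => by rcases hv with rfl | rfl | rfl | rfl <;> simp) (by simp)
  · exact hs.best.congr (by simp) (by simp)
  · simp [hs.var7]
  · exact hs.length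
  · exact hs.covered
  · simp
  · simp [e10]
  · rintro h hh t ds ⟨ht, t8, t10⟩
    refine ⟨?_, pairBody_wp hn hE hX ⟨i, hi⟩ hh ht t8 t10⟩
    simp only [Expr.eval, t8, ht.ctx.var6]
    omega
  · rintro t ds ⟨ht, t8, t10⟩
    refine ⟨?_, Wp.assign rfl ?_ ⟨?_, ?_, ?_, ?_, ?_⟩⟩
    · simp only [Expr.eval, t8, ht.ctx.var6]
      omega
    · simp [ht.var7]
      rw [abs_le]; constructor <;> omega
    · exact ht.ctx.congr (fun v hv => by rcases hv with rfl | rfl | rfl | rfl <;> simp) (by simp)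
    · exact ht.best.congr (by simp) (by simp)
    · simp [ht.var7]
    · have := ht.length
      rw [add_mul]
      omega
    · intro l hl
      refine ht.covered l ?_
      rcases l with _ | ⟨i', h'⟩
      · trivial
      · have := h'.2
        simp only [Before] at hl ⊢
        omega
  · have e1 : (I.mstar + 1) * (5 + 160 * (I.n + 1)) + 9
        ≤ (I.mstar + 1) * (I.n + 1) * 5 + (I.mstar + 1) * (I.n + 1) * 160
          + (I.mstar + 1) * (I.n + 1) * 9 := by
      nlinarith [Nat.zero_le (I.mstar * I.n), Nat.zero_le I.mstar, Nat.zero_le I.n]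
    omega

theorem sumSq_wp (hX : I.regBound ≤ E.X) (h0 : s.var 0 = I.n) (h4 : s.var 4 = 0)
    (h5 : s.var 5 = 0) (h2 : s.arr 2 = toArr I.σ) :
    Wp E (forLoop 4 0 sumSqBody) s cs ((I.n + 1) * 25) fun t ds => ds = cs ∧ t.arr = s.arr ∧
      (∀ v, v ≠ 4 → v ≠ 5 → t.var v = s.var v) ∧ t.var 5 = (∑ j, I.σ j ^ 2 : ℕ) := by
  obtain ⟨-, hX2, hX3, -, -, hX6, -⟩ := le_regBound (I := I)
  refine Wp.loop (a := 20) I.n (fun r t ds => ds = cs ∧ t.arr = s.arr ∧ t.var 4 = r ∧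
    (∀ v, v ≠ 4 → v ≠ 5 → t.var v = s.var v) ∧
    t.var 5 = ∑ j ∈ Finset.range r, toArr I.σ (j : ℤ) * toArr I.σ (j : ℤ)) rfl rfl
    ⟨rfl, rfl, by simp [h4], by simp, by simp [h5]⟩ ?_ ?_
  · rintro r hr t ds ⟨rfl, hta, ht4, htv, ht5⟩
    have t0 := htv 0 (by simp) (by simp)
    refine ⟨?_, Wp.le (a := sumSqBody.flat) (Wp.flat_seq (Wp.flat_assign rfl ?_
      (Wp.flat_assign rfl ?_ ⟨rfl, ?_, ?_, ?_, ?_⟩))) (by decide)⟩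
    · simp only [Expr.eval, ht4, t0, h0]
      omega
    · have hle : ∑ j ∈ Finset.range (r + 1), toArr I.σ (j : ℤ) * toArr I.σ (j : ℤ)
          ≤ I.n * (I.maxCoeff : ℤ) ^ 2 := by
        refine (Finset.sum_le_card_nsmul _ _ ((I.maxCoeff : ℤ) ^ 2) fun j _ => ?_).trans ?_
        · rw [sq]
          exact mul_le_mul (toArr_le I.σ σ_le _) (toArr_le I.σ σ_le _) (toArr_nonneg _ _)
            (by positivity)
        · rw [Finset.card_range, nsmul_eq_mul]
          have : ((r + 1 : ℕ) : ℤ) ≤ I.n := by exact_mod_cast hr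
          gcongr
      have h0' : 0 ≤ ∑ j ∈ Finset.range (r + 1), toArr I.σ (j : ℤ) * toArr I.σ (j : ℤ) :=
        Finset.sum_nonneg fun j _ => mul_self_nonneg _
      rw [Finset.sum_range_succ] at hle h0'
      simp only [Expr.eval, ht4, ht5, hta, h2]
      rw [abs_of_nonneg h0']
      refine hle.trans ?_
      exact_mod_cast hX6.trans hX
    · simp [ht4]
      rw [abs_le]; constructor <;> omega
    · simpa using hta
    · simp [ht4]
    · intro v h4 h5
      simp [h4, h5, htv v h4 h5]
    · rw [Finset.sum_range_succ]
      simp [ht4, ht5, hta, h2]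
  · rintro t ds ⟨rfl, hta, ht4, htv, ht5⟩
    have t0 := htv 0 (by simp) (by simp)
    refine ⟨?_, rfl, hta, htv, ?_⟩
    · simp only [Expr.eval, ht4, t0, h0]
      omega
    · rw [ht5, ← Fin.sum_univ_eq_sum_range (fun j : ℕ => toArr I.σ (j : ℤ) * toArr I.σ (j : ℤ))]
      simp [sq]

theorem piecesProgram_wp (hX : I.regBound ≤ E.X) (h0 : s.var 0 = I.n) (h2 : s.var 2 = I.Ω)
    (h5 : s.var 5 = (∑ j, I.σ j ^ 2 : ℕ)) (h6 : s.var 6 = 0) :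
    Wp E piecesProgram s cs (24 * (I.mstar + 1)) fun t ds => ds = cs ∧ t.arr = s.arr ∧
      (∀ v, v ≠ 6 → t.var v = s.var v) ∧ t.var 6 = I.mstar := by
  obtain ⟨-, -, -, hX4, -⟩ := le_regBound (I := I)
  have hm := mstar_pos (I := I)
  -- The loop test is the negation of `mstar_pred_le_iff`, so the counter stops at m* - 1 and the
  -- final increment yields m*.
  have hcond : ∀ q : ℕ, ((4 * ((q : ℤ) * q) + 1
      ≤ (I.Ω : ℤ) * I.Ω * (I.n * (∑ j, I.σ j ^ 2 : ℕ))) ↔ q + 1 < I.mstar) := by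
    intro q
    rw [← not_le, not_iff_not.2 (mstar_pred_le_iff q), not_le]
    zify
    simp only [sq]
    omega
  refine Wp.le (a := (I.mstar - 1 + 1) * (15 + 4) + 4) (Wp.seq (Wp.loop (a := 4) (I.mstar - 1)
    (fun q t ds => ds = cs ∧ t.arr = s.arr ∧ (∀ v, v ≠ 6 → t.var v = s.var v) ∧ t.var 6 = q)
    rfl rfl ⟨rfl, rfl, by simp, by simp [h6]⟩ ?_ ?_)) (by omega)
  · rintro q hq t ds ⟨rfl, hta, htv, ht6⟩
    refine ⟨?_, Wp.assign rfl ?_ ⟨rfl, ?_, ?_, ?_⟩⟩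
    · simp only [Expr.eval, ht6, htv 0 (by simp), htv 2 (by simp), htv 5 (by simp), h0, h2, h5]
      exact (hcond q).2 (by omega)
    · simp [ht6]
      rw [abs_le]; constructor <;> omega
    · simpa using hta
    · intro v hv
      simp [hv, htv v hv]
    · simp [ht6]
  · rintro t ds ⟨rfl, hta, htv, ht6⟩
    refine ⟨?_, Wp.assign rfl ?_ ⟨rfl, ?_, ?_, ?_⟩⟩
    · simp only [Expr.eval, ht6, htv 0 (by simp), htv 2 (by simp), htv 5 (by simp), h0, h2, h5]
      rw [hcond]
      omega
    · simp [ht6]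
      rw [abs_le]; constructor <;> omega
    · simpa using hta
    · intro v hv
      simp [hv, htv v hv]
    · simp [ht6]
      omega

theorem noneWeights_wp (hX : I.regBound ≤ E.X) (hs : I.Ctx s) (h4 : s.var 4 = 0) :
    Wp E (forLoop 4 0 noneWeightBody) s cs ((I.n + 1) * 25) fun t ds => ds = cs ∧
      (∀ v, v ≠ 4 → t.var v = s.var v) ∧ (∀ a, a ≠ 4 → t.arr a = s.arr a) ∧
      ∀ (k : ℕ) (hk : k < I.n), t.arr 4 k = I.a ⟨k, hk⟩ + I.Ω * I.σ ⟨k, hk⟩ := by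
  obtain ⟨-, hX2, hX3, hX4, -, -, -, -, hX9⟩ := le_regBound (I := I)
  have hm := mstar_pos (I := I)
  refine Wp.loop (a := 20) I.n (fun r t ds => ds = cs ∧ t.var 4 = r ∧
      (∀ v, v ≠ 4 → t.var v = s.var v) ∧ (∀ a, a ≠ 4 → t.arr a = s.arr a) ∧
      ∀ (k : ℕ) (hk : k < I.n), k < r → t.arr 4 k = I.a ⟨k, hk⟩ + I.Ω * I.σ ⟨k, hk⟩)
      rfl rfl ⟨rfl, by simp [h4], by simp, by simp, by simp⟩ ?_ ?_
  · rintro r hr t ds ⟨rfl, ht4, htv, hta, htw⟩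
    have t0 : t.var 0 = I.n := by rw [htv 0 (by simp), hs.var0]
    have t2 : t.var 2 = I.Ω := by rw [htv 2 (by simp), hs.var2]
    have a0 : t.arr 0 r = I.a ⟨r, hr⟩ := by rw [hta 0 (by simp), hs.arr0, toArr_of_lt]
    have a2 : t.arr 2 r = I.σ ⟨r, hr⟩ := by rw [hta 2 (by simp), hs.arr2, toArr_of_lt]
    refine ⟨?_, Wp.le (a := noneWeightBody.flat) (Wp.flat_seq (Wp.flat_store rfl rfl ?_
      (Wp.flat_assign rfl ?_ ⟨rfl, ?_, ?_, ?_, ?_⟩))) (by decide)⟩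
    · simp only [Expr.eval, ht4, t0]
      omega
    · simp only [Expr.eval, ht4, t2, a0, a2]
      have h1 : I.a ⟨r, hr⟩ + I.Ω * I.σ ⟨r, hr⟩ ≤ I.maxCoeff + I.maxCoeff * I.maxCoeff :=
        add_le_add (a_le _) (Nat.mul_le_mul Ω_le (σ_le _))
      have h2 : I.maxCoeff + I.maxCoeff * I.maxCoeff ≤ I.regBound := by
        refine le_trans ?_ hX9
        have : 1 ≤ I.mstar ^ 2 := Nat.one_le_pow _ _ hm
        nlinarith [Nat.zero_le I.maxCoeff, Nat.zero_le (I.maxCoeff ^ 2)]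
      rw [abs_of_nonneg (by positivity)]
      exact_mod_cast h1.trans (h2.trans hX)
    · simp [ht4]
      rw [abs_le]; constructor <;> omega
    · simp [ht4]
    · intro v h4
      simp [h4, htv v h4]
    · intro a h4
      simp [h4, hta a h4]
    · intro k hk hkr
      simp only [State.setVar_arr, State.setArr_arr, if_true, Expr.eval, Function.update_apply,
        ht4, t2, a0, a2]
      by_cases hkr' : k = r
      · subst hkr'
        simp
      · rw [if_neg (by exact_mod_cast hkr')]
        exact htw k hk (by omega)
  · rintro t ds ⟨rfl, ht4, htv, hta, htw⟩
    have t0 : t.var 0 = I.n := by rw [htv 0 (by simp), hs.var0]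
    refine ⟨?_, rfl, htv, hta, fun k hk => htw k hk hk⟩
    simp only [Expr.eval, ht4, t0]
    omega

theorem socProgram_wp (hn : 0 < I.n) (hE : E.Solves) (hX : I.regBound ≤ E.X) :
    Wp E socProgram I.load [] (340 * ((I.n + 1) * ((I.mstar + 1) * (I.n + 1)))) fun t ds =>
      I.Progress I.n 0 ds t := by
  obtain ⟨-, hX2, hX3, hX4, hX5, -, -, -⟩ := le_regBound (I := I)
  refine Wp.le (a := (I.n + 1) * 25 + (24 * (I.mstar + 1) + (2 + ((I.n + 1) * 25 + (2 +
    (60 * (I.n + 1) + (I.n + 1) * (5 + 180 * ((I.mstar + 1) * (I.n + 1)))))))))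
    (Wp.seq ((sumSq_wp hX rfl rfl rfl rfl).mono le_rfl ?_)) ?_
  · rintro t ds ⟨rfl, hta, htv, ht5⟩
    refine Wp.seq ((piecesProgram_wp hX (htv 0 (by simp) (by simp)) (htv 2 (by simp) (by simp)) ht5
      (htv 6 (by simp) (by simp))).mono le_rfl ?_)
    rintro u ds ⟨rfl, hua, huv, hu6⟩
    have hctx : I.Ctx u :=
      ⟨by rw [huv 0 (by simp), htv 0 (by simp) (by simp)]; rfl,
        by rw [huv 1 (by simp), htv 1 (by simp) (by simp)]; rfl,
        by rw [huv 2 (by simp), htv 2 (by simp) (by simp)]; rfl, hu6,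
        by rw [hua, hta]; rfl, by rw [hua, hta]; rfl, by rw [hua, hta]; rfl⟩
    refine Wp.seq (Wp.assign rfl (by simp) (Wp.seq ((noneWeights_wp hX (s := u.setVar 4 0)
      (hctx.congr (fun v hv => by rcases hv with rfl | rfl | rfl | rfl <;> simp) (by simp))
      (by simp)).mono le_rfl ?_)))
    rintro r ds ⟨rfl, hrv, hra, hrw⟩
    have r1 : r.var 1 = I.b := by rw [hrv 1 (by simp)]; simp [hctx.var1]
    have r7 : r.var 7 = 0 := by
      rw [hrv 7 (by simp)]
      simp [huv 7 (by simp), htv 7 (by simp) (by simp)]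
      rfl
    have r14 : r.var 14 = 0 := by
      rw [hrv 14 (by simp)]
      simp [huv 14 (by simp), htv 14 (by simp) (by simp)]
      rfl
    have r3 : r.arr 3 = fun _ => 0 := by
      rw [hra 3 (by simp)]
      simp [hua, hta]
      rfl
    have ctx₂ : I.Ctx (r.setVar 12 I.b) := hctx.congr
      (fun v hv => by
        rcases hv with rfl | rfl | rfl | rfl <;>
          simp [hrv 0 (by simp), hrv 1 (by simp), hrv 2 (by simp), hrv 6 (by simp)])
      (fun a ha => by rw [State.setVar_arr, hra a (by omega)]; simp)
    -- The initial zero memory is the zero vector with profit 0, which is feasible because b ≥ 0.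
    have best₂ : I.Best [] (r.setVar 12 I.b) := by
      constructor
      · simp only [State.setVar_arr, r3]
        exact ⟨fun j => Or.inl rfl, by simp [ofArr]⟩
      · simp [r14, r3, ofArr, SOCKP.profit]
      · simp
      · simp
    have sub₂ := isSub_none ctx₂ (by simp) (by simpa using hrw)
    refine Wp.seq (Wp.assign rfl ?_ (Wp.seq ?_))
    · simp only [Expr.eval, r1]
      have := b_le (I := I)
      rw [abs_le]; constructor <;> omega
    simp only [Expr.eval, r1]
    refine (solveProgram_wp hn hE hX ctx₂ best₂ ⟨_, sub₂⟩).mono le_rfl ?_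
    rintro q ds ⟨rfl, hqb, hqv, hqa⟩
    refine Wp.loop (a := 180 * ((I.mstar + 1) * (I.n + 1))) I.n
      (fun i t ds => I.Progress i 0 ds t) rfl rfl ⟨?_, hqb, ?_, by simp, ?_⟩ ?_ ?_
    · exact ctx₂.congr (fun v hv => hqv v (by omega) (by omega) (by omega))
        (fun a ha => hqa a (by omega) (by omega))
    · rw [hqv 7 (by simp) (by simp) (by simp)]
      simp [r7]
    · intro l hl _
      rcases l with _ | ⟨i', h'⟩
      · exact ⟨_, by simp, sub₂⟩
      · simp [Before] at hl
    · rintro i hi t ds ht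
      refine ⟨?_, itemBody_wp hn hE hX hi ht⟩
      simp only [Expr.eval, ht.var7, ht.ctx.var0]
      omega
    · rintro t ds ht
      refine ⟨?_, ht⟩
      simp only [Expr.eval, ht.var7, ht.ctx.var0]
      omega
  · generalize I.mstar = m
    generalize I.n = n
    have h1 : (n + 1) * 1 ≤ (n + 1) * ((m + 1) * (n + 1)) :=
      Nat.mul_le_mul_left _ (Nat.succ_le_of_lt (by positivity))
    have h2 : (m + 1) * 1 ≤ (m + 1) * ((n + 1) * (n + 1)) :=
      Nat.mul_le_mul_left _ (Nat.succ_le_of_lt (by positivity))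
    have h3 : (m + 1) * ((n + 1) * (n + 1)) = (n + 1) * ((m + 1) * (n + 1)) := by ring
    have h4 : (n + 1) * (5 + 180 * ((m + 1) * (n + 1)))
      = (n + 1) * 5 + 180 * ((n + 1) * ((m + 1) * (n + 1))) := by ring
    omega

end Knap

namespace Knap

open SOCKP

/-! ## Polynomial bounds -/

/-- `f` is bounded by a polynomial in the size `x`. -/
def PolyBounded {ι : Type*} (x f : ι → ℕ) : Prop := ∃ D e : ℕ, ∀ i, f i ≤ D * x i ^ e

namespace PolyBounded

variable {ι : Type*} {x f g : ι → ℕ}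

theorem mono (hg : PolyBounded x g) (h : ∀ i, f i ≤ g i) : PolyBounded x f := by
  obtain ⟨D, e, hD⟩ := hg
  exact ⟨D, e, fun i => (h i).trans (hD i)⟩

theorem const (c : ℕ) : PolyBounded x fun _ => c := ⟨c, 0, fun i => by simp⟩

theorem self : PolyBounded x x := ⟨1, 1, fun i => by simp⟩

theorem add (hx : ∀ i, 1 ≤ x i) (hf : PolyBounded x f) (hg : PolyBounded x g) :
    PolyBounded x fun i => f i + g i := by
  obtain ⟨D, e, hD⟩ := hf
  obtain ⟨D', e', hD'⟩ := hg
  refine ⟨D + D', e + e', fun i => ?_⟩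
  rw [add_mul]
  refine add_le_add ((hD i).trans ?_) ((hD' i).trans ?_)
  · exact Nat.mul_le_mul_left _ (Nat.pow_le_pow_right (hx i) (Nat.le_add_right _ _))
  · exact Nat.mul_le_mul_left _ (Nat.pow_le_pow_right (hx i) (Nat.le_add_left _ _))

theorem mul (hf : PolyBounded x f) (hg : PolyBounded x g) :
    PolyBounded x fun i => f i * g i := by
  obtain ⟨D, e, hD⟩ := hf
  obtain ⟨D', e', hD'⟩ := hg
  refine ⟨D * D', e + e', fun i => (Nat.mul_le_mul (hD i) (hD' i)).trans (le_of_eq ?_)⟩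
  ring

theorem pow (hf : PolyBounded x f) (k : ℕ) : PolyBounded x fun i => f i ^ k := by
  obtain ⟨D, e, hD⟩ := hf
  refine ⟨D ^ k, e * k, fun i => (Nat.pow_le_pow_left (hD i) k).trans (le_of_eq ?_)⟩
  ring

theorem unitCost (hx : ∀ i, 1 ≤ x i) (hf : PolyBounded x f) :
    PolyBounded x fun i => Knap.unitCost (f i) :=
  ((hf.add hx (const 4)).pow _).add hx (const 1)

end PolyBounded

/-! ## The dynamic program -/

theorem solvesBKP_dpProgram : SolvesBKP dpProgram := by
  intro B hB
  obtain ⟨U, hU⟩ : ∃ U : ℕ, ∀ x, B.Feasible x → B.profit x ≤ U := by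
    refine ⟨∑ j, B.p j, fun x hx => ?_⟩
    push_cast
    refine Finset.sum_le_sum fun j _ => ?_
    rcases hx.1 j with h | h <;> simp [h]
  obtain ⟨g, k, h1, h2, -⟩ := dpProgram_runs B hU
  exact ⟨g, k, h1, h2⟩

theorem profitTimeBKP_dpProgram : ProfitTimeBKP dpProgram 800 := by
  intro B hB U hU1 hU g k hk
  obtain ⟨g', k', h1, -, h2, -⟩ := dpProgram_runs B hU
  obtain ⟨-, rfl⟩ := hk.det h1
  refine h2.trans ?_
  -- Here n ≥ 1 and U ≥ 1 absorb the additive constants; 100 · 2 · 4 is the constant 800.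
  have : (B.n + 1) * (U + 3) ≤ (2 * B.n) * (4 * U) := Nat.mul_le_mul (by omega) (by omega)
  calc 100 * ((B.n + 1) * (U + 3)) ≤ 100 * ((2 * B.n) * (4 * U)) := by omega
    _ = 800 * (B.n * U) := by ring

theorem pseudoPolyBKP_dpProgram : PseudoPolyBKP dpProgram := by
  let x : {B : BKP // 0 < B.n} → ℕ := fun B => B.1.n + B.1.maxCoeff
  have hx : ∀ B, 1 ≤ x B := fun B => by have := B.2; simp only [x]; omega
  have hn : PolyBounded x fun B => B.1.n := PolyBounded.self.mono fun B => Nat.le_add_right _ _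
  have hP : PolyBounded x fun B => B.1.maxCoeff :=
    PolyBounded.self.mono fun B => Nat.le_add_left _ _
  have hU := hn.mul hP
  obtain ⟨D, e, hD⟩ := ((PolyBounded.const 100).mul ((hn.add hx (.const 1)).mul
    (hU.add hx (.const 3)))).mul ((((hn.add hx hP).add hx hU).add hx (.const 1)).unitCost hx)
  refine ⟨D, e, fun B hB g k hk => ?_⟩
  -- The crude profit bound of n times the largest coefficient makes the time polynomial.
  obtain ⟨g', k', h1, -, -, h2⟩ := dpProgram_runs B (U := B.n * B.maxCoeff) (by
    intro y hy
    have h : ∀ j ∈ Finset.univ, (B.p j : ℤ) * y j ≤ B.maxCoeff := by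
      intro j _
      have hp : B.p j ≤ B.maxCoeff := le_max_of_le_right (le_max_of_le_right
        (Finset.le_sup (f := B.p) (Finset.mem_univ j)))
      rcases hy.1 j with h | h
      · simp [h]
      · rw [h, mul_one]
        exact_mod_cast hp
    refine (Finset.sum_le_card_nsmul _ _ _ h).trans ?_
    simp)
  obtain ⟨-, rfl⟩ := hk.det h1
  exact h2.trans (hD ⟨B, hB⟩)

/-! ## The reduction -/

open Classical in
/-- The cost of the program `R` on the instance `B`. -/
noncomputable def runCost (R : Cmd) (B : BKP) : Cost :=
  if h : ∃ k g, RunsBKP R B g k then h.choose else ⟨0, 0, []⟩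

theorem RunsBKP.runCost_eq {R : Cmd} {B : BKP} {g : ℤ → ℤ} {k : Cost} (h : RunsBKP R B g k) :
    runCost R B = k := by
  have hex : ∃ k g, RunsBKP R B g k := ⟨k, g, h⟩
  rw [runCost, dif_pos hex]
  obtain ⟨g', hg'⟩ := hex.choose_spec
  exact (hg'.det h).2

/-- A feasible competitor lies in some `B_l`. That problem then has nonnegative capacity, hence was
solved, and its optimal value does not exceed the stored profit. -/
theorem SOCKP.Progress.isOptimal {I : SOCKP} {cs : List BKP} {s : State}
    (h : I.Progress I.n 0 cs s) : I.IsOptimal (ofArr I.n (s.arr 3)) := by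
  refine ⟨h.best.feasible, fun y hy => ?_⟩
  obtain ⟨g, rfl⟩ : ∃ g, ofArr I.n g = y := by
    refine ⟨fun i => if h : i.toNat < I.n then y ⟨i.toNat, h⟩ else 0, funext fun j => ?_⟩
    simp [ofArr]
  obtain ⟨l, hl⟩ := feasible_iff_exists_inSub.1 hy
  obtain ⟨B, hB, hlB⟩ := h.covered l
    (by rcases l with _ | ⟨i, k⟩; exacts [trivial, Or.inl i.2]) (subCap_nonneg_of_inSub hl)
  have := h.best.upper B hB g ((hlB.feasible_iff mstar_pos g).2 hl)
  rw [hlB.profit_eq, h.best.profit] at this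
  exact this

theorem SOCKP.bounded_load (I : SOCKP) : I.load.Bounded I.regBound := by
  obtain ⟨-, hX2, hX3, hX4, hX5, -, -, -⟩ := le_regBound (I := I)
  have hb := b_le (I := I)
  have hΩ := Ω_le (I := I)
  refine ⟨fun v => ?_, fun a i => ?_⟩
  · simp only [SOCKP.load]
    rw [abs_le]
    split_ifs <;> constructor <;> omega
  · have b1 := abs_toArr_le I.a a_le i
    have b2 := abs_toArr_le I.p p_le i
    have b3 := abs_toArr_le I.σ σ_le i
    simp only [SOCKP.load]
    split_ifs
    · omega
    · omega
    · omega
    · simp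

theorem socProgram_runs {R : Cmd} (hR : SolvesBKP R) {I : SOCKP} (hn : 0 < I.n) :
    ∃ g k, RunsSOCKP socProgram R I g k ∧ I.IsOptimal (ofArr I.n g) ∧
      k.calls.length ≤ 2 * (I.mstar * I.n) ∧
      (∀ B ∈ k.calls, ∃ l, I.IsSub I.mstar l B) ∧
      (∀ l, 0 ≤ I.subCap I.mstar l → ∃ B ∈ k.calls, I.IsSub I.mstar l B) ∧
      k.steps ≤ 2720 * (I.mstar * I.n * I.n)
        + (k.calls.map fun B => (runCost R B).steps).sum ∧
      k.bits ≤ 2720 * (I.mstar * I.n * I.n) * unitCost I.regBound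
        + (k.calls.map fun B => (runCost R B).bits).sum := by
  have hE : Env.Solves ⟨RunsBKP R, runCost R, I.regBound⟩ := by
    intro B hB
    obtain ⟨g, k, h1, h2⟩ := hR B hB
    refine ⟨g, ?_, h2⟩
    show RunsBKP R B g (runCost R B)
    rw [h1.runCost_eq]
    exact h1
  have hm := mstar_pos (I := I)
  -- Three factors of the form a + 1 ≤ 2a turn 340 into 2720.
  have hcost : 340 * ((I.n + 1) * ((I.mstar + 1) * (I.n + 1))) ≤ 2720 * (I.mstar * I.n * I.n) := by
    calc 340 * ((I.n + 1) * ((I.mstar + 1) * (I.n + 1)))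
        ≤ 340 * ((2 * I.n) * ((2 * I.mstar) * (2 * I.n))) := by gcongr <;> omega
      _ = 2720 * (I.mstar * I.n * I.n) := by ring
  obtain ⟨t, k, h1, -, h3, h4, h5⟩ :=
    ((socProgram_wp hn hE le_rfl).le hcost) I.bounded_load
  rw [List.nil_append] at h5
  refine ⟨t.arr 3, k, ⟨t, h1, rfl⟩, h5.isOptimal, ?_, h5.best.calls, fun l => h5.covered l ?_, h3,
    h4⟩
  · have := h5.length
    have h6 : 1 ≤ I.mstar * I.n := Nat.mul_pos hm hn
    rw [mul_comm I.n] at this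
    omega
  · rcases l with _ | ⟨i, h⟩
    exacts [trivial, Or.inl i.2]

theorem sum_map_le_length_mul {α : Type*} (l : List α) (f : α → ℕ) {T : ℕ}
    (h : ∀ a ∈ l, f a ≤ T) : (l.map f).sum ≤ l.length * T := by
  have := List.sum_le_card_nsmul (l.map f) T (by simpa using h)
  simpa using this

theorem reductionTime_socProgram {R : Cmd} (hR : SolvesBKP R) :
    ReductionTime socProgram R 2720 := by
  intro I hn T hT g k hk
  obtain ⟨g', k', h1, -, h2, h3, -, h4, -⟩ := socProgram_runs hR hn
  obtain ⟨-, rfl⟩ := hk.det h1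
  have h5 : (k.calls.map fun B => (runCost R B).steps).sum ≤ k.calls.length * T := by
    refine sum_map_le_length_mul _ _ fun B hB => ?_
    obtain ⟨l, hl⟩ := h3 B hB
    have hBn : B.n = I.n := hl.1
    obtain ⟨gB, kB, hB1, -⟩ := hR B (by omega)
    rw [hB1.runCost_eq]
    exact hT l B hl gB kB hB1
  have h6 := Nat.mul_le_mul_right T h2
  have e1 : 2720 * (I.mstar * I.n * (I.n + T))
    = 2720 * (I.mstar * I.n * I.n) + 2 * (I.mstar * I.n) * T + 2718 * (I.mstar * I.n * T) := by ring
  omega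

/-- Clearing denominators enlarges the coefficients only polynomially, so a pseudo-polynomial
subroutine remains so on the problems `B_l`. -/
theorem SOCKP.IsSub.maxCoeff_le {I : SOCKP} {l : Option (Fin I.n × Fin I.mstar)} {B : BKP}
    (h : I.IsSub I.mstar l B) : B.maxCoeff ≤ I.regBound := by
  obtain ⟨-, -, -, -, hP, -, -, -, hW⟩ := le_regBound (I := I)
  have hm := mstar_pos (I := I)
  obtain ⟨hn, hp, hw, hc⟩ := h
  refine max_le ?_ (max_le (Finset.sup_le fun j _ => ?_) (Finset.sup_le fun j _ => ?_))
  · rcases l with _ | ⟨i, h⟩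
    · simp only [subScale, subCap, one_mul] at hc
      have : B.c = I.b := by exact_mod_cast hc
      rw [this]
      exact b_le.trans hP
    · rw [subScale_mul_subCap hm] at hc
      rw [← Int.cast_natCast, Int.cast_inj] at hc
      have := (le_abs_self _).trans (abs_pairCap_le i h.2)
      rw [← hc] at this
      exact_mod_cast this
  · have hj := hw j
    rcases l with _ | ⟨i, h⟩
    · rw [subWeight_none, subScale, d] at hj
      have hm' : (I.mstar : ℚ) ≠ 0 := by exact_mod_cast hm.ne'
      have e : (B.w j : ℚ) = I.a (Fin.cast hn j) + I.Ω * I.σ (Fin.cast hn j) := by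
        rw [hj]; field_simp
      have e' : B.w j = I.a (Fin.cast hn j) + I.Ω * I.σ (Fin.cast hn j) := by exact_mod_cast e
      have h1 : I.a (Fin.cast hn j) + I.Ω * I.σ (Fin.cast hn j)
          ≤ I.maxCoeff + I.maxCoeff * I.maxCoeff :=
        add_le_add (a_le _) (Nat.mul_le_mul Ω_le (σ_le _))
      have h2 : 1 ≤ I.mstar ^ 2 := Nat.one_le_pow _ _ hm
      rw [e']
      refine h1.trans (le_trans ?_ hW)
      nlinarith [Nat.zero_le I.maxCoeff, Nat.zero_le (I.maxCoeff ^ 2)]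
    · rw [subScale_mul_subWeight hm] at hj
      rw [← Int.cast_natCast, Int.cast_inj] at hj
      have := pairWeight_le i (Fin.cast hn j) h.2
      rw [← hj] at this
      exact_mod_cast this
  · rw [hp]
    exact (p_le _).trans hP

/-- With P the largest coefficient, the radicand test of `mstar_pred_le_iff` holds at q = nP²,
because Ω² n ∑ σ_j² is at most (nP²)². -/
theorem SOCKP.mstar_le (I : SOCKP) : I.mstar ≤ I.n * I.maxCoeff ^ 2 + 1 := by
  rw [mstar_pred_le_iff]
  have h1 : ∑ j, I.σ j ^ 2 ≤ I.n * I.maxCoeff ^ 2 := by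
    have := Finset.sum_le_card_nsmul Finset.univ (fun j => I.σ j ^ 2) _
      fun j _ => Nat.pow_le_pow_left (σ_le j) 2
    simpa using this
  calc I.Ω ^ 2 * (I.n * ∑ j, I.σ j ^ 2)
      ≤ I.maxCoeff ^ 2 * (I.n * (I.n * I.maxCoeff ^ 2)) :=
        Nat.mul_le_mul (Nat.pow_le_pow_left Ω_le 2) (Nat.mul_le_mul_left _ h1)
    _ = (I.n * I.maxCoeff ^ 2) ^ 2 := by ring
    _ ≤ 4 * (I.n * I.maxCoeff ^ 2) ^ 2 := by omega

theorem pseudoPolySOCKP_socProgram {R : Cmd} (hR : SolvesBKP R) (hp : PseudoPolyBKP R) :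
    PseudoPolySOCKP socProgram R := by
  obtain ⟨D₀, e₀, hD₀⟩ := hp
  let x : {I : SOCKP // 0 < I.n} → ℕ := fun I => I.1.n + I.1.maxCoeff
  have hx : ∀ I, 1 ≤ x I := fun I => by have := I.2; simp only [x]; omega
  have hn : PolyBounded x fun I => I.1.n := PolyBounded.self.mono fun I => Nat.le_add_right _ _
  have hP : PolyBounded x fun I => I.1.maxCoeff :=
    PolyBounded.self.mono fun I => Nat.le_add_left _ _
  have hm : PolyBounded x fun I => I.1.mstar :=
    ((hn.mul (hP.pow 2)).add hx (.const 1)).mono fun I => I.1.mstar_le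
  have hP1 := (hP.add hx (.const 1)).pow 2
  have hX : PolyBounded x fun I => I.1.regBound :=
    ((((PolyBounded.const 4).mul (hm.pow 2)).mul hP1).add hx (hn.mul hP1)).add hx hm |>.add hx
      (.const 1)
  obtain ⟨D, e, hD⟩ := (((PolyBounded.const 2720).mul ((hm.mul hn).mul hn)).mul
    (hX.unitCost hx)).add hx (((PolyBounded.const 2).mul (hm.mul hn)).mul
      ((PolyBounded.const D₀).mul ((hn.add hx hX).pow e₀)))
  refine ⟨D, e, fun I hI g k hk => ?_⟩
  obtain ⟨g', k', h1, -, h2, h3, -, -, h4⟩ := socProgram_runs hR hI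
  obtain ⟨-, rfl⟩ := hk.det h1
  refine (h4.trans (Nat.add_le_add_left ?_ _)).trans (hD ⟨I, hI⟩)
  refine (sum_map_le_length_mul (T := D₀ * (I.n + I.regBound) ^ e₀) _ _
    fun B hB => ?_).trans (Nat.mul_le_mul_right _ h2)
  obtain ⟨l, hl⟩ := h3 B hB
  have hBn : B.n = I.n := hl.1
  obtain ⟨gB, kB, hB1, -⟩ := hR B (by omega)
  rw [hB1.runCost_eq]
  refine (hD₀ B (by omega) gB kB hB1).trans ?_
  rw [hBn]
  have := hl.maxCoeff_le
  gcongr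

theorem profitTimeSOCKP_socProgram {R : Cmd} (hR : SolvesBKP R) {D : ℕ}
    (hD : ProfitTimeBKP R D) : ProfitTimeSOCKP socProgram R (2720 * (D + 1)) := by
  intro I hn U hU1 hU g k hk
  refine (reductionTime_socProgram hR I hn (D * (I.n * U)) (fun l B hl g' k' hk' => ?_)
    g k hk).trans ?_
  · have hBn : B.n = I.n := hl.1
    rw [← hBn]
    refine hD B (by omega) U hU1 (fun y hy => ?_) g' k' hk'
    obtain ⟨q, rfl⟩ : ∃ q, ofArr B.n q = y := by
      refine ⟨fun i => if h : i.toNat < B.n then y ⟨i.toNat, h⟩ else 0, funext fun j => ?_⟩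
      simp [ofArr]
    rw [hl.profit_eq]
    exact hU l _ ((hl.feasible_iff mstar_pos q).1 hy)
  · calc 2720 * (I.mstar * I.n * (I.n + D * (I.n * U)))
        ≤ 2720 * (I.mstar * I.n * (I.n * U + D * (I.n * U))) := by
          gcongr
          exact Nat.le_mul_of_pos_right _ hU1
      _ = 2720 * (D + 1) * (I.mstar * I.n ^ 2 * U) := by ring

end Knap

/-! ### The main theorem -/

theorem theorem2 :
    ∃ (A : Knap.Cmd) (C : ℕ),
      (∀ R : Knap.Cmd, Knap.SolvesBKP R →
        Knap.SolvesSOCKP A R ∧ Knap.CallsSubproblems A R C ∧ Knap.ReductionTime A R C ∧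
        (Knap.PseudoPolyBKP R → Knap.PseudoPolySOCKP A R)) ∧
      ∃ R : Knap.Cmd,
        Knap.SolvesBKP R ∧ Knap.PseudoPolyBKP R ∧ (∃ D : ℕ, Knap.ProfitTimeBKP R D) ∧
        ∃ E : ℕ, Knap.ProfitTimeSOCKP A R E := by
  refine ⟨Knap.socProgram, 2720, fun R hR => ⟨fun I hI => ?_, fun I hI g k hk => ?_,
    Knap.reductionTime_socProgram hR, Knap.pseudoPolySOCKP_socProgram hR⟩,
    Knap.dpProgram, Knap.solvesBKP_dpProgram, Knap.pseudoPolyBKP_dpProgram,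
    ⟨_, Knap.profitTimeBKP_dpProgram⟩, _,
    Knap.profitTimeSOCKP_socProgram Knap.solvesBKP_dpProgram Knap.profitTimeBKP_dpProgram⟩
  · obtain ⟨g, k, h1, h2, -⟩ := Knap.socProgram_runs hR hI
    exact ⟨g, k, h1, h2⟩
  · obtain ⟨g', k', h1, -, h2, h3, h4, -⟩ := Knap.socProgram_runs hR hI
    obtain ⟨-, rfl⟩ := hk.det h1
    exact ⟨h2.trans (Nat.mul_le_mul_right _ (by norm_num)), h3, h4⟩
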